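/- Partitions are identified with their Young diagrams. Let $s_\lambda=\sum_T x^T$ (sum over semistandard $\lambda$-tableaux $T$) be the Schur function in infinitely many variables. For symmetric functions $f$ and $g=x^{u_0}+x^{u_1}+\cdots$ (a sum of monomials) let $f\circ g=f(x^{u_0},x^{u_1},\dots)$ denote plethysm. The plethysm coefficients $p^\lambda_{\nu,\mu}\in\mathbb Z$ are defined by $s_\nu\circ s_\mu=\sum_\lambda p^\lambda_{\nu,\mu}s_\lambda$. For partitions $\lambda,\theta$ let $\lambda+\theta=(\lambda_1+\theta_1,\lambda_2+\theta_2,\dots)$. Let $k$ be a field of characteristic zero (for instance $\mathbb C$). For a partition $\nu$ of $n$ let $S^\nu$ be the Specht module of $\mathfrak S_n$ over $k$, and let $H_\nu^{(m^n)}=(\mathrm{Inf}\,S^\nu)\uparrow_{\mathfrak S_m\wr\mathfrak S_n}^{\mathfrak S_{mn}}$ be the twisted Foulkes module, where $\mathrm{Inf}$ is inflation along $\mathfrak S_m\wr\mathfrak S_n\to\mathfrak S_n$. Write $[H_\nu^{(m^n)}:S^\lambda]=\dim\mathrm{Hom}_{k\mathfrak S_{mn}}(S^\lambda,H_\nu^{(m^n)})$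 for the multiplicity of $S^\lambda$ in it; this is the representation-theoretic form of $p^\lambda_{\nu,(m)}$. **Theorem.** Let $m,n\ge 0$ and let $\lambda=(\lambda_1,\dots,\lambda_\ell)$ be a partition of $mn$. 1. The function $s_{(n)}\circ s_{(1^m)}$ has a unique expansion as a finite integral linear combination of Schur functions, and $$p^\lambda_{(n),(1^m)}\le p^{\lambda+(1^m)}_{(n+1),(1^m)}.$$ 2. Let $\tilde\lambda=(\lambda_1,\dots,\lambda_q,m,\lambda_{q+1},\dots,\lambda_\ell)$, where $q\ge0$ is minimal with $\lambda_{q+1}\le m$ (parts beyond $\lambda_\ell$ being $0$). - If $m$ is even, then $[H_{(n)}^{(m^n)}:S^\lambda]\le[H_{(n+1)}^{(m^{n+1})}:S^{\tilde\lambda}]$ (Foulkes modules). - If $m$ is odd, then $[H_{(1^n)}^{(m^n)}:S^\lambda]\le[H_{(1^{n+1})}^{(m^{n+1})}:S^{\tilde\lambda}]$ (signed Foulkes modules). -/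

import Mathlib

/-! Partitions are Young diagrams (Mathlib's `YoungDiagram`, English notation, indices from `0`):
`lam.rowLen i` is the part `λ_{i+1}` and `lam.card` is the size `|λ|`. -/

/-- The one-row partition `(n)` (empty for `n = 0`). -/
def rowShape (n : ℕ) : YoungDiagram :=
  YoungDiagram.ofRowLens [n] (List.Pairwise.sortedGE (List.pairwise_singleton _ n))

/-- The one-column partition `(1^m)` (empty for `m = 0`). -/
def colShape (m : ℕ) : YoungDiagram :=
  YoungDiagram.ofRowLens (List.replicate m 1)
    (List.Pairwise.sortedGE (List.pairwise_replicate.2 (Or.inr le_rfl)))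

/-- The sum of partitions `λ + θ = (λ₁ + θ₁, λ₂ + θ₂, …)`. -/
def addShape (lam theta : YoungDiagram) : YoungDiagram :=
  YoungDiagram.ofRowLens
    ((List.range (max (lam.colLen 0) (theta.colLen 0))).map
      fun i => lam.rowLen i + theta.rowLen i)
    (List.Pairwise.sortedGE (by
      rw [List.pairwise_map]
      refine List.pairwise_lt_range.imp ?_
      intro i j hij
      exact Nat.add_le_add (lam.rowLen_anti i j hij.le) (theta.rowLen_anti i j hij.le)))

/-- The partition `λ̃ = (λ₁, …, λ_q, m, λ_{q+1}, …, λ_ℓ)`, where `q` is minimal with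
`λ_{q+1} ≤ m`: a new row of length `m` is inserted in front of the first row that is not longer
than `m`. -/
def insertRow (m : ℕ) (lam : YoungDiagram) : YoungDiagram :=
  YoungDiagram.ofRowLens (lam.rowLens.orderedInsert (fun a b => a ≥ b) m)
    (List.Pairwise.sortedGE (List.Pairwise.orderedInsert m _ lam.rowLens_sorted.pairwise))

noncomputable section

/-! ### Schur functions and plethysm -/

/-- The content of a semistandard tableau: the exponent of the monomial `x^T`. -/
def content {lam : YoungDiagram} (T : SemistandardYoungTableau lam) : ℕ →₀ ℕ :=
  ∑ c ∈ lam.cells, Finsupp.single (T c.1 c.2) 1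

/-- The Schur function `s_λ = ∑_T x^T` in the variables `x_0, x_1, x_2, …`, as a formal power
series: the coefficient of `x^d` is the number of semistandard `λ`-tableaux of content `d`. -/
def schur (R : Type) [Semiring R] (lam : YoungDiagram) : MvPowerSeries ℕ R :=
  fun d => (Nat.card {T : SemistandardYoungTableau lam // content T = d} : R)

/-- The monomials of a power series `g` with natural number coefficients, each one repeated as
often as its coefficient says; so `g = ∑_u x^{u.1}` over `u : MonomialIndex g`. -/
abbrev MonomialIndex (g : MvPowerSeries ℕ ℕ) : Type :=
  Σ d : ℕ →₀ ℕ, Fin (MvPowerSeries.coeff d g)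

/-- The plethysm `f ∘ g` of a symmetric function `f` and a symmetric function `g` with natural
number coefficients (such as a Schur function): if `g = x^{u_0} + x^{u_1} + ⋯` is written as a sum
of monomials, then `f ∘ g = f (x^{u_0}, x^{u_1}, …)`. As `f` is symmetric, the enumeration of
the monomials of `g` (variables that number no monomial are set to `0`) is irrelevant.
The monomial `y^e` of `f` contributes to the coefficient of `x^d` if `∑_u e_u u = d`. -/
def plethysm (f : MvPowerSeries ℕ ℤ) (g : MvPowerSeries ℕ ℕ) : MvPowerSeries ℕ ℤ :=
  fun d => ∑ᶠ e : {e : MonomialIndex g →₀ ℕ // (e.sum fun u k => k • u.1) = d},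
    MvPowerSeries.coeff (e.1.mapDomain Encodable.encode) f

/-- `F = ∑_λ c_λ s_λ`, a finite integral linear combination of Schur functions. -/
def IsSchurExpansion (F : MvPowerSeries ℕ ℤ) (c : YoungDiagram →₀ ℤ) : Prop :=
  F = c.sum fun lam a => a • schur ℤ lam

open Classical in
/-- The plethysm coefficient `p^λ_{ν,μ}`: the coefficient of `s_λ` in the expansion of
`s_ν ∘ s_μ` into Schur functions. -/
def plethysmCoeff (nu mu lam : YoungDiagram) : ℤ :=
  if h : ∃ c, IsSchurExpansion (plethysm (schur ℤ nu) (schur ℕ mu)) c then h.choose lam else 0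

/-! ### Specht modules and twisted Foulkes modules

The symmetric group on a finite set `α` is `Equiv.Perm α`; modules are left modules over a field
`k` (of characteristic zero, for instance `ℂ`). -/

section Specht

variable (k : Type*) [Field k] (lam : YoungDiagram) (α : Type) [Fintype α] [DecidableEq α]

/-- A `λ`-tableau with (distinct) entries `α`: a bijective filling of the cells of `λ`. -/
abbrev Tableau : Type := {c : ℕ × ℕ // c ∈ lam.cells} ≃ α

variable {lam α}

/-- The tabloid `{t}` of a `λ`-tableau, recorded as the function that sends each entry to the
index of its row: two tableaux have the same tabloid iff they are row equivalent. -/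
def Tableau.tabloid (t : Tableau lam α) : α → ℕ := fun a => (t.symm a).1.1

/-- `π` belongs to the column stabiliser `C_t` of `t`: it moves entries only within their
columns. -/
def Tableau.IsColStab (t : Tableau lam α) (π : Equiv.Perm α) : Prop :=
  ∀ a, (t.symm (π a)).1.2 = (t.symm a).1.2

open Classical in
/-- The polytabloid `e_t = ∑_{π ∈ C_t} sgn(π) {π t}`. -/
def Tableau.polytabloid (t : Tableau lam α) : (α → ℕ) →₀ k :=
  ∑ π : Equiv.Perm α with t.IsColStab π,
    Finsupp.single (Tableau.tabloid (lam := lam) (t.trans π)) ((Equiv.Perm.sign π : ℤ) : k)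

variable (α) in
/-- The permutation action of the symmetric group on the space spanned by all row functions
`α → ℕ`; it contains each Young permutation module `M^λ` as the span of the `λ`-tabloids. -/
def rowFunctionRep : Representation k (Equiv.Perm α) ((α → ℕ) →₀ k) where
  toFun σ := Finsupp.lmapDomain k k fun r a => r (σ⁻¹ a)
  map_one' := by
    ext r
    simp
  map_mul' σ τ := by
    ext r
    simp [Finsupp.mapDomain_single]

variable (lam α) in
/-- The Specht module `S^λ`, spanned by all polytabloids. -/
def spechtModule : Submodule k ((α → ℕ) →₀ k) :=
  Submodule.span k (Set.range fun t : Tableau lam α => t.polytabloid k)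

theorem rowFunctionRep_polytabloid (σ : Equiv.Perm α) (t : Tableau lam α) :
    rowFunctionRep k α σ (t.polytabloid k) = Tableau.polytabloid k (lam := lam) (t.trans σ) := by
  classical
  simp only [Tableau.polytabloid, map_sum]
  refine Finset.sum_equiv (MulAut.conj σ).toEquiv ?_ ?_
  · intro π
    rw [Finset.mem_filter_univ, Finset.mem_filter_univ]
    constructor
    · intro h a
      simpa using h (σ⁻¹ a)
    · intro h a
      simpa using h (σ a)
  · intro π _
    have h1 : Equiv.Perm.sign ((MulAut.conj σ).toEquiv π) = Equiv.Perm.sign π := by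
      simp [mul_right_comm (Equiv.Perm.sign σ)]
    rw [h1]
    simp only [rowFunctionRep, MonoidHom.coe_mk, OneHom.coe_mk, Finsupp.lmapDomain_apply,
      Finsupp.mapDomain_single]
    congr 1
    ext a
    simp only [Tableau.tabloid, Equiv.symm_trans_apply]
    have h2 : σ.symm (((MulAut.conj σ).toEquiv π).symm a) = π.symm (σ⁻¹ a) := by
      change σ⁻¹ ((σ * π * σ⁻¹)⁻¹ a) = π⁻¹ (σ⁻¹ a)
      simp
    rw [h2]

variable (lam α) in
/-- The action of the symmetric group on the Specht module `S^λ`. -/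
def spechtRep : Representation k (Equiv.Perm α) (spechtModule k lam α) where
  toFun σ := (rowFunctionRep k α σ).restrict (p := spechtModule k lam α) (q := spechtModule k lam α) (by
    intro x hx
    induction hx using Submodule.span_induction with
    | mem x h =>
      obtain ⟨t, rfl⟩ := h
      rw [rowFunctionRep_polytabloid]
      exact Submodule.subset_span ⟨_, rfl⟩
    | zero => simp
    | add x y _ _ hx hy => rw [map_add]; exact add_mem hx hy
    | smul a x _ hx => rw [map_smul]; exact Submodule.smul_mem _ a hx)
  map_one' := by
    ext x
    simp
  map_mul' σ τ := by
    ext x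
    simp

end Specht

/-- The wreath product `𝔖_m ≀ 𝔖_n = (𝔖_m)^n ⋊ 𝔖_n`. -/
abbrev Wreath (m n : ℕ) : Type :=
  (Fin n → Equiv.Perm (Fin m)) ⋊[mulAutArrow] Equiv.Perm (Fin n)

/-- The embedding of `𝔖_m ≀ 𝔖_n` into `𝔖_{mn}`, the symmetric group on the `mn` points
`Fin n × Fin m`, which are arranged in `n` blocks of size `m`. -/
def wreathHom (m n : ℕ) : Wreath m n →* Equiv.Perm (Fin n × Fin m) where
  toFun w :=
    { toFun := fun x => (w.right x.1, w.left (w.right x.1) x.2)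
      invFun := fun x => (w.right⁻¹ x.1, (w.left x.1)⁻¹ x.2)
      left_inv := fun x => by simp
      right_inv := fun x => by simp }
  map_one' := by
    ext x <;> simp
  map_mul' v w := by
    have key : ∀ i, mulAutArrow v.right w.left (v.right i) = w.left i := fun i => by
      change w.left (v.right⁻¹ (v.right i)) = w.left i
      simp
    ext x
    · simp
    · simp only [SemidirectProduct.mul_left, SemidirectProduct.mul_right, Equiv.coe_fn_mk,
        Equiv.Perm.mul_apply, Pi.mul_apply, key]

/-- The module `(Inf X)↑` of `𝔖_{mn}`: an `𝔖_n`-module `X` is inflated along the surjection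
`𝔖_m ≀ 𝔖_n → 𝔖_n` and then induced from `𝔖_m ≀ 𝔖_n` to `𝔖_{mn}`. -/
def inducedInflation {k V : Type*} [Field k] [AddCommGroup V] [Module k V] (m n : ℕ)
    (ρ : Representation k (Equiv.Perm (Fin n)) V) :
    Representation k (Equiv.Perm (Fin n × Fin m))
      (Representation.IndV (wreathHom m n)
        (ρ.comp (SemidirectProduct.rightHom : Wreath m n →* Equiv.Perm (Fin n)))) :=
  Representation.ind (wreathHom m n)
    (ρ.comp (SemidirectProduct.rightHom : Wreath m n →* Equiv.Perm (Fin n)))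

/-- The twisted Foulkes module `H_ν^{(m^n)} = (Inf S^ν)↑`. -/
abbrev twistedFoulkes (k : Type*) [Field k] (m n : ℕ) (nu : YoungDiagram) :=
  inducedInflation (V := spechtModule k nu (Fin n)) m n (spechtRep k nu (Fin n))

/-- The multiplicity of the irreducible module `S^λ` as a composition factor of
`H_ν^{(m^n)}`, that is, the dimension of `Hom(S^λ, H_ν^{(m^n)})`. -/
def twistedFoulkesMult (k : Type*) [Field k] (m n : ℕ) (nu lam : YoungDiagram) : ℕ :=
  Module.finrank k
    (Representation.IntertwiningMap (spechtRep k lam (Fin n × Fin m)) (twistedFoulkes k m n nu))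

end

/-!
The plethysm `s_{(n)} ∘ s_{(1^m)}` is the character of `Symⁿ(Λᵐ V)`, where `V` has a basis of
letters `0, 1, 2, …`, and its coefficient at `s_λ` is the dimension of the space of highest weight
vectors of weight `λ`. The algebra `⊕ₙ Symⁿ(Λᵐ V)` is a polynomial ring, hence a domain, on which the
raising operators act as derivations, and `0 ∧ 1 ∧ ⋯ ∧ (m - 1)` is a highest weight vector of weight
`(1^m)`. Multiplication by this element is therefore an injective map from the highest weight vectors
of weight `λ` in degree `n` to those of weight `λ + (1^m)` in degree `n + 1` (`foulkesMult_le`).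

The passage between characters, highest weight vectors and Specht modules is Schur–Weyl duality, made
explicit on the space spanned by the words `α → ℕ`, which contains the Specht modules of the symmetric
group of `α`. The highest weight vectors of weight `λ` in it are exactly the Specht module `S^λ`
(`hwSpace_eq_spechtModule`), so that the highest weight vectors of `Symⁿ(Λᵐ V)` are the vectors of
`S^λ` on which the wreath product acts by the linear character `wreathSign`; their dimension is
`foulkesMult`. That `foulkesMult` gives the plethysm coefficients (`plethysmCoeff_eq`) follows from
Young's rule (`finrank_invariants_eq_kostka`): the number of monomials of weight `d` in
`Symⁿ(Λᵐ V)` is `∑_λ K_{λ,d} · foulkesMult λ` (`card_wedgeExponents`), where the orthonormality and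
completeness of the Specht modules are used (`finrank_hom_specht`, `exists_hom_specht`). The same
formula proves that the expansion into Schur functions exists; uniqueness holds as the Kostka
numbers are unitriangular (`linearIndependent_schur`).

For the twisted Foulkes modules, Frobenius reciprocity and the isomorphism of `S^λ` with the sign
twist of `S^{λ'}` show that the multiplicities of `S^λ` are `foulkesMult λ'`, for the trivial module
if `m` is even and for the sign module if `m` is odd, because the sign of an element of the wreath
product that permutes the blocks by `σ` is its `wreathSign` times `sgn(σ)ᵐ`
(`twistedFoulkesMult_eq`). Adding a column `(1^m)` to `λ'` inserts a row of length `m` into `λ`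
(`insertRow_eq`).
-/

noncomputable section

set_option linter.unusedSectionVars false

/-! ### Words and raising operators -/

/-- The additive group structure on a submodule of finitely supported functions whose additive
monoid structure is, reducibly, the one inherited from the module; the instance that is found
otherwise lacks this property. -/
instance (priority := high) submoduleFinsuppAddCommGroup {k β : Type*} [Field k]
    (S : Submodule k (β →₀ k)) : AddCommGroup S :=
  Module.addCommMonoidToAddCommGroup k

section Words

open Finset

variable {k : Type*} [Field k] {α : Type} [Fintype α] [DecidableEq α]

/-- The weight of a word `f : α → ℕ`: the multiplicity of each letter. -/
def wordWeight (f : α → ℕ) : ℕ →₀ ℕ := ∑ a, Finsupp.single (f a) 1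

/-- The number of occurrences of the letter `p` of the word `f` at the positions in `P`. -/
def letterCount (P : Finset α) (f : α → ℕ) (p : ℕ) : ℕ := #{a ∈ P | f a = p}

theorem wordWeight_apply (f : α → ℕ) (p : ℕ) : wordWeight f p = letterCount univ f p := by
  simp [wordWeight, letterCount, Finsupp.finsetSum_apply, Finsupp.single_apply]

variable (k α) in
/-- The span of the words of weight `d`; for a partition `d` this is the Young permutation
module. -/
def weightSpace (d : ℕ →₀ ℕ) : Submodule k ((α → ℕ) →₀ k) :=
  Finsupp.supported k k {f | wordWeight f = d}

theorem mem_weightSpace {d : ℕ →₀ ℕ} {v : (α → ℕ) →₀ k} :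
    v ∈ weightSpace k α d ↔ ∀ f, v f ≠ 0 → wordWeight f = d := by
  simp [weightSpace, Finsupp.mem_supported, Set.subset_def]

/-- The operator on words that sums over all ways to change one letter `p` at a position
in `P` into a `q`. -/
def letterOp (P : Finset α) (p q : ℕ) : ((α → ℕ) →₀ k) →ₗ[k] ((α → ℕ) →₀ k) :=
  Finsupp.linearCombination k fun f =>
    ∑ a ∈ P with f a = p, Finsupp.single (Function.update f a q) 1

theorem letterOp_single (P : Finset α) (p q : ℕ) (f : α → ℕ) (c : k) :
    letterOp P p q (Finsupp.single f c) =
      ∑ a ∈ P with f a = p, Finsupp.single (Function.update f a q) c := by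
  simp [letterOp, Finsupp.linearCombination_single, Finset.smul_sum]

theorem letterOp_apply (P : Finset α) {p q : ℕ} (v : (α → ℕ) →₀ k) (u : α → ℕ) :
    letterOp P p q v u = ∑ a ∈ P with u a = q, v (Function.update u a p) := by
  classical
  induction v using Finsupp.induction_linear with
  | zero => simp
  | add v w hv hw => simp [hv, hw, Finset.sum_add_distrib]
  | single f c =>
    rw [letterOp_single, Finsupp.finsetSum_apply, Finset.sum_filter, Finset.sum_filter]
    refine Finset.sum_congr rfl fun a _ => ?_
    simp only [Finsupp.single_apply]
    by_cases h1 : f a = p ∧ Function.update f a q = u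
    · obtain ⟨h1, rfl⟩ := h1
      simp [← h1]
    · by_cases h2 : u a = q ∧ f = Function.update u a p
      · obtain ⟨rfl, rfl⟩ := h2
        simp at h1
      · have e1 : (if f a = p then if Function.update f a q = u then c else 0 else 0) = 0 := by
          split_ifs <;> simp_all
        have e2 : (if u a = q then if f = Function.update u a p then c else 0 else 0) = 0 := by
          split_ifs <;> simp_all
        rw [e1, e2]

theorem letterCount_update_source {P : Finset α} {f : α → ℕ} {a : α} (ha : a ∈ P) {p q : ℕ}
    (hpq : p ≠ q) (hf : f a = p) :
    letterCount P (Function.update f a q) p + 1 = letterCount P f p := by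
  unfold letterCount
  have h : ({b ∈ P | f b = p} : Finset α) =
      insert a {b ∈ P | Function.update f a q b = p} := by
    ext b
    by_cases hb : b = a
    · subst hb; simp [ha, hf]
    · simp [hb]
  rw [h, Finset.card_insert_of_notMem (by simp [hpq.symm])]

theorem letterCount_update_target {P : Finset α} {f : α → ℕ} {a : α} (ha : a ∈ P) {p q : ℕ}
    (hpq : p ≠ q) (hf : f a = p) :
    letterCount P (Function.update f a q) q = letterCount P f q + 1 := by
  have := letterCount_update_source (f := Function.update f a q) ha hpq.symm (by simp)
  rw [← this]
  simp [← hf]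

/-- The commutation relation `[e, f] = h` of `sl₂` for the operators that exchange `p` and `q`. -/
theorem letterOp_comm (P : Finset α) {p q : ℕ} (hpq : p ≠ q) (f : α → ℕ) :
    letterOp P p q (letterOp P q p (Finsupp.single f (1 : k))) + (letterCount P f p : k) •
        Finsupp.single f 1 =
      letterOp P q p (letterOp P p q (Finsupp.single f (1 : k))) + (letterCount P f q : k) •
        Finsupp.single f 1 := by
  have key : ∀ p q : ℕ, p ≠ q → letterOp P p q (letterOp P q p (Finsupp.single f (1 : k))) =
      (letterCount P f q : k) • Finsupp.single f 1 + ∑ a ∈ P with f a = q, ∑ b ∈ P with f b = p,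
        Finsupp.single (Function.update (Function.update f a p) b q) 1 := by
    intro p q hpq
    simp only [letterOp_single, map_sum, letterCount, Finset.card_eq_sum_ones, Nat.cast_sum,
      Finset.sum_smul]
    rw [← Finset.sum_add_distrib]
    refine Finset.sum_congr rfl fun a ha => ?_
    rw [Finset.mem_filter] at ha
    have h : ({b ∈ P | Function.update f a p b = p} : Finset α) =
        insert a {b ∈ P | f b = p} := by
      ext b
      by_cases hb : b = a
      · subst hb; simp [ha]
      · simp [hb]
    rw [h, Finset.sum_insert (by simp [ha.2, hpq.symm])]
    congr 1
    rw [← ha.2]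
    simp
  rw [key p q hpq, key q p hpq.symm, Finset.sum_comm]
  have : ∀ a ∈ ({a ∈ P | f a = p} : Finset α), ∀ b ∈ ({b ∈ P | f b = q} : Finset α),
      Function.update (Function.update f b p) a q =
        Function.update (Function.update f a q) b p := by
    intro a ha b hb
    rw [Finset.mem_filter] at ha hb
    apply Function.update_comm
    rintro rfl
    exact hpq (ha.2.symm.trans hb.2)
  rw [Finset.sum_congr rfl fun a ha => Finset.sum_congr rfl fun b hb => by rw [this a ha b hb]]
  abel

theorem letterOp_comm_of_count (P : Finset α) {p q s : ℕ} (hpq : p ≠ q) {v : (α → ℕ) →₀ k}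
    (hv : ∀ f, v f ≠ 0 → letterCount P f p = letterCount P f q + s) :
    letterOp P p q (letterOp P q p v) + (s : k) • v = letterOp P q p (letterOp P p q v) := by
  have hsum : v = ∑ f ∈ v.support, v f • Finsupp.single f 1 := by
    conv_lhs => rw [← Finsupp.sum_single v]
    simp [Finsupp.sum]
  rw [hsum]
  simp only [map_sum, map_smul, Finset.smul_sum]
  rw [← Finset.sum_add_distrib]
  refine Finset.sum_congr rfl fun f hf => ?_
  have h := letterOp_comm (k := k) P hpq f
  rw [hv f (Finsupp.mem_support_iff.1 hf)] at h
  push_cast at h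
  rw [add_smul, add_comm (_ • _), ← add_assoc] at h
  rw [smul_comm (s : k), ← smul_add]
  congr 1
  exact add_right_cancel h

theorem letterOp_count {P : Finset α} {p q s : ℕ} (hpq : p ≠ q) {v : (α → ℕ) →₀ k}
    (hv : ∀ f, v f ≠ 0 → letterCount P f p = letterCount P f q + s) (f : α → ℕ)
    (hf : letterOp P q p v f ≠ 0) : letterCount P f p = letterCount P f q + (s + 2) := by
  rw [letterOp_apply] at hf
  obtain ⟨a, ha, h⟩ := Finset.exists_ne_zero_of_sum_ne_zero hf
  rw [Finset.mem_filter] at ha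
  have h1 := hv _ h
  have h2 := letterCount_update_source ha.1 hpq ha.2
  have h3 := letterCount_update_target ha.1 hpq ha.2
  omega

/-- A vector that is killed by the raising operator `p ↦ q` cannot have more letters `p` than
letters `q`: the weight of a highest weight vector of a finite-dimensional `sl₂`-module is
nonnegative. -/
theorem eq_zero_of_letterOp_eq_zero [CharZero k] {P : Finset α} {p q s : ℕ} (hpq : p ≠ q)
    (hs : 0 < s) {v : (α → ℕ) →₀ k}
    (hv : ∀ f, v f ≠ 0 → letterCount P f p = letterCount P f q + s)
    (h0 : letterOp P p q v = 0) : v = 0 := by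
  set F : ((α → ℕ) →₀ k) →ₗ[k] ((α → ℕ) →₀ k) := letterOp P q p with hF
  have hcount : ∀ n, ∀ f, (F ^ n) v f ≠ 0 →
      letterCount P f p = letterCount P f q + (s + 2 * n) := by
    intro n
    induction n with
    | zero => simpa using hv
    | succ n ih =>
      intro f hf
      rw [pow_succ', Module.End.mul_apply] at hf
      have := letterOp_count hpq ih f hf
      omega
  -- `e fⁿ⁺¹ v` is a nonzero multiple of `fⁿ v`, while `fⁿ v = 0` for large `n`.
  have hE : ∀ n : ℕ, letterOp P p q ((F ^ (n + 1)) v) = -((n + 1) * (s + n) : k) • (F ^ n) v := by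
    intro n
    induction n with
    | zero =>
      have := letterOp_comm_of_count (k := k) P hpq hv
      rw [h0, map_zero] at this
      simpa using eq_neg_of_add_eq_zero_left this
    | succ n ih =>
      have := letterOp_comm_of_count (k := k) P hpq (hcount (n + 1))
      rw [ih, map_smul, ← hF, ← Module.End.mul_apply F, ← pow_succ', ← Module.End.mul_apply F,
        ← pow_succ'] at this
      rw [eq_sub_of_add_eq this, ← sub_smul]
      congr 1
      push_cast
      ring
  have htop : (F ^ (#P + 1)) v = 0 := by
    by_contra hne
    obtain ⟨f, hf⟩ := Finsupp.ne_iff.1 hne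
    have h1 := hcount _ f hf
    have h2 : letterCount P f p ≤ #P := Finset.card_filter_le _ _
    omega
  have hdown : ∀ n, (F ^ n) v = 0 → v = 0 := by
    intro n
    induction n with
    | zero => simp
    | succ n ih =>
      intro h
      apply ih
      have := hE n
      rw [h, map_zero] at this
      have hne : -((n + 1) * (s + n) : k) ≠ 0 := by
        rw [neg_ne_zero]
        exact_mod_cast (Nat.mul_pos n.succ_pos (by omega : 0 < s + n)).ne'
      exact (smul_eq_zero.1 this.symm).resolve_left hne
  exact hdown _ htop

end Words

/-! ### Specht modules and highest weight vectors -/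

section Specht

open Finset

variable {k : Type*} [Field k] {α : Type} [Fintype α] [DecidableEq α] {lam : YoungDiagram}

theorem rowFunctionRep_single (σ : Equiv.Perm α) (f : α → ℕ) (c : k) :
    rowFunctionRep k α σ (Finsupp.single f c) = Finsupp.single (f ∘ ⇑σ⁻¹) c := by
  simp only [rowFunctionRep, MonoidHom.coe_mk, OneHom.coe_mk, Finsupp.lmapDomain_apply,
    Finsupp.mapDomain_single]
  rfl

theorem rowFunctionRep_apply (σ : Equiv.Perm α) (v : (α → ℕ) →₀ k) (u : α → ℕ) :
    rowFunctionRep k α σ v u = v (u ∘ ⇑σ) := by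
  induction v using Finsupp.induction_linear with
  | zero => simp
  | add v w hv hw => simp [hv, hw]
  | single f c =>
    rw [rowFunctionRep_single]
    simp only [Finsupp.single_apply]
    congr 1
    rw [eq_iff_iff]
    constructor
    · rintro rfl; ext a; simp
    · rintro rfl; ext a; simp

theorem letterOp_rowFunctionRep {p q : ℕ} (σ : Equiv.Perm α) (v : (α → ℕ) →₀ k) :
    letterOp univ p q (rowFunctionRep k α σ v) = rowFunctionRep k α σ (letterOp univ p q v) := by
  ext u
  rw [letterOp_apply, rowFunctionRep_apply, letterOp_apply]
  symm
  refine Finset.sum_equiv σ (by simp) fun a _ => ?_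
  rw [rowFunctionRep_apply]
  congr 1
  ext b
  simp [Function.update_apply]

theorem wordWeight_comp (f : α → ℕ) (σ : Equiv.Perm α) : wordWeight (f ∘ σ) = wordWeight f :=
  Equiv.sum_comp σ fun a => Finsupp.single (f a) 1

theorem rowFunctionRep_mem_weightSpace {d : ℕ →₀ ℕ} (σ : Equiv.Perm α) {v : (α → ℕ) →₀ k}
    (hv : v ∈ weightSpace k α d) : rowFunctionRep k α σ v ∈ weightSpace k α d := by
  rw [mem_weightSpace] at hv ⊢
  intro f hf
  rw [rowFunctionRep_apply] at hf
  rw [← hv _ hf, wordWeight_comp]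

variable (k α) in
/-- The highest weight vectors of weight `d` among the combinations of words: those killed by all
operators that change one letter `i + 1` into `i`. -/
def hwSpace (d : ℕ →₀ ℕ) : Submodule k ((α → ℕ) →₀ k) :=
  weightSpace k α d ⊓ ⨅ i, LinearMap.ker (letterOp univ (i + 1) i)

theorem mem_hwSpace {d : ℕ →₀ ℕ} {v : (α → ℕ) →₀ k} :
    v ∈ hwSpace k α d ↔ v ∈ weightSpace k α d ∧ ∀ i, letterOp univ (i + 1) i v = 0 := by
  simp [hwSpace]

/-- A partition as a weight: the letter `i` has multiplicity `λ_i`. -/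
def rowWeight (lam : YoungDiagram) : ℕ →₀ ℕ := ∑ c ∈ lam.cells, Finsupp.single c.1 1

theorem rowWeight_apply (lam : YoungDiagram) (i : ℕ) : rowWeight lam i = lam.rowLen i := by
  rw [YoungDiagram.rowLen_eq_card, YoungDiagram.row]
  simp [rowWeight, Finsupp.finsetSum_apply, Finsupp.single_apply]

theorem rowWeight_injective : Function.Injective rowWeight := by
  intro lam mu h
  ext ⟨i, j⟩
  rw [YoungDiagram.mem_cells, YoungDiagram.mem_cells, YoungDiagram.mem_iff_lt_rowLen,
    YoungDiagram.mem_iff_lt_rowLen, ← rowWeight_apply, h, rowWeight_apply]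

theorem wordWeight_tabloid (t : Tableau lam α) : wordWeight t.tabloid = rowWeight lam := by
  unfold wordWeight rowWeight Tableau.tabloid
  rw [Equiv.sum_comp t.symm (fun c : {c : ℕ × ℕ // c ∈ lam.cells} => Finsupp.single c.1.1 1),
    ← Finset.sum_coe_sort lam.cells fun c => Finsupp.single c.1 1]

theorem Tableau.IsColStab.inv {t : Tableau lam α} {π : Equiv.Perm α} (h : t.IsColStab π) :
    t.IsColStab π⁻¹ := fun a => by simpa using (h (π⁻¹ a)).symm

theorem Tableau.IsColStab.mul {t : Tableau lam α} {π τ : Equiv.Perm α} (h : t.IsColStab π)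
    (h' : t.IsColStab τ) : t.IsColStab (π * τ) := fun a => (h (τ a)).trans (h' a)

theorem Tableau.tabloid_trans (t : Tableau lam α) (π : Equiv.Perm α) :
    Tableau.tabloid (lam := lam) (t.trans π) = t.tabloid ∘ ⇑π⁻¹ := rfl

theorem Tableau.eq_one_of_isColStab {t : Tableau lam α} {π : Equiv.Perm α} (h : t.IsColStab π)
    (h' : t.tabloid ∘ ⇑π = t.tabloid) : π = 1 := by
  ext a
  have h1 : t.symm (π a) = t.symm a := Subtype.ext (Prod.ext (congrFun h' a) (h a))
  simpa using h1

open Classical in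
theorem Tableau.polytabloid_eq (t : Tableau lam α) :
    t.polytabloid k = ∑ π : Equiv.Perm α with t.IsColStab π,
      ((Equiv.Perm.sign π : ℤ) : k) • rowFunctionRep k α π (Finsupp.single t.tabloid 1) := by
  unfold Tableau.polytabloid
  refine Finset.sum_congr rfl fun π _ => ?_
  rw [rowFunctionRep_single, Tableau.tabloid_trans, Finsupp.smul_single, smul_eq_mul, mul_one]

theorem Tableau.polytabloid_apply_comp (t : Tableau lam α) {π : Equiv.Perm α}
    (h : t.IsColStab π) : t.polytabloid k (t.tabloid ∘ π) = ((Equiv.Perm.sign π : ℤ) : k) := by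
  classical
  unfold Tableau.polytabloid
  rw [Finsupp.finsetSum_apply, Finset.sum_eq_single π⁻¹]
  · simp [Tableau.tabloid_trans]
  · intro τ hτ hne
    rw [Finset.mem_filter_univ] at hτ
    rw [Finsupp.single_apply, if_neg]
    intro heq
    apply hne
    rw [Tableau.tabloid_trans] at heq
    have h1 := Tableau.eq_one_of_isColStab (t := t) (π := π * τ) (h.mul hτ) (by
      rw [Equiv.Perm.coe_mul, ← Function.comp_assoc, ← heq]
      ext a; simp)
    exact eq_inv_of_mul_eq_one_right h1
  · intro hn
    exact absurd (by simpa using h.inv) hn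

theorem Tableau.exists_of_polytabloid_ne_zero (t : Tableau lam α) {u : α → ℕ}
    (h : t.polytabloid k u ≠ 0) : ∃ π : Equiv.Perm α, t.IsColStab π ∧ u = t.tabloid ∘ π := by
  classical
  unfold Tableau.polytabloid at h
  rw [Finsupp.finsetSum_apply] at h
  obtain ⟨π, hπ, h⟩ := Finset.exists_ne_zero_of_sum_ne_zero h
  rw [Finset.mem_filter_univ] at hπ
  refine ⟨π⁻¹, hπ.inv, ?_⟩
  rw [Finsupp.single_apply] at h
  rw [← Tableau.tabloid_trans]
  by_contra hne
  exact h (if_neg fun h' => hne h'.symm)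

theorem Tableau.polytabloid_apply_tabloid (t : Tableau lam α) :
    t.polytabloid k t.tabloid = 1 := by
  simpa using t.polytabloid_apply_comp (k := k) (π := 1) fun a => rfl

open Classical in
/-- The column antisymmetriser of a tableau kills each word with a repeated letter in a column. -/
theorem Tableau.sum_colStab_eq_zero [CharZero k] (t : Tableau lam α) {u : α → ℕ} {a b : α}
    (hab : a ≠ b) (hcol : (t.symm a).1.2 = (t.symm b).1.2) (hu : u a = u b) :
    ∑ π : Equiv.Perm α with t.IsColStab π,
      ((Equiv.Perm.sign π : ℤ) : k) • rowFunctionRep k α π (Finsupp.single u 1) = 0 := by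
  have hswap : t.IsColStab (Equiv.swap a b) :=
    Equiv.apply_swap_eq_self (v := fun a => (t.symm a).1.2) hcol
  have hus : rowFunctionRep k α (Equiv.swap a b) (Finsupp.single u 1) = Finsupp.single u 1 := by
    rw [rowFunctionRep_single, Equiv.swap_inv]
    exact congrArg (Finsupp.single · 1) (funext (Equiv.apply_swap_eq_self hu))
  refine Finset.sum_involution (fun π _ => π * Equiv.swap a b) ?_ ?_ ?_ ?_
  · intro π _
    rw [map_mul (rowFunctionRep k α), Module.End.mul_apply, hus]
    simp [Equiv.Perm.sign_swap hab]
  · intro π _ _ h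
    exact hab (by simpa using h)
  · intro π hπ
    rw [Finset.mem_filter_univ] at hπ ⊢
    exact hπ.mul hswap
  · intro π _
    simp [mul_assoc]

/-- Polytabloids are highest weight vectors: if an entry `a` of the row `i + 1` changes its letter to
`i`, then the word repeats a letter in the column of `a`. -/
theorem Tableau.polytabloid_mem_hwSpace [CharZero k] (t : Tableau lam α) :
    t.polytabloid k ∈ hwSpace k α (rowWeight lam) := by
  classical
  rw [mem_hwSpace]
  constructor
  · rw [mem_weightSpace]
    intro f hf
    obtain ⟨π, -, rfl⟩ := t.exists_of_polytabloid_ne_zero hf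
    rw [wordWeight_comp, wordWeight_tabloid]
  · intro i
    rw [Tableau.polytabloid_eq, map_sum]
    simp only [map_smul, letterOp_rowFunctionRep, letterOp_single, map_sum, Finset.smul_sum]
    rw [Finset.sum_comm]
    refine Finset.sum_eq_zero fun a ha => ?_
    rw [Finset.mem_filter_univ] at ha
    have hmem : (i, (t.symm a).1.2) ∈ lam.cells := by
      rw [YoungDiagram.mem_cells]
      refine lam.up_left_mem (i2 := (t.symm a).1.1) ?_ le_rfl (t.symm a).2
      change i ≤ t.tabloid a
      omega
    set b := t ⟨_, hmem⟩ with hb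
    have htb : t.tabloid b = i := by simp [Tableau.tabloid, hb]
    have hab : a ≠ b := by
      rintro h
      rw [← h] at htb
      omega
    refine t.sum_colStab_eq_zero hab (by simp [hb]) ?_
    rw [Function.update_self, Function.update_of_ne hab.symm, htb]

theorem spechtModule_le_hwSpace [CharZero k] :
    spechtModule k lam α ≤ hwSpace k α (rowWeight lam) := by
  rw [spechtModule, Submodule.span_le]
  rintro _ ⟨t, rfl⟩
  exact t.polytabloid_mem_hwSpace

/-- A word, read along a linear order of the positions given by `e`, as an element of a
lexicographic order; the position of index `0` is the most significant one. -/
def wordKey {r : ℕ} (e : α ≃ Fin r) (w : α → ℕ) : Lex (Fin r → ℕ) := toLex (w ∘ e.symm)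

theorem wordKey_injective {r : ℕ} (e : α ≃ Fin r) : Function.Injective (wordKey e) := by
  intro w w' h
  have h' : w ∘ e.symm = w' ∘ e.symm := h
  ext a
  simpa using congrFun h' (e a)

theorem wordKey_lt {r : ℕ} {e : α ≃ Fin r} {w w' : α → ℕ} (a : α) (ha : w a < w' a)
    (h : ∀ b, e b < e a → w b = w' b) : wordKey e w < wordKey e w' :=
  ⟨e a, fun j hj => by simpa [wordKey] using h (e.symm j) (by simpa using hj), by
    simpa [wordKey] using ha⟩

theorem exists_of_wordKey_lt {r : ℕ} {e : α ≃ Fin r} {w w' : α → ℕ}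
    (h : wordKey e w < wordKey e w') : ∃ a, w a < w' a ∧ ∀ b, e b < e a → w b = w' b := by
  obtain ⟨i, h1, h2⟩ := h
  exact ⟨e.symm i, h2, fun b hb => by simpa [wordKey] using h1 (e b) (by simpa using hb)⟩

/-- A word is a Yamanouchi word if each of its final segments (with respect to `e`) contains each
letter `i` at least as often as the letter `i + 1`. -/
def IsYamanouchi {r : ℕ} (e : α ≃ Fin r) (w : α → ℕ) : Prop :=
  ∀ a i, letterCount {b | e a ≤ e b} w (i + 1) ≤ letterCount {b | e a ≤ e b} w i

theorem letterCount_add_compl (P : Finset α) (f : α → ℕ) (p : ℕ) :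
    letterCount P f p + letterCount Pᶜ f p = letterCount univ f p := by
  unfold letterCount
  rw [← Finset.card_union_of_disjoint]
  · congr 1
    ext a
    by_cases h : a ∈ P <;> simp [h]
  · exact Finset.disjoint_filter_filter disjoint_compl_right

theorem letterCount_congr {P : Finset α} {f g : α → ℕ} (h : ∀ a ∈ P, f a = g a) (p : ℕ) :
    letterCount P f p = letterCount P g p := by
  unfold letterCount
  congr 1
  exact Finset.filter_congr fun a ha => by rw [h a ha]

/-- The leading word of a highest weight vector is a Yamanouchi word. -/
theorem isYamanouchi_of_leading [CharZero k] {r : ℕ} {e : α ≃ Fin r} {d : ℕ →₀ ℕ}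
    {v : (α → ℕ) →₀ k} (hv : v ∈ hwSpace k α d) {w : α → ℕ} (hw : v w ≠ 0)
    (hmax : ∀ u, v u ≠ 0 → wordKey e u ≤ wordKey e w) : IsYamanouchi e w := by
  classical
  intro a₀ i
  by_contra! hlt
  rw [mem_hwSpace, mem_weightSpace] at hv
  set P : Finset α := {b | e a₀ ≤ e b} with hP
  -- The component of `v` whose words agree with `w` at the significant positions is killed by the
  -- raising operator on the remaining positions, as a raised word comes from a larger word.
  set v' : (α → ℕ) →₀ k := v.filter fun u => ∀ b ∉ P, u b = w b with hv'
  have h0 : letterOp P (i + 1) i v' = 0 := by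
    ext u
    rw [letterOp_apply, Finsupp.zero_apply]
    by_cases hu : ∀ b ∉ P, u b = w b
    · have hE := DFunLike.congr_fun (hv.2 i) u
      rw [letterOp_apply, Finsupp.zero_apply] at hE
      rw [← hE]
      rw [← Finset.sum_subset (s₁ := {a ∈ P | u a = i})
        (Finset.filter_subset_filter _ (Finset.subset_univ _))]
      · refine Finset.sum_congr rfl fun a ha => ?_
        rw [Finset.mem_filter] at ha
        rw [hv', Finsupp.filter_apply_pos]
        intro b hb
        rw [Function.update_of_ne (by rintro rfl; exact hb ha.1), hu b hb]
      · intro a ha ha'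
        rw [Finset.mem_filter_univ] at ha
        have haP : a ∉ P := fun h => ha' (Finset.mem_filter.2 ⟨h, ha⟩)
        by_contra hne
        refine (hmax _ hne).not_gt (wordKey_lt a ?_ ?_)
        · rw [Function.update_self, ← hu a haP, ha]
          exact Nat.lt_succ_self i
        · intro b hb
          rw [Function.update_of_ne (by rintro rfl; exact lt_irrefl _ hb)]
          refine (hu b ?_).symm
          simp only [hP, Finset.mem_filter_univ, not_le] at haP ⊢
          exact hb.trans haP
    · refine Finset.sum_eq_zero fun a ha => ?_
      rw [Finset.mem_filter] at ha
      rw [hv', Finsupp.filter_apply_neg]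
      intro h
      apply hu
      intro b hb
      have := h b hb
      rwa [Function.update_of_ne (by rintro rfl; exact hb ha.1)] at this
  have hz : v' = 0 := by
    refine eq_zero_of_letterOp_eq_zero (s := letterCount P w (i + 1) - letterCount P w i)
      (by omega : i + 1 ≠ i) (by omega) ?_ h0
    intro f hf
    have hf1 : ∀ b ∉ P, f b = w b := by
      by_contra h
      exact hf (Finsupp.filter_apply_neg _ _ h)
    have hf2 : v f ≠ 0 := by rwa [hv', Finsupp.filter_apply_pos _ _ hf1] at hf
    have hcount : ∀ p, letterCount P f p = letterCount P w p := by
      intro p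
      have h1 := letterCount_add_compl P f p
      have h2 := letterCount_add_compl P w p
      rw [← wordWeight_apply, hv.1 f hf2] at h1
      rw [← wordWeight_apply, hv.1 w hw] at h2
      have h3 := letterCount_congr (P := Pᶜ) (f := f) (g := w)
        (fun a ha => hf1 a (Finset.mem_compl.1 ha)) p
      omega
    rw [hcount, hcount]
    omega
  apply hw
  rw [← Finsupp.filter_apply_pos (fun u => ∀ b ∉ P, u b = w b) v (fun b _ => rfl), ← hv', hz,
    Finsupp.zero_apply]

end Specht

/-! ### Standard tableaux -/

section Standard

open Finset

variable {k : Type*} [Field k] {α : Type} [Fintype α] [DecidableEq α] {lam : YoungDiagram}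

theorem degree_wordWeight (f : α → ℕ) : (wordWeight f).degree = Fintype.card α := by
  simp [wordWeight, map_sum]

theorem degree_rowWeight (lam : YoungDiagram) : (rowWeight lam).degree = lam.card := by
  simp [rowWeight, map_sum]

/-- A tableau is standard for the order of the entries in which entries of smaller index `e` are
larger: the index decreases along each row and down each column. -/
def Tableau.IsStandard {r : ℕ} (e : α ≃ Fin r) (t : Tableau lam α) : Prop :=
  (∀ c c', c.1.1 = c'.1.1 → c.1.2 < c'.1.2 → e (t c') < e (t c)) ∧
    ∀ c c', c.1.2 = c'.1.2 → c.1.1 < c'.1.1 → e (t c') < e (t c)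

/-- A Yamanouchi word of weight `λ` is the tabloid of a standard `λ`-tableau: each position is
entered in the row given by its letter, in reverse order. -/
theorem IsYamanouchi.exists_isStandard {r : ℕ} {e : α ≃ Fin r} {w : α → ℕ}
    (hw : IsYamanouchi e w) (hwt : wordWeight w = rowWeight lam) :
    ∃ t : Tableau lam α, t.tabloid = w ∧ t.IsStandard e := by
  classical
  -- `a` is entered in the cell of the row `w a` whose column is the number of later letters `w a`.
  set after : α → Finset α := fun a => {b | e a < e b ∧ w b = w a} with hafter
  have hmem : ∀ a, (w a, #(after a)) ∈ lam.cells := by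
    intro a
    rw [YoungDiagram.mem_cells, YoungDiagram.mem_iff_lt_rowLen, ← rowWeight_apply, ← hwt,
      wordWeight_apply]
    refine Finset.card_lt_card (Finset.ssubset_iff_subset_ne.2 ⟨?_, ?_⟩)
    · intro b hb
      simp only [hafter, Finset.mem_filter_univ] at hb ⊢
      exact hb.2
    · intro h
      have : a ∈ after a := by rw [h]; simp
      simp [hafter] at this
  have hlt : ∀ a b, w a = w b → e a < e b → #(after b) < #(after a) := by
    intro a b hab he
    refine Finset.card_lt_card (Finset.ssubset_iff_subset_ne.2 ⟨?_, ?_⟩)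
    · intro x hx
      simp only [hafter, Finset.mem_filter_univ] at hx ⊢
      exact ⟨he.trans hx.1, hx.2.trans hab.symm⟩
    · intro h
      have : b ∈ after a := by simp [hafter, he, hab]
      rw [← h] at this
      simp [hafter] at this
  set pos : α → {c : ℕ × ℕ // c ∈ lam.cells} := fun a => ⟨_, hmem a⟩ with hpos
  have hinj : Function.Injective pos := by
    intro a b hab
    have h1 : w a = w b := congrArg (fun c => c.1.1) hab
    have h2 : #(after a) = #(after b) := congrArg (fun c => c.1.2) hab
    rcases lt_trichotomy (e a) (e b) with h | h | h
    · exact absurd h2 (hlt a b h1 h).ne'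
    · exact e.injective h
    · exact absurd h2 (hlt b a h1.symm h).ne
  have hcard : Fintype.card α = Fintype.card {c : ℕ × ℕ // c ∈ lam.cells} := by
    rw [← degree_wordWeight w, hwt, degree_rowWeight]
    simp
  have hbij : Function.Bijective pos := (Fintype.bijective_iff_injective_and_card _).2 ⟨hinj, hcard⟩
  refine ⟨(Equiv.ofBijective pos hbij).symm, ?_, ?_, ?_⟩
  · ext a
    simp [Tableau.tabloid, hpos]
  · intro c c'
    obtain ⟨a, rfl⟩ := hbij.2 c
    obtain ⟨b, rfl⟩ := hbij.2 c'
    rw [Equiv.ofBijective_symm_apply_apply, Equiv.ofBijective_symm_apply_apply]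
    intro h1 h2
    change w a = w b at h1
    change #(after a) < #(after b) at h2
    by_contra h
    rcases (not_lt.1 h).lt_or_eq with h | h
    · exact h2.not_gt (hlt a b h1 h)
    · rw [e.injective h] at h2
      exact lt_irrefl _ h2
  · have step : ∀ a b, w b = w a + 1 → #(after a) = #(after b) → e b < e a := by
      intro a b h1 h2
      by_contra h
      have hab : e a < e b := by
        refine (not_lt.1 h).lt_of_ne fun h' => ?_
        rw [e.injective h'] at h1
        omega
      have h3 := hw b (w a)
      have h4 : letterCount {x | e b ≤ e x} w (w a + 1) = #(after b) + 1 := by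
        have hins : ({x ∈ ({x | e b ≤ e x} : Finset α) | w x = w a + 1} : Finset α) =
            insert b (after b) := by
          ext x
          simp only [hafter, Finset.mem_filter, Finset.mem_univ, true_and, Finset.mem_insert, h1]
          constructor
          · rintro ⟨h5, h6⟩
            rcases h5.lt_or_eq with h5 | h5
            · exact Or.inr ⟨h5, h6⟩
            · exact Or.inl (e.injective h5).symm
          · rintro (rfl | ⟨h5, h6⟩)
            · exact ⟨le_rfl, h1⟩
            · exact ⟨h5.le, h6⟩
        unfold letterCount
        rw [hins, Finset.card_insert_of_notMem (by simp [hafter])]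
      have h5 : letterCount {x | e b ≤ e x} w (w a) ≤ #(after a) := by
        refine Finset.card_le_card fun x hx => ?_
        simp only [hafter, Finset.mem_filter, Finset.mem_univ, true_and] at hx ⊢
        exact ⟨hab.trans_le hx.1, hx.2⟩
      omega
    intro c c'
    obtain ⟨a, rfl⟩ := hbij.2 c
    obtain ⟨b, rfl⟩ := hbij.2 c'
    rw [Equiv.ofBijective_symm_apply_apply, Equiv.ofBijective_symm_apply_apply]
    intro h1 h2
    change #(after a) = #(after b) at h1
    change w a + 1 ≤ w b at h2
    generalize hi : w b = i at h2
    induction i, h2 using Nat.le_induction generalizing b with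
    | base => exact step a b hi h1
    | succ i h2 ih =>
      have hc : (i, #(after b)) ∈ lam.cells := by
        rw [YoungDiagram.mem_cells]
        exact lam.up_left_mem (i2 := w b) (by omega) le_rfl (hmem b)
      obtain ⟨x, hx⟩ := hbij.2 ⟨_, hc⟩
      have hx1 : w x = i := congrArg (fun c => c.1.1) hx
      have hx2 : #(after x) = #(after b) := congrArg (fun c => c.1.2) hx
      exact (step x b (by omega) hx2).trans (ih x (by omega) hx1)

/-- The leading word of the polytabloid of a standard tableau is its tabloid. -/
theorem Tableau.IsStandard.wordKey_le {r : ℕ} {e : α ≃ Fin r} {t : Tableau lam α}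
    (ht : t.IsStandard e) {u : α → ℕ} (hu : t.polytabloid k u ≠ 0) :
    wordKey e u ≤ wordKey e t.tabloid := by
  obtain ⟨π, hπ, rfl⟩ := t.exists_of_polytabloid_ne_zero hu
  by_contra h
  obtain ⟨a, h1, h2⟩ := exists_of_wordKey_lt (not_le.1 h)
  -- The entry `π a` lies below `a` in the same column, so it is more significant than `a` and
  -- hence fixed by `π`.
  have h3 : e (π a) < e a := by
    have := ht.2 (t.symm a) (t.symm (π a)) (hπ a).symm h1
    simpa using this
  have h4 : t.symm (π (π a)) = t.symm (π a) :=
    Subtype.ext (Prod.ext (h2 _ h3).symm (hπ _))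
  have h5 : π a = a := π.injective (t.symm.injective h4)
  rw [Function.comp_apply, h5] at h1
  exact lt_irrefl _ h1

/-- The highest weight vectors of weight `λ` form the Specht module: subtracting multiples of
standard polytabloids lowers the leading word. -/
theorem hwSpace_eq_spechtModule [CharZero k] (lam : YoungDiagram) :
    hwSpace k α (rowWeight lam) = spechtModule k lam α := by
  refine le_antisymm ?_ spechtModule_le_hwSpace
  let e : α ≃ Fin (Fintype.card α) := Fintype.equivFin α
  have step : ∀ v ∈ hwSpace k α (rowWeight lam), v ≠ 0 → ∃ w, v w ≠ 0 ∧
      ∃ s ∈ spechtModule k lam α, ∀ u, (v - s) u ≠ 0 → wordKey e u < wordKey e w := by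
    intro v hv h0
    obtain ⟨w, hw, hmax⟩ := Finset.exists_max_image v.support (wordKey e)
      (Finsupp.support_nonempty_iff.2 h0)
    rw [Finsupp.mem_support_iff] at hw
    have hmax' : ∀ u, v u ≠ 0 → wordKey e u ≤ wordKey e w := fun u hu =>
      hmax u (Finsupp.mem_support_iff.2 hu)
    obtain ⟨t, rfl, ht⟩ := (isYamanouchi_of_leading hv hw hmax').exists_isStandard
      (mem_weightSpace.1 (mem_hwSpace.1 hv).1 w hw)
    refine ⟨_, hw, v t.tabloid • t.polytabloid k,
      Submodule.smul_mem _ _ (Submodule.subset_span ⟨t, rfl⟩), fun u hu => lt_of_le_of_ne ?_ ?_⟩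
    · by_contra hlt
      have h1 : v u = 0 := by
        by_contra h; exact hlt (hmax' u h)
      have h2 : t.polytabloid k u = 0 := by
        by_contra h; exact hlt (ht.wordKey_le h)
      exact hu (by simp [h1, h2])
    · intro h
      rw [wordKey_injective e h] at hu
      exact hu (by simp [t.polytabloid_apply_tabloid])
  have main : ∀ K : Lex (Fin (Fintype.card α) → ℕ), ∀ v ∈ hwSpace k α (rowWeight lam),
      (∀ u, v u ≠ 0 → wordKey e u < K) → v ∈ spechtModule k lam α := by
    intro K
    induction K using WellFoundedLT.induction with
    | ind K ih =>
      intro v hv hK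
      by_cases h0 : v = 0
      · rw [h0]; exact zero_mem _
      obtain ⟨w, hw, s, hs, hlt⟩ := step v hv h0
      simpa using add_mem (ih _ (hK w hw) _ (sub_mem hv (spechtModule_le_hwSpace hs)) hlt) hs
  intro v hv
  by_cases h0 : v = 0
  · rw [h0]; exact zero_mem _
  obtain ⟨w, -, s, hs, hlt⟩ := step v hv h0
  simpa using add_mem (main _ _ (sub_mem hv (spechtModule_le_hwSpace hs)) hlt) hs

end Standard

/-! ### Multiplicities in representations of finite groups -/

section FiniteGroup

open Representation Module

universe v

variable {k : Type*} [Field k] [CharZero k] {G : Type} [Group G] [Fintype G]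
variable {A B C : Type*} [AddCommGroup A] [Module k A] [AddCommGroup B] [Module k B]
  [AddCommGroup C] [Module k C]

/-- The average `|G|⁻¹ ∑_g g f g⁻¹` of a linear map over the group. -/
def averageHom (ρ : Representation k G A) (σ : Representation k G B) (f : A →ₗ[k] B) :
    IntertwiningMap ρ σ where
  toLinearMap := (Fintype.card G : k)⁻¹ • ∑ g : G, σ g ∘ₗ f ∘ₗ ρ g⁻¹
  isIntertwining' h := by
    ext v
    simp only [LinearMap.comp_apply, LinearMap.smul_apply, LinearMap.sum_apply, map_smul, map_sum]
    congr 1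
    refine Fintype.sum_equiv (Equiv.mulLeft h⁻¹) _ _ fun g => ?_
    simp [← Module.End.mul_apply, ← map_mul]

theorem averageHom_apply (ρ : Representation k G A) (σ : Representation k G B) (f : A →ₗ[k] B)
    (v : A) : averageHom ρ σ f v = (Fintype.card G : k)⁻¹ • ∑ g : G, σ g (f (ρ g⁻¹ v)) := by
  change ((Fintype.card G : k)⁻¹ • ∑ g : G, σ g ∘ₗ f ∘ₗ ρ g⁻¹) v = _
  simp

theorem inv_card_smul_sum_const (x : A) :
    (Fintype.card G : k)⁻¹ • ∑ _g : G, x = x := by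
  have : (Fintype.card G : k) ≠ 0 := by exact_mod_cast Fintype.card_ne_zero
  rw [Finset.sum_const, Finset.card_univ, ← Nat.cast_smul_eq_nsmul k, smul_smul,
    inv_mul_cancel₀ this, one_smul]

/-- Averaging a generalised inverse of an intertwining map gives an equivariant one. -/
theorem exists_generalizedInverse {ρ : Representation k G A} {σ : Representation k G B}
    (φ : IntertwiningMap ρ σ) : ∃ s : IntertwiningMap σ ρ, ∀ a, φ (s (φ a)) = φ a := by
  obtain ⟨r, hr⟩ := φ.toLinearMap.rangeRestrict.exists_rightInverse_of_surjective
    φ.toLinearMap.range_rangeRestrict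
  obtain ⟨f, hf⟩ := LinearMap.exists_extend r
  have hφ : ∀ a, φ (f (φ a)) = φ a := by
    intro a
    have h1 : f (φ a) = r ⟨φ a, ⟨a, rfl⟩⟩ := by rw [← hf]; rfl
    rw [h1]
    exact congrArg Subtype.val (LinearMap.congr_fun hr ⟨φ a, ⟨a, rfl⟩⟩)
  refine ⟨averageHom σ ρ f, fun a => ?_⟩
  rw [averageHom_apply, map_smul, map_sum]
  have : ∀ g : G, φ (ρ g (f (σ g⁻¹ (φ a)))) = φ a := by
    intro g
    rw [φ.isIntertwining, ← φ.isIntertwining _ _ g⁻¹, hφ, φ.isIntertwining, ← Module.End.mul_apply,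
      ← map_mul]
    simp
  rw [Finset.sum_congr rfl fun g _ => this g]
  exact inv_card_smul_sum_const _

theorem exists_smul_of_finrank_end_eq_one {σ : Representation k G B}
    (hσ : finrank k (IntertwiningMap σ σ) = 1) (e : IntertwiningMap σ σ) :
    ∃ c : k, ∀ b, e b = c • b := by
  have hne : IntertwiningMap.id σ ≠ 0 := by
    intro h0
    have : Nontrivial (IntertwiningMap σ σ) :=
      nontrivial_of_finrank_pos (R := k) (by rw [hσ]; exact one_pos)
    obtain ⟨x, hx⟩ := exists_ne (0 : IntertwiningMap σ σ)
    apply hx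
    ext b
    have : b = 0 := DFunLike.congr_fun h0 b
    simp [this]
  obtain ⟨c, hc⟩ := exists_smul_eq_of_finrank_eq_one hσ hne e
  exact ⟨c, fun b => by rw [← hc]; simp⟩

/-- A nonzero map onto a module with trivial endomorphism ring splits. -/
theorem exists_section {ρ : Representation k G A} {σ : Representation k G B}
    (hσ : finrank k (IntertwiningMap σ σ) = 1) (φ : IntertwiningMap ρ σ) (hφ : φ ≠ 0) :
    ∃ s : IntertwiningMap σ ρ, ∀ b, φ (s b) = b := by
  obtain ⟨s, hs⟩ := exists_generalizedInverse φ
  obtain ⟨c, hc⟩ := exists_smul_of_finrank_end_eq_one hσ (φ.comp s)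
  obtain ⟨a, ha⟩ : ∃ a, φ a ≠ 0 := by
    by_contra! h
    exact hφ (IntertwiningMap.ext (LinearMap.ext h))
  have h1 : c • φ a = (1 : k) • φ a := by
    rw [← hc, one_smul]
    exact hs a
  have hc1 : c = 1 := smul_left_injective k ha h1
  exact ⟨s, fun b => by simpa [hc1] using hc b⟩

/-- A nonzero map from a module with trivial endomorphism ring splits. -/
theorem exists_retraction {ρ : Representation k G A} {σ : Representation k G B}
    (hρ : finrank k (IntertwiningMap ρ ρ) = 1) (φ : IntertwiningMap ρ σ) (hφ : φ ≠ 0) :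
    ∃ s : IntertwiningMap σ ρ, ∀ a, s (φ a) = a := by
  obtain ⟨s, hs⟩ := exists_generalizedInverse φ
  obtain ⟨c, hc⟩ := exists_smul_of_finrank_end_eq_one hρ (s.comp φ)
  obtain ⟨a, ha⟩ : ∃ a, φ a ≠ 0 := by
    by_contra! h
    exact hφ (IntertwiningMap.ext (LinearMap.ext h))
  have h1 : c • φ a = (1 : k) • φ a := by
    rw [← map_smul, ← hc, one_smul]
    exact hs a
  have hc1 : c = 1 := smul_left_injective k ha h1
  exact ⟨s, fun b => by simpa [hc1] using hc b⟩

variable [FiniteDimensional k A] [FiniteDimensional k B] [FiniteDimensional k C]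

theorem cast_finrank_hom (ρ : Representation k G A) (σ : Representation k G B) :
    (finrank k (IntertwiningMap ρ σ) : k) =
      (Nat.card G : k)⁻¹ * ∑ g : G, σ.character g * ρ.character g⁻¹ := by
  have : Invertible (Nat.card G : k) :=
    invertibleOfNonzero (by exact_mod_cast Nat.card_pos.ne')
  exact (card_inv_mul_sum_char_mul_char_eq_finrank ρ σ).symm

theorem finrank_hom_comm (ρ : Representation k G A) (σ : Representation k G B) :
    finrank k (IntertwiningMap ρ σ) = finrank k (IntertwiningMap σ ρ) := by
  apply Nat.cast_injective (R := k)
  rw [cast_finrank_hom, cast_finrank_hom]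
  congr 1
  refine Fintype.sum_equiv (Equiv.inv G) _ _ fun g => ?_
  simp [mul_comm]

/-- If `φ` has a section then the character of its source is the sum of the characters of its
kernel and its target. -/
theorem character_eq_add {ρ : Representation k G A} {σ : Representation k G B}
    (φ : IntertwiningMap ρ σ) (s : IntertwiningMap σ ρ) (hs : ∀ b, φ (s b) = b) (g : G) :
    ρ.character g = φ.ker.toRepresentation.character g + σ.character g := by
  let p : A →ₗ[k] φ.ker.toSubmodule :=
    (LinearMap.id - s.toLinearMap ∘ₗ φ.toLinearMap).codRestrict _ fun a => by
      change φ _ = 0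
      simp [hs]
  have hp : ∀ a, (p a : A) = a - s (φ a) := fun a => rfl
  let i : φ.ker.toSubmodule →ₗ[k] A := φ.ker.toSubmodule.subtype
  have h1 : ρ g = (ρ g ∘ₗ i) ∘ₗ p + (ρ g ∘ₗ s.toLinearMap) ∘ₗ φ.toLinearMap := by
    ext a
    simp [i, hp]
  have h2 : p ∘ₗ ρ g ∘ₗ i = φ.ker.toRepresentation g := by
    ext a
    have ha : φ (a : A) = 0 := a.2
    rw [LinearMap.comp_apply, LinearMap.comp_apply, hp]
    simp only [i, Submodule.coe_subtype]
    rw [φ.isIntertwining, ha]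
    simp [Subrepresentation.toRepresentation]
  have h3 : φ.toLinearMap ∘ₗ ρ g ∘ₗ s.toLinearMap = σ g := by
    ext b
    simp [φ.isIntertwining, hs]
  unfold character
  rw [h1, map_add, LinearMap.trace_comp_comm' p (ρ g ∘ₗ i),
    LinearMap.trace_comp_comm' φ.toLinearMap (ρ g ∘ₗ s.toLinearMap), h2, h3]

theorem finrank_hom_eq_add {ρ : Representation k G A} {σ : Representation k G B}
    (φ : IntertwiningMap ρ σ) (s : IntertwiningMap σ ρ) (hs : ∀ b, φ (s b) = b)
    (τ : Representation k G C) :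
    finrank k (IntertwiningMap ρ τ) = finrank k (IntertwiningMap φ.ker.toRepresentation τ) +
      finrank k (IntertwiningMap σ τ) := by
  apply Nat.cast_injective (R := k)
  push_cast
  rw [cast_finrank_hom, cast_finrank_hom, cast_finrank_hom, ← mul_add, ← Finset.sum_add_distrib]
  simp_rw [character_eq_add φ s hs, mul_add]

theorem finrank_hom_of_subsingleton [Subsingleton A] (ρ : Representation k G A)
    (σ : Representation k G B) : finrank k (IntertwiningMap ρ σ) = 0 := by
  have : Subsingleton (IntertwiningMap ρ σ) :=
    ⟨fun a b => IntertwiningMap.ext (LinearMap.ext fun x => by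
      rw [Subsingleton.elim x 0, map_zero, map_zero])⟩
  exact finrank_zero_of_subsingleton

/-- Completeness relation: for a finite family of representations that are orthonormal and among
which each nonzero representation finds a target, the multiplicities with respect to the family
determine all dimensions of spaces of intertwining maps. -/
theorem finrank_hom_eq_sum {A : Type v} [AddCommGroup A] [Module k A] [FiniteDimensional k A]
    {ι : Type*} [Fintype ι] [DecidableEq ι] {S : ι → Type*}
    [∀ i, AddCommGroup (S i)] [∀ i, Module k (S i)] [∀ i, FiniteDimensional k (S i)]
    (σ : ∀ i, Representation k G (S i))
    (horth : ∀ i j, finrank k (IntertwiningMap (σ i) (σ j)) = if i = j then 1 else 0)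
    (hex : ∀ (H : Type v) [AddCommGroup H] [Module k H] [FiniteDimensional k H] [Nontrivial H]
      (ρ : Representation k G H), ∃ i, ∃ φ : IntertwiningMap ρ (σ i), φ ≠ 0)
    (ρ : Representation k G A) (τ : Representation k G B) :
    finrank k (IntertwiningMap ρ τ) =
      ∑ i, finrank k (IntertwiningMap ρ (σ i)) * finrank k (IntertwiningMap τ (σ i)) := by
  generalize hn : finrank k A = n
  induction n using Nat.strong_induction_on generalizing A with
  | _ n ih =>
    rcases subsingleton_or_nontrivial A with hA | hA
    · simp [finrank_hom_of_subsingleton]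
    · obtain ⟨i, φ, hφ⟩ := hex A ρ
      obtain ⟨s, hs⟩ := exists_section (by simp [horth]) φ hφ
      have hlt : finrank k φ.ker.toSubmodule < n := by
        rw [← hn]
        refine Submodule.finrank_lt fun htop => hφ ?_
        ext a
        have : a ∈ φ.ker.toSubmodule := by rw [htop]; trivial
        exact this
      rw [finrank_hom_eq_add φ s hs, ih _ hlt φ.ker.toRepresentation rfl]
      simp only [finrank_hom_eq_add φ s hs, add_mul, Finset.sum_add_distrib, horth]
      simp [finrank_hom_comm τ (σ i)]

/-- The subspace on which a group `W`, acting through `φ : W → G`, acts by the scalars `χ`. -/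
def semiInvariants {W : Type*} [Group W] {A : Type*} [AddCommMonoid A] [Module k A] (φ : W →* G)
    (χ : W → k) (ρ : Representation k G A) : Submodule k A where
  carrier := {v | ∀ w, ρ (φ w) v = χ w • v}
  add_mem' ha hb w := by rw [map_add, ha w, hb w, smul_add]
  zero_mem' w := by simp
  smul_mem' c v hv w := by rw [map_smul, hv w, smul_comm]

/-- Frobenius reciprocity for a representation induced from a one-dimensional one. -/
theorem finrank_hom_ind {W X : Type*} [Group W] [AddCommGroup X] [Module k X] (φ : W →* G)
    (ξ : Representation k W X) (χ : W → k) (x₀ : X) (hx : ∀ w, ξ w x₀ = χ w • x₀) (h0 : x₀ ≠ 0)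
    (hspan : ∀ x, ∃ c : k, x = c • x₀) (ρ : Representation k G A) :
    finrank k (IntertwiningMap (ind φ ξ) ρ) = finrank k (semiInvariants φ χ ρ) := by
  let ev : IntertwiningMap (ind φ ξ) ρ →ₗ[k] A :=
    { toFun := fun ψ => ψ (IndV.mk φ ξ 1 x₀)
      map_add' := fun _ _ => rfl
      map_smul' := fun _ _ => rfl }
  have hev : ∀ ψ, ev ψ = ψ (IndV.mk φ ξ 1 x₀) := fun _ => rfl
  have hmk : ∀ (ψ : IntertwiningMap (ind φ ξ) ρ) (h : G) (x : X),
      ψ (IndV.mk φ ξ h x) = ρ h⁻¹ (ψ (IndV.mk φ ξ 1 x)) := by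
    intro ψ h x
    rw [← ψ.isIntertwining, ind_mk, one_mul, inv_inv]
  have hinj : Function.Injective ev := by
    intro ψ ψ' h
    apply IntertwiningMap.ext
    refine IndV.hom_ext φ ξ fun g => LinearMap.ext fun x => ?_
    obtain ⟨c, rfl⟩ := hspan x
    change ψ (IndV.mk φ ξ g (c • x₀)) = ψ' (IndV.mk φ ξ g (c • x₀))
    rw [hmk, hmk ψ', map_smul, map_smul, map_smul, map_smul, map_smul]
    exact congrArg (fun z => c • ρ g⁻¹ z) h
  have hrange : LinearMap.range ev = semiInvariants φ χ ρ := by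
    ext v
    constructor
    · rintro ⟨ψ, rfl⟩ w
      change ρ (φ w) (ψ (IndV.mk φ ξ 1 x₀)) = χ w • ψ (IndV.mk φ ξ 1 x₀)
      rw [← ψ.isIntertwining, ind_mk, one_mul, ← map_smul, ← map_smul, ← hx]
      congr 1
      simp [← Coinvariants.mk_inv_tmul]
    · intro hv
      choose c hc using hspan
      have hc' : ∀ {a : k} {x : X}, x = a • x₀ → c x = a := by
        intro a x hxa
        exact smul_left_injective k h0 ((hc x).symm.trans hxa)
      let lin : X →ₗ[k] A :=
        { toFun := fun x => c x • v
          map_add' := fun x y => by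
            rw [hc' (a := c x + c y) (x := x + y) (by rw [add_smul, ← hc, ← hc]), add_smul]
          map_smul' := fun a x => by
            rw [hc' (a := a * c x) (x := a • x) (by rw [mul_smul, ← hc]), mul_smul]
            rfl }
      have hlin : ∀ w x, lin (ξ w x) = ρ (φ w) (lin x) := by
        intro w x
        change c _ • v = ρ (φ w) (c x • v)
        rw [hc' (a := c x * χ w) (x := ξ w x) (by
          conv_lhs => rw [hc x]
          rw [map_smul, hx, smul_smul]), map_smul, hv w, smul_smul]
      refine ⟨⟨Coinvariants.lift _ (TensorProduct.lift <|
        (Finsupp.lift _ _ _ fun h => ρ h⁻¹ ∘ₗ lin) ∘ₗ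
          (MonoidAlgebra.coeffLinearEquiv k).toLinearMap) fun w => ?_, fun g => ?_⟩, ?_⟩
      · ext h x
        simp only [LinearMap.coe_comp, Function.comp_apply, MonoidAlgebra.lsingle_apply]
        simp [ofMulAction_single, mul_inv_rev, hlin]
      · ext; simp
      · rw [hev]
        simp [lin, hc' (one_smul k x₀).symm]
  rw [← hrange]
  exact (LinearMap.finrank_range_of_inj hinj).symm

end FiniteGroup

/-! ### Kostka numbers and Young subgroups -/

section Kostka

open Finset

/-- The Kostka number: the number of semistandard tableaux of shape `lam` and content `d`. -/
def kostka (lam : YoungDiagram) (d : ℕ →₀ ℕ) : ℕ :=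
  Nat.card {T : SemistandardYoungTableau lam // content T = d}

theorem content_apply {lam : YoungDiagram} (T : SemistandardYoungTableau lam) (j : ℕ) :
    content T j = #{c ∈ lam.cells | T c.1 c.2 = j} := by
  simp [content, Finsupp.finsetSum_apply, Finsupp.single_apply]

instance finite_content (lam : YoungDiagram) (d : ℕ →₀ ℕ) :
    Finite {T : SemistandardYoungTableau lam // content T = d} := by
  let F : {T : SemistandardYoungTableau lam // content T = d} → (lam.cells → d.support) :=
    fun T c => ⟨T.1 c.1.1 c.1.2, by
      obtain ⟨T, rfl⟩ := T
      rw [Finsupp.mem_support_iff, content_apply]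
      refine (Finset.card_pos.2 ⟨c.1, ?_⟩).ne'
      simp⟩
  refine Finite.of_injective F fun T T' h =>
    Subtype.ext (SemistandardYoungTableau.ext fun i j => ?_)
  by_cases hc : (i, j) ∈ lam
  · exact congrArg Subtype.val (congrFun h ⟨(i, j), hc⟩)
  · rw [T.1.zeros hc, T'.1.zeros hc]

/-- The sum of the letters of a word of a given weight. For a partition this is the statistic
`∑ i λ_i`, which decreases strictly in the dominance order. -/
def letterSum : (ℕ →₀ ℕ) →+ ℕ := Finsupp.liftAddHom fun i => (AddMonoidHom.mulRight i)

theorem letterSum_single (i : ℕ) : letterSum (Finsupp.single i 1) = i := by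
  simp [letterSum]

theorem letterSum_rowWeight (lam : YoungDiagram) :
    letterSum (rowWeight lam) = ∑ c ∈ lam.cells, c.1 := by
  simp [rowWeight, map_sum, letterSum_single]

theorem letterSum_content {lam : YoungDiagram} (T : SemistandardYoungTableau lam) :
    letterSum (content T) = ∑ c ∈ lam.cells, T c.1 c.2 := by
  simp [content, map_sum, letterSum_single]

theorem SemistandardYoungTableau.row_le_entry {lam : YoungDiagram}
    (T : SemistandardYoungTableau lam) {i j : ℕ} (h : (i, j) ∈ lam) : i ≤ T i j := by
  induction i with
  | zero => exact Nat.zero_le _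
  | succ i ih =>
    exact (ih (lam.up_left_mem (Nat.le_succ i) le_rfl h)).trans_lt
      (T.col_strict (Nat.lt_succ_self i) h)

theorem rowWeight_eq_content_highestWeight (lam : YoungDiagram) :
    content (SemistandardYoungTableau.highestWeight lam) = rowWeight lam := by
  unfold content rowWeight
  refine Finset.sum_congr rfl fun c hc => ?_
  rw [SemistandardYoungTableau.highestWeight_apply,
    if_pos (show (c.1, c.2) ∈ lam from hc)]

/-- The Kostka matrix is unitriangular with respect to `letterSum`. -/
theorem letterSum_le_of_content_eq {lam mu : YoungDiagram} {T : SemistandardYoungTableau mu}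
    (hT : content T = rowWeight lam) : letterSum (rowWeight mu) ≤ letterSum (rowWeight lam) ∧
      (letterSum (rowWeight mu) = letterSum (rowWeight lam) →
        mu = lam ∧ T = SemistandardYoungTableau.highestWeight mu) := by
  have hle : ∀ c ∈ mu.cells, c.1 ≤ T c.1 c.2 := fun c hc => T.row_le_entry hc
  rw [← hT, letterSum_content, letterSum_rowWeight]
  refine ⟨Finset.sum_le_sum hle, fun h => ?_⟩
  rw [Finset.sum_eq_sum_iff_of_le hle] at h
  have hT' : T = SemistandardYoungTableau.highestWeight mu := by
    ext i j
    rw [SemistandardYoungTableau.highestWeight_apply]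
    split_ifs with hc
    · exact (h (i, j) hc).symm
    · exact T.zeros hc
  exact ⟨rowWeight_injective (by rw [← hT, hT', rowWeight_eq_content_highestWeight]), hT'⟩

theorem letterSum_le_of_kostka_ne_zero {lam mu : YoungDiagram}
    (h : kostka mu (rowWeight lam) ≠ 0) :
    letterSum (rowWeight mu) ≤ letterSum (rowWeight lam) ∧
      (letterSum (rowWeight mu) = letterSum (rowWeight lam) → mu = lam) := by
  obtain ⟨⟨T, hT⟩⟩ := (Nat.card_ne_zero.1 h).1
  exact ⟨(letterSum_le_of_content_eq hT).1, fun h => ((letterSum_le_of_content_eq hT).2 h).1⟩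

theorem kostka_self (lam : YoungDiagram) : kostka lam (rowWeight lam) = 1 := by
  rw [kostka, Nat.card_eq_one_iff_unique]
  refine ⟨⟨fun T T' => Subtype.ext ?_⟩, ⟨⟨_, rowWeight_eq_content_highestWeight lam⟩⟩⟩
  rw [((letterSum_le_of_content_eq T.2).2 rfl).2, ((letterSum_le_of_content_eq T'.2).2 rfl).2]

/-- Semistandard tableaux are determined by the numbers of entries at most `v` in each row. -/
theorem SemistandardYoungTableau.ext_of_card {lam : YoungDiagram}
    {T T' : SemistandardYoungTableau lam}
    (h : ∀ i v, #{c ∈ lam.cells | c.1 = i ∧ T c.1 c.2 ≤ v} =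
      #{c ∈ lam.cells | c.1 = i ∧ T' c.1 c.2 ≤ v}) : T = T' := by
  have key : ∀ (T : SemistandardYoungTableau lam) (i j v : ℕ), (i, j) ∈ lam →
      (T i j ≤ v ↔ j < #{c ∈ lam.cells | c.1 = i ∧ T c.1 c.2 ≤ v}) := by
    intro T i j v hc
    constructor
    · intro hv
      have hsub : (range (j + 1)).map ⟨fun j' => (i, j'), Prod.mk_right_injective i⟩ ⊆
          {c ∈ lam.cells | c.1 = i ∧ T c.1 c.2 ≤ v} := by
        intro c hc'
        obtain ⟨j', hj', rfl⟩ := Finset.mem_map.1 hc'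
        have hj : j' ≤ j := by simpa [Nat.lt_succ_iff] using hj'
        exact Finset.mem_filter.2 ⟨lam.up_left_mem le_rfl hj hc, rfl,
          (T.row_weak_of_le hj hc).trans hv⟩
      simpa using Finset.card_le_card hsub
    · intro hlt
      by_contra hv
      have hsub : ({c ∈ lam.cells | c.1 = i ∧ T c.1 c.2 ≤ v} : Finset (ℕ × ℕ)) ⊆
          (range j).map ⟨fun j' => (i, j'), Prod.mk_right_injective i⟩ := by
        rintro ⟨i', j'⟩ hc'
        obtain ⟨hm, rfl, hle⟩ := Finset.mem_filter.1 hc'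
        refine Finset.mem_map.2 ⟨j', ?_, rfl⟩
        rw [Finset.mem_range]
        by_contra hj
        exact hv ((T.row_weak_of_le (not_lt.1 hj) hm).trans hle)
      have := Finset.card_le_card hsub
      rw [Finset.card_map, Finset.card_range] at this
      omega
  ext i j
  by_cases hc : (i, j) ∈ lam
  · refine le_antisymm ?_ ?_
    · rw [key T i j _ hc, h, ← key T' i j _ hc]
    · rw [key T' i j _ hc, ← h, ← key T i j _ hc]
  · rw [T.zeros hc, T'.zeros hc]

end Kostka

section StabInvariants

open Finset

open Module

variable {k : Type*} [Field k] {α : Type} [Fintype α] [DecidableEq α] {lam : YoungDiagram}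

/-- The Young subgroup of all permutations that preserve a word. -/
def wordStab (f : α → ℕ) : Subgroup (Equiv.Perm α) where
  carrier := {g | f ∘ g = f}
  mul_mem' {g h} hg hh := by
    change f ∘ (g ∘ h) = f
    rw [← Function.comp_assoc, show f ∘ g = f from hg, show f ∘ h = f from hh]
  one_mem' := rfl
  inv_mem' {g} hg := by
    change f ∘ ⇑g⁻¹ = f
    conv_lhs => rw [← show f ∘ g = f from hg]
    ext a; simp

theorem mem_wordStab {f : α → ℕ} {g : Equiv.Perm α} : g ∈ wordStab f ↔ f ∘ g = f := Iff.rfl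

theorem swap_mem_wordStab {f : α → ℕ} {a b : α} (h : f a = f b) : Equiv.swap a b ∈ wordStab f :=
  funext (Equiv.apply_swap_eq_self h)

theorem spechtRep_coe (σ : Equiv.Perm α) (v : spechtModule k lam α) :
    (spechtRep k lam α σ v : (α → ℕ) →₀ k) = rowFunctionRep k α σ v := rfl

instance finiteDimensional_spechtModule : FiniteDimensional k (spechtModule k lam α) :=
  FiniteDimensional.span_of_finite k (Set.finite_range _)

variable (k) in
/-- The sign of a permutation as an element of the field. -/
def permSign (g : Equiv.Perm α) : k := ((Equiv.Perm.sign g : ℤ) : k)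

theorem permSign_mul (g h : Equiv.Perm α) : permSign k (g * h) = permSign k g * permSign k h := by
  simp [permSign]

theorem permSign_mul_self (g : Equiv.Perm α) : permSign k g * permSign k g = 1 := by
  rw [permSign, ← Int.cast_mul, ← Units.val_mul, Int.units_mul_self]
  simp

variable (k lam) in
/-- The vectors of the Specht module on which `W` acts by the scalars `χ`, as a subspace of the
space of all combinations of words. -/
def spechtSemiInvariants {W : Type*} [Group W] (φ : W →* Equiv.Perm α) (χ : W → k) :
    Submodule k ((α → ℕ) →₀ k) :=
  spechtModule k lam α ⊓ semiInvariants φ χ (rowFunctionRep k α)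

instance finiteDimensional_spechtSemiInvariants {W : Type*} [Group W] (φ : W →* Equiv.Perm α)
    (χ : W → k) : FiniteDimensional k (spechtSemiInvariants k lam φ χ) :=
  Submodule.finiteDimensional_of_le inf_le_left

theorem finrank_semiInvariants_spechtRep {W : Type*} [Group W] (φ : W →* Equiv.Perm α)
    (χ : W → k) : finrank k (semiInvariants φ χ (spechtRep k lam α)) =
      finrank k (spechtSemiInvariants k lam φ χ) := by
  refine LinearEquiv.finrank_eq
    { toFun := fun v => ⟨v.1.1, v.1.2, fun w => congrArg Subtype.val (v.2 w)⟩
      invFun := fun v => ⟨⟨v.1, v.2.1⟩, fun w => Subtype.ext (v.2.2 w)⟩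
      map_add' := fun _ _ => rfl
      map_smul' := fun _ _ => rfl
      left_inv := fun _ => rfl
      right_inv := fun _ => rfl }

theorem exists_equivFin_antitone (f : α → ℕ) :
    ∃ e : α ≃ Fin (Fintype.card α), ∀ a b, e a ≤ e b → f b ≤ f a := by
  let e₀ := Fintype.equivFin α
  let σ := Tuple.sort (OrderDual.toDual ∘ f ∘ e₀.symm)
  have hσ : Monotone ((OrderDual.toDual ∘ f ∘ e₀.symm) ∘ σ) := Tuple.monotone_sort _
  refine ⟨e₀.trans σ.symm, fun a b h => ?_⟩
  have := hσ h
  simpa using this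

variable (lam) in
/-- The words that can lead a vector of the Specht module on which the Young subgroup of `f` acts
by the sign. -/
def signLeadingWords (e : α ≃ Fin (Fintype.card α)) (f : α → ℕ) : Set (α → ℕ) :=
  {w | wordWeight w = rowWeight lam ∧ IsYamanouchi e w ∧
    ∀ a b, f a = f b → e a < e b → w b < w a}

theorem finite_wordWeight (d : ℕ →₀ ℕ) : {w : α → ℕ | wordWeight w = d}.Finite := by
  refine (Set.Finite.pi' fun _ : α => d.support.finite_toSet).subset fun w hw a => ?_
  rw [← show wordWeight w = d from hw, Finset.mem_coe, Finsupp.mem_support_iff, wordWeight_apply]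
  exact (Finset.card_pos.2 ⟨a, by simp⟩).ne'

theorem sum_cells_eq_sum {M : Type*} [AddCommMonoid M] (t : Tableau lam α) (F : ℕ × ℕ → M)
    (F' : α → M) (h : ∀ c, F c.1 = F' (t c)) : ∑ c ∈ lam.cells, F c = ∑ a, F' a := by
  rw [← Finset.sum_coe_sort lam.cells F]
  exact Fintype.sum_equiv t _ _ h

/-- Recording the labels `f` in the cells of the transpose of the standard tableau of a leading
word gives a semistandard tableau. -/
theorem exists_semistandard_of_signLeadingWord {e : α ≃ Fin (Fintype.card α)} {f : α → ℕ}
    (hf : ∀ a b, e a ≤ e b → f b ≤ f a) {w : α → ℕ} (hw : w ∈ signLeadingWords lam e f) :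
    ∃ T : SemistandardYoungTableau lam.transpose, content T = wordWeight f ∧
      ∃ t : Tableau lam α, t.tabloid = w ∧ ∀ c, T c.1.2 c.1.1 = f (t c) := by
  classical
  obtain ⟨hwt, hY, hstrict⟩ := hw
  obtain ⟨t, rfl, ht⟩ := hY.exists_isStandard hwt
  let F : ℕ → ℕ → ℕ := fun j i => if h : (i, j) ∈ lam.cells then f (t ⟨(i, j), h⟩) else 0
  have hF : ∀ c, F c.1.2 c.1.1 = f (t c) := fun c => dif_pos c.2
  have hmem : ∀ {i j}, (j, i) ∈ lam.transpose ↔ (i, j) ∈ lam.cells := by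
    intro i j
    rw [YoungDiagram.mem_transpose, YoungDiagram.mem_cells]
    rfl
  refine ⟨⟨F, ?_, ?_, ?_⟩, ?_, t, rfl, hF⟩
  · intro j i1 i2 hi hc
    have hc2 := hmem.1 hc
    have hc1 : (i1, j) ∈ lam.cells := lam.up_left_mem hi.le le_rfl hc2
    rw [hF ⟨_, hc1⟩, hF ⟨_, hc2⟩]
    exact hf _ _ (ht.2 ⟨_, hc1⟩ ⟨_, hc2⟩ rfl hi).le
  · intro j1 j2 i hj hc
    have hc2 := hmem.1 hc
    have hc1 : (i, j1) ∈ lam.cells := lam.up_left_mem le_rfl hj.le hc2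
    rw [hF ⟨_, hc1⟩, hF ⟨_, hc2⟩]
    have hlt := ht.1 ⟨_, hc1⟩ ⟨_, hc2⟩ rfl hj
    refine (hf _ _ hlt.le).lt_of_ne fun heq => ?_
    have := hstrict _ _ heq.symm hlt
    simp [Tableau.tabloid] at this
  · intro j i hc
    exact dif_neg fun h => hc (hmem.2 h)
  · rw [content, wordWeight,
      ← sum_cells_eq_sum t (fun c => Finsupp.single (F c.2 c.1) 1) _ fun c => by rw [hF]]
    refine Finset.sum_equiv (Equiv.prodComm ℕ ℕ) (fun c => ?_) fun c _ => rfl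
    obtain ⟨j, i⟩ := c
    rw [YoungDiagram.mem_cells, hmem]
    rfl

/-- The space of vectors of a Specht module on which a Young subgroup acts by the sign has at most
the dimension given by the Kostka number of the transposed partition. -/
theorem finrank_sign_le_kostka [CharZero k] (lam : YoungDiagram) (f : α → ℕ) :
    finrank k (spechtSemiInvariants k lam (wordStab f).subtype
      fun g => permSign k (g : Equiv.Perm α)) ≤ kostka lam.transpose (wordWeight f) := by
  obtain ⟨e, hf⟩ := exists_equivFin_antitone f
  set V := spechtSemiInvariants k lam (wordStab f).subtype
    fun g => permSign k (g : Equiv.Perm α)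
  have hfin : (signLeadingWords lam e f).Finite :=
    (finite_wordWeight (rowWeight lam)).subset fun w hw => hw.1
  have := hfin.fintype
  let ev : V →ₗ[k] (signLeadingWords lam e f → k) :=
    { toFun := fun v w => (v : (α → ℕ) →₀ k) w
      map_add' := fun _ _ => rfl
      map_smul' := fun _ _ => rfl }
  have hev : Function.Injective ev := by
    intro v₁ v₂ h₁₂
    by_contra hne
    let v : V := ⟨v₁ - v₂, sub_mem v₁.2 v₂.2⟩
    have hv : ∀ w : signLeadingWords lam e f, (v : (α → ℕ) →₀ k) w = 0 := fun w => by
      change ((v₁ : (α → ℕ) →₀ k) - v₂) w = 0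
      rw [Finsupp.sub_apply]
      exact sub_eq_zero.2 (congrFun h₁₂ w)
    have hne' : (v : (α → ℕ) →₀ k) ≠ 0 := fun h => hne (Subtype.ext (sub_eq_zero.1 h))
    obtain ⟨w, hw, hmax⟩ := Finset.exists_max_image (v : (α → ℕ) →₀ k).support (wordKey e)
      (Finsupp.support_nonempty_iff.2 hne')
    rw [Finsupp.mem_support_iff] at hw
    have hmax' : ∀ u, (v : (α → ℕ) →₀ k) u ≠ 0 → wordKey e u ≤ wordKey e w := fun u hu =>
      hmax u (Finsupp.mem_support_iff.2 hu)
    have hhw : (v : (α → ℕ) →₀ k) ∈ hwSpace k α (rowWeight lam) :=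
      spechtModule_le_hwSpace v.2.1
    have hgood : w ∈ signLeadingWords lam e f := by
      refine ⟨mem_weightSpace.1 (mem_hwSpace.1 hhw).1 w hw,
        isYamanouchi_of_leading hhw hw hmax', ?_⟩
      intro a b hab hlt
      have hne : a ≠ b := fun h => by rw [h] at hlt; exact lt_irrefl _ hlt
      have hstab : Equiv.swap a b ∈ wordStab f := swap_mem_wordStab hab
      have hsign := DFunLike.congr_fun (v.2.2 ⟨_, hstab⟩) w
      change rowFunctionRep k α (Equiv.swap a b) (v : (α → ℕ) →₀ k) w =
        permSign k (Equiv.swap a b) * (v : (α → ℕ) →₀ k) w at hsign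
      rw [rowFunctionRep_apply, permSign, Equiv.Perm.sign_swap hne] at hsign
      have hsw : (v : (α → ℕ) →₀ k) (w ∘ Equiv.swap a b) ≠ 0 := by
        rw [hsign]
        simpa using hw
      have hle := hmax' _ hsw
      by_contra hge
      rcases (not_lt.1 hge).lt_or_eq with h | h
      · refine hle.not_gt (wordKey_lt a (by simpa using h) fun c hc => ?_)
        have h1 : c ≠ a := fun h => by rw [h] at hc; exact lt_irrefl _ hc
        have h2 : c ≠ b := fun h => by rw [h] at hc; exact lt_asymm hc hlt
        rw [Function.comp_apply, Equiv.swap_apply_of_ne_of_ne h1 h2]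
      · rw [mem_wordStab.1 (swap_mem_wordStab h)] at hsign
        apply hw
        have h2 : (2 : k) * (v : (α → ℕ) →₀ k) w = 0 := by
          rw [two_mul]
          nth_rewrite 1 [hsign]
          simp
        simpa using h2
    exact hw (hv ⟨w, hgood⟩)
  refine (LinearMap.finrank_le_finrank_of_injective hev).trans ?_
  rw [Module.finrank_fintype_fun_eq_card, ← Nat.card_eq_fintype_card, kostka]
  choose T hT t ht hTt using fun w : signLeadingWords lam e f =>
    exists_semistandard_of_signLeadingWord hf w.2
  refine Nat.card_le_card_of_injective (fun w => (⟨T w, hT w⟩ :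
    {T : SemistandardYoungTableau lam.transpose // content T = wordWeight f})) ?_
  intro w w' hww
  have hTT : T w = T w' := congrArg Subtype.val hww
  -- Each block of `f` has the same set of letters in both words, and both words are decreasing on
  -- the blocks.
  have himage : ∀ w w' : signLeadingWords lam e f, T w = T w' → ∀ a, ∃ b, f b = f a ∧
      w.1 b = w'.1 a := by
    intro w w' hTT a
    refine ⟨t w ((t w').symm a), ?_, ?_⟩
    · rw [← hTt w, hTT, hTt w', Equiv.apply_symm_apply]
    · rw [← ht w, ← ht w']
      simp [Tableau.tabloid]
  have main : ∀ w w' : signLeadingWords lam e f, T w = T w' →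
      ¬ wordKey e w.1 < wordKey e w'.1 := by
    intro w w' hTT hlt
    obtain ⟨a, ha, hbefore⟩ := exists_of_wordKey_lt hlt
    obtain ⟨b, hb, hwb⟩ := himage w w' hTT a
    have hba : e b < e a := by
      rcases lt_trichotomy (e a) (e b) with h | h | h
      · exact absurd ((hwb.symm.trans_lt (w.2.2.2 a b hb.symm h)).trans ha) (lt_irrefl _)
      · obtain rfl := e.injective h
        exact absurd hwb ha.ne
      · exact h
    have h1 := hbefore b hba
    have h2 := w'.2.2.2 b a hb hba
    exact h2.ne' (h1.symm.trans hwb)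
  refine Subtype.ext (wordKey_injective e ?_)
  exact le_antisymm (not_lt.1 (main w' w hTT.symm)) (not_lt.1 (main w w' hTT))

end StabInvariants

/-! ### Orthonormality of the Specht modules and the sign twist -/

section Orthonormality

open Finset Module Representation

variable {k : Type*} [Field k] {α : Type} [Fintype α] [DecidableEq α] {lam mu : YoungDiagram}

/-- The word that records the column of each entry of a tableau. -/
def Tableau.columnWord (t : Tableau lam α) : α → ℕ := fun a => (t.symm a).1.2

/-- The transposed tableau. -/
def Tableau.transposed (t : Tableau lam α) : Tableau lam.transpose α :=
  Equiv.trans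
    { toFun := fun c => ⟨c.1.swap, by
        rw [YoungDiagram.mem_cells]
        exact YoungDiagram.mem_transpose.1 ((YoungDiagram.mem_cells _).1 c.2)⟩
      invFun := fun c => ⟨c.1.swap, by
        rw [YoungDiagram.mem_cells, YoungDiagram.mem_transpose, Prod.swap_swap]
        exact c.2⟩
      left_inv := fun _ => rfl
      right_inv := fun _ => rfl } t

theorem Tableau.tabloid_transposed (t : Tableau lam α) :
    t.transposed.tabloid = t.columnWord := rfl

theorem Tableau.columnWord_transposed (t : Tableau lam α) :
    t.transposed.columnWord = t.tabloid := rfl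

theorem Tableau.wordWeight_columnWord (t : Tableau lam α) :
    wordWeight t.columnWord = rowWeight lam.transpose := by
  rw [← Tableau.tabloid_transposed, wordWeight_tabloid]

theorem Tableau.isColStab_iff {t : Tableau lam α} {π : Equiv.Perm α} :
    t.IsColStab π ↔ t.columnWord ∘ π = t.columnWord := funext_iff.symm

theorem Tableau.isColStab_transposed {t : Tableau lam α} {π : Equiv.Perm α} :
    t.transposed.IsColStab π ↔ t.tabloid ∘ π = t.tabloid := by
  rw [Tableau.isColStab_iff, Tableau.columnWord_transposed]

theorem rowFunctionRep_polytabloid_of_isColStab (t : Tableau lam α) {π : Equiv.Perm α}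
    (h : t.IsColStab π) :
    rowFunctionRep k α π (t.polytabloid k) = permSign k π • t.polytabloid k := by
  classical
  rw [Tableau.polytabloid_eq, map_sum, Finset.smul_sum]
  refine Finset.sum_equiv (Equiv.mulLeft π) ?_ ?_
  · intro τ
    rw [Finset.mem_filter_univ, Finset.mem_filter_univ]
    exact ⟨fun hτ => h.mul hτ, fun hτ => by simpa using h.inv.mul hτ⟩
  · intro τ _
    rw [Equiv.coe_mulLeft, map_smul, ← Module.End.mul_apply, ← map_mul, smul_smul]
    congr 1
    change permSign k τ = permSign k π * permSign k (π * τ)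
    rw [permSign_mul, ← mul_assoc, permSign_mul_self, one_mul]

theorem exists_tableau (h : lam.card = Fintype.card α) : Nonempty (Tableau lam α) :=
  ⟨Fintype.equivOfCardEq (by simpa using h)⟩

/-- The polytabloid of `t` as an element of the Specht module. -/
def Tableau.spechtVector (k : Type*) [Field k] (t : Tableau lam α) : spechtModule k lam α :=
  ⟨t.polytabloid k, Submodule.subset_span ⟨t, rfl⟩⟩

theorem Tableau.spechtVector_ne_zero (t : Tableau lam α) : t.spechtVector k ≠ 0 := by
  intro h
  have h1 := t.polytabloid_apply_tabloid (k := k)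
  rw [show t.polytabloid k = 0 from congrArg Subtype.val h] at h1
  exact zero_ne_one h1

/-- The Specht module is generated by any one of its polytabloids. -/
theorem intertwiningMap_ext_spechtVector {V : Type*} [AddCommMonoid V] [Module k V]
    {σ : Representation k (Equiv.Perm α) V} (t : Tableau lam α)
    {φ ψ : IntertwiningMap (spechtRep k lam α) σ}
    (h : φ (t.spechtVector k) = ψ (t.spechtVector k)) : φ = ψ := by
  refine IntertwiningMap.ext (LinearMap.ext fun x => ?_)
  obtain ⟨x, hx⟩ := x
  change φ ⟨x, hx⟩ = ψ ⟨x, hx⟩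
  have key : ∀ y, ∀ hy : y ∈ spechtModule k lam α, φ ⟨y, hy⟩ = ψ ⟨y, hy⟩ := by
    intro y hy
    induction hy using Submodule.span_induction with
    | mem y hy =>
      obtain ⟨t', rfl⟩ := hy
      have ht : (⟨t'.polytabloid k, Submodule.subset_span ⟨t', rfl⟩⟩ : spechtModule k lam α) =
          spechtRep k lam α (t.symm.trans t') (t.spechtVector k) := by
        refine Subtype.ext ?_
        rw [spechtRep_coe, Tableau.spechtVector, rowFunctionRep_polytabloid]
        exact congrArg (Tableau.polytabloid k) (Equiv.ext fun c => by simp :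
          t' = t.trans (t.symm.trans t'))
      rw [ht, φ.isIntertwining, ψ.isIntertwining, h]
    | zero => exact (map_zero φ).trans (map_zero ψ).symm
    | add a b ha hb h1 h2 =>
      exact (map_add φ ⟨a, ha⟩ ⟨b, hb⟩).trans ((congrArg₂ _ h1 h2).trans
        (map_add ψ ⟨a, ha⟩ ⟨b, hb⟩).symm)
    | smul c a ha h1 =>
      exact (map_smul φ c ⟨a, ha⟩).trans ((congrArg _ h1).trans (map_smul ψ c ⟨a, ha⟩).symm)
  exact key x hx

/-- A homomorphism from `S^μ` is determined by the image of a polytabloid, and the column stabiliser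
acts on this image by the sign. -/
theorem finrank_hom_specht_le_kostka [CharZero k] (lam : YoungDiagram)
    (hmu : mu.card = Fintype.card α) :
    finrank k (IntertwiningMap (spechtRep k mu α) (spechtRep k lam α)) ≤
      kostka lam.transpose (rowWeight mu.transpose) := by
  obtain ⟨t⟩ := exists_tableau hmu
  rw [← t.wordWeight_columnWord]
  refine le_trans ?_ (finrank_sign_le_kostka (k := k) lam t.columnWord)
  let ev : IntertwiningMap (spechtRep k mu α) (spechtRep k lam α) →ₗ[k]
      spechtSemiInvariants k lam (wordStab t.columnWord).subtype
        fun g => permSign k (g : Equiv.Perm α) :=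
    { toFun := fun φ => ⟨φ (t.spechtVector k), (φ (t.spechtVector k)).2, fun g => by
        have h : spechtRep k mu α g.1 (t.spechtVector k) = permSign k g.1 • t.spechtVector k :=
          Subtype.ext (rowFunctionRep_polytabloid_of_isColStab t (Tableau.isColStab_iff.2 g.2))
        have h2 := congrArg φ h
        rw [φ.isIntertwining, map_smul] at h2
        exact congrArg Subtype.val h2⟩
      map_add' := fun _ _ => rfl
      map_smul' := fun _ _ => rfl }
  refine LinearMap.finrank_le_finrank_of_injective (f := ev) fun φ ψ h => ?_
  have h' : (ev φ).1 = (ev ψ).1 := congrArg Subtype.val h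
  exact intertwiningMap_ext_spechtVector t (Subtype.ext h')

theorem finrank_end_specht [CharZero k] (hlam : lam.card = Fintype.card α) :
    finrank k (IntertwiningMap (spechtRep k lam α) (spechtRep k lam α)) = 1 := by
  refine le_antisymm ?_ ?_
  · have := finrank_hom_specht_le_kostka (k := k) lam hlam
    rwa [kostka_self] at this
  · obtain ⟨t⟩ := exists_tableau hlam
    refine Nat.one_le_iff_ne_zero.2 fun h => ?_
    have hsub := finrank_zero_iff.1 h
    have h1 : IntertwiningMap.id (spechtRep k lam α) = 0 := Subsingleton.elim _ _
    exact t.spechtVector_ne_zero (DFunLike.congr_fun h1 (t.spechtVector k))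

/-- The Specht modules are orthonormal: nonzero homomorphisms in both directions between `S^λ` and
`S^μ` force `λ = μ` by the triangularity of the Kostka numbers. -/
theorem finrank_hom_specht [CharZero k] [DecidableEq YoungDiagram]
    (hlam : lam.card = Fintype.card α) (hmu : mu.card = Fintype.card α) :
    finrank k (IntertwiningMap (spechtRep k lam α) (spechtRep k mu α)) =
      if lam = mu then 1 else 0 := by
  split_ifs with h
  · subst h
    exact finrank_end_specht hlam
  · by_contra hne
    apply h
    have h1 := finrank_hom_specht_le_kostka (k := k) mu hlam
    have h2 := finrank_hom_specht_le_kostka (k := k) lam hmu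
    rw [finrank_hom_comm] at h2
    obtain ⟨h3, h4⟩ := letterSum_le_of_kostka_ne_zero (by omega :
      kostka mu.transpose (rowWeight lam.transpose) ≠ 0)
    obtain ⟨h5, -⟩ := letterSum_le_of_kostka_ne_zero (by omega :
      kostka lam.transpose (rowWeight mu.transpose) ≠ 0)
    exact (YoungDiagram.transpose_eq_iff.1 (h4 (le_antisymm h3 h5))).symm

/-- The twist of a representation by the sign. -/
def signTwist {V : Type*} [AddCommMonoid V] [Module k V]
    (ρ : Representation k (Equiv.Perm α) V) : Representation k (Equiv.Perm α) V where
  toFun g := permSign k g • ρ g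
  map_one' := by simp [permSign]
  map_mul' g h := by
    rw [permSign_mul, map_mul]
    ext v
    simp [smul_smul, mul_comm]

theorem finrank_end_signTwist {V : Type*} [AddCommMonoid V] [Module k V]
    (ρ : Representation k (Equiv.Perm α) V) :
    finrank k (IntertwiningMap (signTwist ρ) (signTwist ρ)) =
      finrank k (IntertwiningMap ρ ρ) := by
  have hne : ∀ g : Equiv.Perm α, permSign k g ≠ 0 := fun g h => by
    have := permSign_mul_self (k := k) g
    rw [h, zero_mul] at this
    exact zero_ne_one this
  have h1 : ∀ (φ : V →ₗ[k] V), (∀ g, φ ∘ₗ signTwist ρ g = signTwist ρ g ∘ₗ φ) ↔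
      ∀ g, φ ∘ₗ ρ g = ρ g ∘ₗ φ := by
    intro φ
    refine forall_congr' fun g => ?_
    change φ ∘ₗ (permSign k g • ρ g) = (permSign k g • ρ g) ∘ₗ φ ↔ _
    rw [LinearMap.comp_smul, LinearMap.smul_comp]
    refine ⟨fun h => ?_, fun h => by rw [h]⟩
    have := congrArg (fun z => (permSign k g)⁻¹ • z) h
    simpa [smul_smul, hne g] using this
  refine LinearEquiv.finrank_eq
    { toFun := fun φ => ⟨φ.toLinearMap, (h1 _).1 φ.isIntertwining'⟩
      invFun := fun φ => ⟨φ.toLinearMap, (h1 _).2 φ.isIntertwining'⟩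
      map_add' := fun _ _ => rfl
      map_smul' := fun _ _ => rfl
      left_inv := fun _ => rfl
      right_inv := fun _ => rfl }

/-- The map `v ↦ ∑_g sgn(g) v(g {t}) g e_{t'}` from words to the Specht module of the transposed
partition, where `v(u)` is the coefficient of the word `u`. -/
def transposeMap (t : Tableau lam α) :
    ((α → ℕ) →₀ k) →ₗ[k] spechtModule k lam.transpose α :=
  ∑ g : Equiv.Perm α, permSign k g •
    (Finsupp.lapply (t.tabloid ∘ ⇑g⁻¹)).smulRight
      (spechtRep k lam.transpose α g (t.transposed.spechtVector k))

theorem transposeMap_apply (t : Tableau lam α) (v : (α → ℕ) →₀ k) :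
    transposeMap t v = ∑ g : Equiv.Perm α, permSign k g • v (t.tabloid ∘ ⇑g⁻¹) •
      spechtRep k lam.transpose α g (t.transposed.spechtVector k) := by
  simp [transposeMap]

theorem transposeMap_rowFunctionRep (t : Tableau lam α) (h : Equiv.Perm α) (v : (α → ℕ) →₀ k) :
    transposeMap t (rowFunctionRep k α h v) =
      permSign k h • spechtRep k lam.transpose α h (transposeMap t v) := by
  rw [transposeMap_apply, transposeMap_apply, map_sum, Finset.smul_sum]
  refine Fintype.sum_equiv (Equiv.mulLeft h⁻¹) _ _ fun g => ?_
  have e : permSign k h * permSign k (h⁻¹ * g) = permSign k g := by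
    rw [← permSign_mul, mul_inv_cancel_left]
  rw [Equiv.coe_mulLeft, map_smul, map_smul, ← Module.End.mul_apply, ← map_mul,
    mul_inv_cancel_left, smul_smul (permSign k h) (permSign k (h⁻¹ * g)), e, rowFunctionRep_apply]
  congr 3

theorem transposeMap_spechtVector_ne_zero [CharZero k] (t : Tableau lam α) :
    transposeMap t (t.polytabloid k) ≠ 0 := by
  classical
  intro h0
  have h1 := DFunLike.congr_fun (congrArg Subtype.val h0) t.columnWord
  rw [transposeMap_apply, AddSubmonoidClass.coe_finsetSum, Finsupp.finsetSum_apply] at h1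
  -- Each nonzero term is `1`: if `{t} g⁻¹ = {t} π` with `π` in the column stabiliser, then `π g` is
  -- in the row stabiliser, which is the column stabiliser of the transposed tableau.
  have hterm : ∀ g : Equiv.Perm α, (↑(permSign k g • t.polytabloid k (t.tabloid ∘ ⇑g⁻¹) •
      spechtRep k lam.transpose α g (t.transposed.spechtVector k)) : (α → ℕ) →₀ k) t.columnWord =
      if t.polytabloid k (t.tabloid ∘ ⇑g⁻¹) ≠ 0 then 1 else 0 := by
    intro g
    change permSign k g * (t.polytabloid k (t.tabloid ∘ ⇑g⁻¹) *
      rowFunctionRep k α g (t.transposed.polytabloid k) t.columnWord) = _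
    split_ifs with hne
    · obtain ⟨π, hπ, hg⟩ := t.exists_of_polytabloid_ne_zero hne
      have hrow : t.transposed.IsColStab (π * g) := by
        rw [Tableau.isColStab_transposed, Equiv.Perm.coe_mul, ← Function.comp_assoc, ← hg]
        ext a; simp
      have hcol : t.columnWord ∘ g = t.transposed.tabloid ∘ ⇑(π * g) := by
        rw [Tableau.tabloid_transposed, Equiv.Perm.coe_mul, ← Function.comp_assoc,
          Tableau.isColStab_iff.1 hπ]
      rw [rowFunctionRep_apply, hcol, Tableau.polytabloid_apply_comp _ hrow, hg,
        Tableau.polytabloid_apply_comp _ hπ]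
      change permSign k g * (permSign k π * permSign k (π * g)) = 1
      rw [permSign_mul, ← mul_assoc (permSign k π), permSign_mul_self, one_mul, permSign_mul_self]
    · rw [not_not.1 hne, zero_mul, mul_zero]
  rw [Finset.sum_congr rfl fun g _ => hterm g, Finset.sum_boole] at h1
  have hpos : 0 < #{g : Equiv.Perm α | t.polytabloid k (t.tabloid ∘ ⇑g⁻¹) ≠ 0} :=
    Finset.card_pos.2 ⟨1, by
      rw [Finset.mem_filter_univ, inv_one, Equiv.Perm.coe_one, Function.comp_id,
        Tableau.polytabloid_apply_tabloid]
      exact one_ne_zero⟩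
  exact hpos.ne' (((Nat.cast_eq_zero (R := k)).1 h1))

/-- The Specht module of the transposed partition is the twist by the sign. -/
theorem exists_transpose_equiv [CharZero k] (hlam : lam.card = Fintype.card α) :
    ∃ θ : spechtModule k lam α ≃ₗ[k] spechtModule k lam.transpose α,
      ∀ g x, θ (spechtRep k lam α g x) = permSign k g • spechtRep k lam.transpose α g (θ x) := by
  obtain ⟨t⟩ := exists_tableau hlam
  let φ : IntertwiningMap (spechtRep k lam α) (signTwist (spechtRep k lam.transpose α)) :=
    { toLinearMap := transposeMap t ∘ₗ (spechtModule k lam α).subtype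
      isIntertwining' := fun g => LinearMap.ext fun x => by
        change transposeMap t (rowFunctionRep k α g (x : (α → ℕ) →₀ k)) =
          permSign k g • spechtRep k lam.transpose α g (transposeMap t (x : (α → ℕ) →₀ k))
        exact transposeMap_rowFunctionRep t g _ }
  have hφ : φ ≠ 0 := fun h => transposeMap_spechtVector_ne_zero (k := k) t
    (DFunLike.congr_fun h (t.spechtVector k))
  have hcard : lam.transpose.card = Fintype.card α := by
    rw [← degree_rowWeight, ← t.wordWeight_columnWord, degree_wordWeight]
  obtain ⟨s, hs⟩ := exists_section ((finrank_end_signTwist _).trans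
    (finrank_end_specht (k := k) hcard)) φ hφ
  obtain ⟨s', hs'⟩ := exists_retraction (finrank_end_specht hlam) φ hφ
  have hbij : Function.Bijective φ.toLinearMap :=
    ⟨Function.LeftInverse.injective hs', Function.RightInverse.surjective hs⟩
  exact ⟨LinearEquiv.ofBijective φ.toLinearMap hbij, fun g x => φ.isIntertwining _ _ g x⟩

/-- Transposing the partition twists linear characters of subgroups by the sign. -/
theorem finrank_spechtSemiInvariants_transpose [CharZero k] (hlam : lam.card = Fintype.card α)
    {W : Type*} [Group W] (φ : W →* Equiv.Perm α) (χ : W → k) :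
    finrank k (spechtSemiInvariants k lam φ χ) =
      finrank k (spechtSemiInvariants k lam.transpose φ fun w => permSign k (φ w) * χ w) := by
  obtain ⟨θ, hθ⟩ := exists_transpose_equiv (k := k) hlam
  rw [← finrank_semiInvariants_spechtRep, ← finrank_semiInvariants_spechtRep]
  have hiff : ∀ x, x ∈ semiInvariants φ χ (spechtRep k lam α) ↔
      θ x ∈ semiInvariants φ (fun w => permSign k (φ w) * χ w) (spechtRep k lam.transpose α) := by
    intro x
    refine forall_congr' fun w => ?_
    rw [← θ.injective.eq_iff, hθ, map_smul]
    constructor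
    · intro h
      rw [mul_smul, ← h, smul_smul, permSign_mul_self, one_smul]
    · intro h
      rw [h, smul_smul, ← mul_assoc, permSign_mul_self, one_mul]
  refine LinearEquiv.finrank_eq
    { toFun := fun x => ⟨θ x.1, (hiff _).1 x.2⟩
      invFun := fun y => ⟨θ.symm y.1, (hiff _).2 (by rw [θ.apply_symm_apply]; exact y.2)⟩
      map_add' := fun x y => Subtype.ext (map_add θ x.1 y.1)
      map_smul' := fun c x => Subtype.ext (map_smul θ c x.1)
      left_inv := fun x => Subtype.ext (θ.symm_apply_apply x.1)
      right_inv := fun y => Subtype.ext (θ.apply_symm_apply y.1) }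

end Orthonormality

/-! ### Young's rule -/

section LowerBound

open Finset Module Representation

variable {k : Type*} [Field k] {α : Type} [Fintype α] [DecidableEq α] {lam : YoungDiagram}

/-- The sums of the letters of `w` over the blocks of `f`, as an element of a lexicographic order in
which the blocks with the larger labels are the more significant ones. -/
def blockKey (f w : α → ℕ) : Lex (Fin (univ.sup f + 1) → ℕ) :=
  toLex fun i => ∑ a with f a + i = univ.sup f, w a

theorem blockKey_comp {f : α → ℕ} (w : α → ℕ) {g : Equiv.Perm α} (hg : g ∈ wordStab f) :
    blockKey f (w ∘ g) = blockKey f w := by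
  refine congrArg toLex (funext fun i => ?_)
  refine Finset.sum_equiv g (fun a => ?_) fun a _ => rfl
  rw [mem_filter_univ, mem_filter_univ, ← Function.comp_apply (f := f) (g := g), mem_wordStab.1 hg]

/-- A tableau whose pattern of labels `f` is the semistandard tableau `T`. -/
def Tableau.IsLabelled (f : α → ℕ) (T : SemistandardYoungTableau lam) (t : Tableau lam α) : Prop :=
  ∀ c, f (t c) = T c.1.1 c.1.2

theorem exists_isLabelled {f : α → ℕ} {T : SemistandardYoungTableau lam}
    (h : content T = wordWeight f) : ∃ t : Tableau lam α, t.IsLabelled f T := by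
  have e : ∀ j, Nonempty ({c : {c : ℕ × ℕ // c ∈ lam.cells} // T c.1.1 c.1.2 = j} ≃
      {a // f a = j}) := by
    intro j
    refine ⟨Fintype.equivOfCardEq ?_⟩
    have h1 := DFunLike.congr_fun h j
    rw [content_apply, wordWeight_apply, letterCount] at h1
    rw [Fintype.card_subtype, Fintype.card_subtype, ← h1]
    refine Finset.card_bij (fun c _ => c.1) ?_ ?_ ?_
    · intro c hc
      exact Finset.mem_filter.2 ⟨c.2, (Finset.mem_filter.1 hc).2⟩
    · intro c _ c' _ h; exact Subtype.ext h
    · intro c hc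
      rw [Finset.mem_filter] at hc
      exact ⟨⟨c, hc.1⟩, by simpa using hc.2, rfl⟩
  exact ⟨Equiv.ofFiberEquiv fun j => (e j).some, fun c => Equiv.ofFiberEquiv_map _ c⟩

/-- A column permutation lowers the key of the tabloid, as the labels increase down each column. -/
theorem Tableau.IsLabelled.blockKey_lt {f : α → ℕ} {T : SemistandardYoungTableau lam}
    {t : Tableau lam α} (ht : t.IsLabelled f T) {π : Equiv.Perm α} (hπ : t.IsColStab π)
    (hne : π ≠ 1) : blockKey f (t.tabloid ∘ π) < blockKey f t.tabloid := by
  -- Look at the moved entries with the largest label: all of them move up in their columns.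
  have hmoved : (univ.filter fun a => π a ≠ a).Nonempty := by
    by_contra h
    rw [Finset.not_nonempty_iff_eq_empty, Finset.filter_eq_empty_iff] at h
    exact hne (Equiv.ext fun a => by simpa using h (mem_univ a))
  obtain ⟨a₀, ha₀, hmax⟩ := Finset.exists_max_image _ f hmoved
  rw [mem_filter_univ] at ha₀
  have hmax' : ∀ a, π a ≠ a → f a ≤ f a₀ := fun a ha => hmax a (by simpa using ha)
  have hup : ∀ a, f a = f a₀ → π a ≠ a → t.tabloid (π a) < t.tabloid a := by
    intro a hfa ha
    have h1 : f (π a) ≤ f a := hfa ▸ hmax' _ fun h => ha (π.injective h)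
    have h2 := ht (t.symm (π a))
    have h3 := ht (t.symm a)
    rw [Equiv.apply_symm_apply] at h2 h3
    have hcol := hπ a
    by_contra hge
    have hge' : (t.symm a).1.1 ≤ (t.symm (π a)).1.1 := not_lt.1 hge
    rcases hge'.lt_or_eq with h | h
    · have := T.col_strict h (j := (t.symm (π a)).1.2)
        ((YoungDiagram.mem_cells _).1 (t.symm (π a)).2)
      rw [← h2, hcol, ← h3] at this
      omega
    · exact ha (t.symm.injective (Subtype.ext (Prod.ext h.symm hcol)))
  have hle : f a₀ ≤ univ.sup f := Finset.le_sup (mem_univ a₀)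
  refine ⟨⟨univ.sup f - f a₀, by omega⟩, fun i hi => ?_, ?_⟩
  · have hi' : i.1 < univ.sup f - f a₀ := hi
    refine Finset.sum_congr rfl fun a ha => ?_
    rw [mem_filter_univ] at ha
    have : π a = a := by
      by_contra h
      have := hmax' a h
      omega
    rw [Function.comp_apply, this]
  · refine Finset.sum_lt_sum (fun a ha => ?_) ⟨a₀, ?_, hup a₀ rfl ha₀⟩
    · rw [mem_filter_univ] at ha
      by_cases h : π a = a
      · rw [Function.comp_apply, h]
      · have ha' : f a + (univ.sup f - f a₀) = univ.sup f := ha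
        exact (hup a (by omega) h).le
    · rw [mem_filter_univ]
      change f a₀ + (univ.sup f - f a₀) = univ.sup f
      omega

theorem Tableau.IsLabelled.eq_of_tabloid_comp {f : α → ℕ} {T T' : SemistandardYoungTableau lam}
    {t t' : Tableau lam α} (ht : t.IsLabelled f T) (ht' : t'.IsLabelled f T') {g : Equiv.Perm α}
    (hg : g ∈ wordStab f) (h : t'.tabloid ∘ g = t.tabloid) : T = T' := by
  have key : ∀ (T : SemistandardYoungTableau lam) (t : Tableau lam α), t.IsLabelled f T → ∀ i v,
      #{c ∈ lam.cells | c.1 = i ∧ T c.1 c.2 ≤ v} = #{a | t.tabloid a = i ∧ f a ≤ v} := by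
    intro T t ht i v
    rw [Finset.card_filter, Finset.card_filter]
    refine sum_cells_eq_sum t _ _ fun c => ?_
    rw [ht c]
    simp [Tableau.tabloid]
  refine SemistandardYoungTableau.ext_of_card fun i v => ?_
  rw [key T t ht, key T' t' ht']
  refine Finset.card_equiv g fun a => ?_
  rw [mem_filter_univ, mem_filter_univ, ← h, ← Function.comp_apply (f := f) (g := g),
    mem_wordStab.1 hg, Function.comp_apply]

open Classical in
/-- The space of vectors of a Specht module that are invariant under a Young subgroup has at least
the dimension given by the Kostka number: the symmetrisations of suitable polytabloids are linearly
independent. -/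
theorem kostka_le_finrank [CharZero k] (lam : YoungDiagram) (f : α → ℕ) :
    kostka lam (wordWeight f) ≤
      finrank k (spechtSemiInvariants k lam (wordStab f).subtype fun _ => 1) := by
  -- The matrix of the values of the vectors `u T` at the tabloids of the `t T` is triangular with
  -- respect to `blockKey`, with nonzero diagonal.
  choose t ht using fun T : {T : SemistandardYoungTableau lam // content T = wordWeight f} =>
    exists_isLabelled T.2
  let u : {T : SemistandardYoungTableau lam // content T = wordWeight f} → (α → ℕ) →₀ k :=
    fun T => ∑ g : wordStab f, rowFunctionRep k α g.1 ((t T).polytabloid k)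
  have hu : ∀ T, u T ∈ spechtSemiInvariants k lam (wordStab f).subtype fun _ => (1 : k) := by
    intro T
    refine ⟨Submodule.sum_mem _ fun g _ => ?_, fun w => ?_⟩
    · rw [rowFunctionRep_polytabloid]
      exact Submodule.subset_span ⟨_, rfl⟩
    · change rowFunctionRep k α w.1 (∑ g : wordStab f, _) = (1 : k) • ∑ g : wordStab f, _
      rw [map_sum, one_smul]
      refine Fintype.sum_equiv (Equiv.mulLeft w) _ _ fun g => ?_
      rw [← Module.End.mul_apply, ← map_mul]
      rfl
  have happly : ∀ T T', u T (t T').tabloid =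
      ∑ g : wordStab f, (t T).polytabloid k ((t T').tabloid ∘ g.1) := by
    intro T T'
    simp only [u]
    rw [Finsupp.finsetSum_apply]
    exact Finset.sum_congr rfl fun g _ => rowFunctionRep_apply _ _ _
  have hterm : ∀ T T' (g : wordStab f), (t T).polytabloid k ((t T').tabloid ∘ g.1) ≠ 0 →
      blockKey f (t T').tabloid < blockKey f (t T).tabloid ∨
        (T = T' ∧ (t T).polytabloid k ((t T').tabloid ∘ g.1) = 1) := by
    intro T T' g hne
    obtain ⟨π, hπ, h⟩ := (t T).exists_of_polytabloid_ne_zero hne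
    rw [← blockKey_comp (t T').tabloid g.2]
    by_cases hπ1 : π = 1
    · right
      subst hπ1
      have h' : (t T').tabloid ∘ ⇑g.1 = (t T).tabloid := h
      exact ⟨Subtype.ext ((ht T).eq_of_tabloid_comp (ht T') g.2 h'), by
        rw [h', Tableau.polytabloid_apply_tabloid]⟩
    · left
      rw [h]
      exact (ht T).blockKey_lt hπ hπ1
  have hdiag : ∀ T, u T (t T).tabloid ≠ 0 := by
    intro T h0
    rw [happly] at h0
    have h1 : ∀ g : wordStab f, (t T).polytabloid k ((t T).tabloid ∘ g.1) =
        if (t T).polytabloid k ((t T).tabloid ∘ g.1) ≠ 0 then 1 else 0 := by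
      intro g
      split_ifs with hne
      · rcases hterm T T g hne with h | h
        · exact absurd h (lt_irrefl _)
        · exact h.2
      · exact not_not.1 hne
    rw [Finset.sum_congr rfl fun g _ => h1 g, Finset.sum_boole] at h0
    have hpos : 0 < #{g : wordStab f | (t T).polytabloid k ((t T).tabloid ∘ g.1) ≠ 0} :=
      Finset.card_pos.2 ⟨1, by
        rw [Finset.mem_filter_univ]
        change (t T).polytabloid k ((t T).tabloid) ≠ 0
        rw [Tableau.polytabloid_apply_tabloid]
        exact one_ne_zero⟩
    exact hpos.ne' ((Nat.cast_eq_zero (R := k)).1 h0)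
  have := Fintype.ofFinite {T : SemistandardYoungTableau lam // content T = wordWeight f}
  have hli : LinearIndependent k fun T => (⟨u T, hu T⟩ :
      spechtSemiInvariants k lam (wordStab f).subtype fun _ => (1 : k)) := by
    rw [Fintype.linearIndependent_iff]
    intro c hc
    have hc' : ∑ T, c T • u T = 0 := by
      have := congrArg Subtype.val hc
      rw [AddSubmonoidClass.coe_finsetSum] at this
      exact this
    by_contra! hne
    obtain ⟨T₁, hT₁⟩ := hne
    obtain ⟨T₀, hT₀, hmax⟩ := Finset.exists_max_image (univ.filter fun T => c T ≠ 0)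
      (fun T => blockKey f (t T).tabloid) ⟨T₁, by simpa using hT₁⟩
    rw [mem_filter_univ] at hT₀
    have h0 := DFunLike.congr_fun hc' (t T₀).tabloid
    rw [Finsupp.finsetSum_apply, Finset.sum_eq_single T₀] at h0
    · exact (mul_ne_zero hT₀ (hdiag T₀)) h0
    · intro T _ hT
      by_contra hne
      have hne' : c T * u T (t T₀).tabloid ≠ 0 := hne
      have hcT := left_ne_zero_of_mul hne'
      have huT := right_ne_zero_of_mul hne'
      rw [happly] at huT
      obtain ⟨g, -, hg⟩ := Finset.exists_ne_zero_of_sum_ne_zero huT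
      rcases hterm T T₀ g hg with h | h
      · exact (hmax T (by simpa using hcT)).not_gt h
      · exact hT h.1
    · intro h; exact absurd (mem_univ _) h
  rw [kostka, Nat.card_eq_fintype_card]
  exact hli.fintype_card_le_finrank

/-- Young's rule. -/
theorem finrank_invariants_eq_kostka [CharZero k] (hlam : lam.card = Fintype.card α) (f : α → ℕ) :
    finrank k (spechtSemiInvariants k lam (wordStab f).subtype fun _ => 1) =
      kostka lam (wordWeight f) := by
  refine le_antisymm ?_ (kostka_le_finrank lam f)
  rw [finrank_spechtSemiInvariants_transpose hlam]
  have := finrank_sign_le_kostka (k := k) lam.transpose f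
  rw [YoungDiagram.transpose_transpose] at this
  exact (congrArg (fun χ => finrank k (spechtSemiInvariants k lam.transpose (wordStab f).subtype χ))
    (funext fun w => mul_one _)).trans_le this

end LowerBound

/-! ### Completeness of the Specht modules -/

section Completeness

open Finset Module Representation

universe v

variable {k : Type*} [Field k] {α : Type} [Fintype α] [DecidableEq α] {lam : YoungDiagram}

/-- The weights with decreasing multiplicities are the partitions. -/
theorem exists_rowWeight_eq {d : ℕ →₀ ℕ} (hd : ∀ i, d (i + 1) ≤ d i) :
    ∃ lam : YoungDiagram, rowWeight lam = d := by
  have hanti : Antitone d := antitone_nat_of_succ_le hd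
  let lam : YoungDiagram :=
    { cells := (d.support.sigma fun i => range (d i)).map (Equiv.sigmaEquivProd ℕ ℕ).toEmbedding
      isLowerSet := by
        rintro ⟨i, j⟩ ⟨i', j'⟩ ⟨hi, hj⟩ h
        simp only [coe_map, Set.mem_image, mem_coe, mem_sigma, Finsupp.mem_support_iff,
          mem_range] at h ⊢
        obtain ⟨⟨a, b⟩, ⟨h1, h2⟩, h3⟩ := h
        cases h3
        have h4 : d a ≤ d i' := hanti hi
        change j' ≤ b at hj
        change b < d a at h2
        exact ⟨⟨i', j'⟩, ⟨by change d i' ≠ 0; omega, by change j' < d i'; omega⟩, rfl⟩ }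
  have hmem : ∀ i j, (i, j) ∈ lam ↔ j < d i := by
    intro i j
    rw [← YoungDiagram.mem_cells]
    simp only [lam, Finset.mem_map, mem_sigma, Finsupp.mem_support_iff, mem_range]
    constructor
    · rintro ⟨⟨a, b⟩, ⟨h1, h2⟩, h3⟩
      cases h3
      exact h2
    · intro h
      exact ⟨⟨i, j⟩, ⟨by change d i ≠ 0; omega, h⟩, rfl⟩
  refine ⟨lam, Finsupp.ext fun i => ?_⟩
  rw [rowWeight_apply]
  refine eq_of_forall_lt_iff fun j => ?_
  rw [← YoungDiagram.mem_iff_lt_rowLen, hmem]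

theorem single_mem_weightSpace {d : ℕ →₀ ℕ} {f : α → ℕ} (hf : wordWeight f = d) (c : k) :
    Finsupp.single f c ∈ weightSpace k α d := Finsupp.single_mem_supported k c hf

theorem letterOp_mem_weightSpace {d d' : ℕ →₀ ℕ} {p q : ℕ}
    (hdd : d + Finsupp.single q 1 = d' + Finsupp.single p 1) {v : (α → ℕ) →₀ k}
    (hv : v ∈ weightSpace k α d) : letterOp univ p q v ∈ weightSpace k α d' := by
  rw [mem_weightSpace] at hv ⊢
  intro f hf
  rw [letterOp_apply] at hf
  obtain ⟨a, ha, h⟩ := Finset.exists_ne_zero_of_sum_ne_zero hf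
  rw [Finset.mem_filter] at ha
  have h1 := hv _ h
  rw [← h1] at hdd
  have h2 : wordWeight (Function.update f a p) + Finsupp.single (f a) 1 =
      wordWeight f + Finsupp.single p 1 := by
    unfold wordWeight
    rw [← Finset.add_sum_erase _ _ (mem_univ a),
      ← Finset.add_sum_erase univ (fun a => Finsupp.single (f a) 1) (mem_univ a),
      Function.update_self, Finset.sum_congr rfl fun b hb => by
        rw [Function.update_of_ne (Finset.ne_of_mem_erase hb)]]
    abel
  rw [ha.2, hdd] at h2
  exact (add_right_cancel h2).symm

theorem exists_weight_letterOp {d : ℕ →₀ ℕ} {v : (α → ℕ) →₀ k} (hv : v ∈ weightSpace k α d)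
    {p q : ℕ} (hne : letterOp univ p q v ≠ 0) : ∃ d' : ℕ →₀ ℕ,
      d + Finsupp.single q 1 = d' + Finsupp.single p 1 ∧
        letterOp univ p q v ∈ weightSpace k α d' := by
  obtain ⟨w, hw⟩ := Finsupp.ne_iff.1 hne
  rw [Finsupp.zero_apply, letterOp_apply] at hw
  obtain ⟨a, ha, h⟩ := Finset.exists_ne_zero_of_sum_ne_zero hw
  have hpos : d p ≠ 0 := by
    rw [← mem_weightSpace.1 hv _ h, wordWeight_apply]
    exact (Finset.card_pos.2 ⟨a, by simp⟩).ne'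
  have hdd : d + Finsupp.single q 1 =
      d - Finsupp.single p 1 + Finsupp.single q 1 + Finsupp.single p 1 := by
    rw [add_right_comm, tsub_add_cancel_of_le (Finsupp.single_le_iff.2 (by omega))]
  exact ⟨_, hdd, letterOp_mem_weightSpace hdd hv⟩

/-- Every nonzero representation of a symmetric group maps nontrivially to a Specht module: take a
nonzero map to a weight space of words with the sum of the letters as small as possible. -/
theorem exists_hom_specht [CharZero k] (H : Type v) [AddCommGroup H] [Module k H] [Nontrivial H]
    (ρ : Representation k (Equiv.Perm α) H) : ∃ lam : YoungDiagram, lam.card = Fintype.card α ∧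
      ∃ φ : IntertwiningMap ρ (spechtRep k lam α), φ ≠ 0 := by
  classical
  let P : ℕ → Prop := fun s => ∃ d : ℕ →₀ ℕ, letterSum d = s ∧ ∃ φ : IntertwiningMap ρ
    (rowFunctionRep k α), φ ≠ 0 ∧ ∀ x, φ x ∈ weightSpace k α d
  have hP : ∃ s, P s := by
    -- A linear form `l` on `H` gives a map to the words with distinct letters, which span a copy of
    -- the regular representation: the coefficient of `ι ∘ g⁻¹` in the image of `x` is `l (g⁻¹ x)`.
    let ι : α → ℕ := fun a => (Fintype.equivFin α a : ℕ)
    have hι : Function.Injective ι := Fin.val_injective.comp (Fintype.equivFin α).injective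
    obtain ⟨h₀, hh₀⟩ := exists_ne (0 : H)
    obtain ⟨l, hl⟩ := Projective.exists_dual_ne_zero k hh₀
    let φ : H →ₗ[k] ((α → ℕ) →₀ k) :=
      ∑ g : Equiv.Perm α, (l ∘ₗ ρ g⁻¹).smulRight (Finsupp.single (ι ∘ ⇑g⁻¹) 1)
    have hφ : ∀ x, φ x = ∑ g : Equiv.Perm α, Finsupp.single (ι ∘ ⇑g⁻¹) (l (ρ g⁻¹ x)) := fun x => by
      simp [φ]
    refine ⟨_, wordWeight ι, rfl, ⟨φ, fun a => LinearMap.ext fun x => ?_⟩, fun h0 => hl ?_,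
      fun x => ?_⟩
    · change φ (ρ a x) = rowFunctionRep k α a (φ x)
      rw [hφ, hφ, map_sum]
      refine Fintype.sum_equiv (Equiv.mulLeft a⁻¹) _ _ fun g => ?_
      rw [rowFunctionRep_single, Equiv.coe_mulLeft, ← Module.End.mul_apply, ← map_mul, mul_inv_rev,
        inv_inv, Function.comp_assoc, ← Equiv.Perm.coe_mul, mul_inv_cancel_right]
    · have h1 : φ h₀ ι = 0 := DFunLike.congr_fun (DFunLike.congr_fun h0 h₀) ι
      rw [hφ, Finsupp.finsetSum_apply, Finset.sum_eq_single 1] at h1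
      · simpa using h1
      · intro g _ hg
        refine Finsupp.single_eq_of_ne fun h => hg ?_
        rw [← inv_inj, inv_one]
        exact Equiv.ext fun a => hι (congrFun h a).symm
      · intro h; exact absurd (mem_univ _) h
    · change φ x ∈ _
      rw [hφ]
      refine Submodule.sum_mem _ fun g _ => ?_
      exact single_mem_weightSpace (wordWeight_comp ι g⁻¹) _
  obtain ⟨d, hd, φ, hφ, hφd⟩ := Nat.find_spec hP
  have hkill : ∀ i x, letterOp univ (i + 1) i (φ x) = 0 := by
    intro i
    by_contra! hne
    obtain ⟨x, hx⟩ := hne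
    obtain ⟨d', hdd, -⟩ := exists_weight_letterOp (hφd x) hx
    refine Nat.find_min hP (m := letterSum d') ?_
      ⟨d', rfl, ⟨letterOp univ (i + 1) i ∘ₗ φ.toLinearMap, fun g => ?_⟩, ?_, fun y => ?_⟩
    · rw [← hd]
      have := congrArg letterSum hdd
      rw [map_add, map_add, letterSum_single, letterSum_single] at this
      omega
    · ext1 y
      change letterOp univ (i + 1) i (φ (ρ g y)) =
        rowFunctionRep k α g (letterOp univ (i + 1) i (φ y))
      rw [φ.isIntertwining, letterOp_rowFunctionRep]
    · intro h0
      exact hx (DFunLike.congr_fun h0 x)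
    · exact letterOp_mem_weightSpace hdd (hφd y)
  obtain ⟨x, hx⟩ : ∃ x, φ x ≠ 0 := by
    by_contra! h
    exact hφ (IntertwiningMap.ext (LinearMap.ext h))
  have hmono : ∀ i, d (i + 1) ≤ d i := by
    intro i
    by_contra hlt
    refine hx (eq_zero_of_letterOp_eq_zero (P := univ) (p := i + 1) (q := i) (Nat.succ_ne_self i)
      (s := d (i + 1) - d i) (by omega) (fun f hf => ?_) (hkill i x))
    rw [← wordWeight_apply, ← wordWeight_apply, mem_weightSpace.1 (hφd x) f hf]
    omega
  obtain ⟨lam, rfl⟩ := exists_rowWeight_eq hmono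
  have hmem : ∀ y, φ y ∈ spechtModule k lam α := fun y => by
    rw [← hwSpace_eq_spechtModule, mem_hwSpace]
    exact ⟨hφd y, fun i => hkill i y⟩
  refine ⟨lam, ?_, ⟨φ.toLinearMap.codRestrict _ hmem, fun g => ?_⟩, fun h0 => hx ?_⟩
  · obtain ⟨w, hw⟩ := Finsupp.ne_iff.1 hx
    rw [← degree_rowWeight, ← mem_weightSpace.1 (hφd x) w hw, degree_wordWeight]
  · ext1 y
    exact Subtype.ext (φ.isIntertwining _ _ g y)
  · exact congrArg Subtype.val (DFunLike.congr_fun h0 x)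

/-- The partitions of a number form a finite type. -/
instance finite_card_eq (r : ℕ) : Finite {lam : YoungDiagram // lam.card = r} := by
  refine Finite.of_injective (β := (range r ×ˢ range r).powerset) (fun lam => ⟨lam.1.cells, ?_⟩) ?_
  · obtain ⟨lam, rfl⟩ := lam
    rw [Finset.mem_powerset]
    rintro ⟨i, j⟩ hc
    have h1 : (range (i + 1)).map ⟨fun i' => (i', j), Prod.mk_left_injective j⟩ ⊆ lam.cells := by
      intro c hc'
      obtain ⟨i', hi', rfl⟩ := Finset.mem_map.1 hc'
      exact lam.up_left_mem (Nat.lt_succ_iff.1 (mem_range.1 hi')) le_rfl hc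
    have h2 : (range (j + 1)).map ⟨fun j' => (i, j'), Prod.mk_right_injective i⟩ ⊆ lam.cells := by
      intro c hc'
      obtain ⟨j', hj', rfl⟩ := Finset.mem_map.1 hc'
      exact lam.up_left_mem le_rfl (Nat.lt_succ_iff.1 (mem_range.1 hj')) hc
    have h3 := Finset.card_le_card h1
    have h4 := Finset.card_le_card h2
    rw [Finset.card_map, Finset.card_range] at h3 h4
    rw [Finset.mem_product, mem_range, mem_range]
    exact ⟨h3, h4⟩
  · intro lam mu h
    exact Subtype.ext (YoungDiagram.ext (congrArg Subtype.val h))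

instance fintype_card_eq (r : ℕ) : Fintype {lam : YoungDiagram // lam.card = r} :=
  Fintype.ofFinite _

variable (k α) in
/-- The Young permutation module: the symmetric group acts on the words of weight `d`. -/
def weightRep (d : ℕ →₀ ℕ) : Representation k (Equiv.Perm α) (weightSpace k α d) where
  toFun g := (rowFunctionRep k α g).restrict fun _ hv => rowFunctionRep_mem_weightSpace g hv
  map_one' := by ext x : 2; simp
  map_mul' g h := by ext x : 2; simp

instance finiteDimensional_weightSpace (d : ℕ →₀ ℕ) :
    FiniteDimensional k (weightSpace k α d) := by
  have : Finite {f : α → ℕ | wordWeight f = d} := finite_wordWeight d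
  exact Module.Finite.equiv (Finsupp.supportedEquivFinsupp {f : α → ℕ | wordWeight f = d}).symm

theorem exists_comp_eq_of_wordWeight_eq {f w : α → ℕ} (h : wordWeight w = wordWeight f) :
    ∃ g : Equiv.Perm α, f ∘ g = w := by
  have e : ∀ j, Nonempty ({a // w a = j} ≃ {a // f a = j}) := by
    intro j
    refine ⟨Fintype.equivOfCardEq ?_⟩
    have h1 := DFunLike.congr_fun h j
    rw [wordWeight_apply, wordWeight_apply] at h1
    rw [Fintype.card_subtype, Fintype.card_subtype]
    exact h1
  exact ⟨Equiv.ofFiberEquiv fun j => (e j).some, funext fun a => Equiv.ofFiberEquiv_map _ a⟩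

/-- Frobenius reciprocity for the Young permutation module, which is induced from the stabiliser of
a word. -/
theorem finrank_hom_weightRep [CharZero k] (f : α → ℕ) (lam : YoungDiagram) :
    finrank k (IntertwiningMap (weightRep k α (wordWeight f)) (spechtRep k lam α)) =
      finrank k (spechtSemiInvariants k lam (wordStab f).subtype fun _ => 1) := by
  classical
  rw [← finrank_semiInvariants_spechtRep]
  have hmem : ∀ g : Equiv.Perm α, Finsupp.single (f ∘ g) (1 : k) ∈ weightSpace k α (wordWeight f) :=
    fun g => single_mem_weightSpace (wordWeight_comp f g) 1
  have htrans : ∀ g : Equiv.Perm α, (⟨_, hmem g⟩ : weightSpace k α (wordWeight f)) =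
      weightRep k α (wordWeight f) g⁻¹ ⟨_, hmem 1⟩ := fun g => Subtype.ext (by
    change _ = rowFunctionRep k α g⁻¹ (Finsupp.single (f ∘ ⇑(1 : Equiv.Perm α)) 1)
    rw [rowFunctionRep_single, inv_inv]
    rfl)
  let ev : IntertwiningMap (weightRep k α (wordWeight f)) (spechtRep k lam α) →ₗ[k]
      semiInvariants (wordStab f).subtype (fun _ => (1 : k)) (spechtRep k lam α) :=
    { toFun := fun ψ => ⟨ψ ⟨_, hmem 1⟩, fun g => by
        rw [one_smul, ← ψ.isIntertwining]
        congr 1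
        have h := htrans g.1⁻¹
        rw [inv_inv] at h
        refine h.symm.trans (Subtype.ext ?_)
        change Finsupp.single (f ∘ ⇑g.1⁻¹) (1 : k) = Finsupp.single f 1
        rw [mem_wordStab.1 ((wordStab f).inv_mem g.2)]⟩
      map_add' := fun _ _ => rfl
      map_smul' := fun _ _ => rfl }
  refine LinearEquiv.finrank_eq (LinearEquiv.ofBijective ev ⟨fun ψ ψ' h => ?_, fun x => ?_⟩)
  · have h' : ψ ⟨_, hmem 1⟩ = ψ' ⟨_, hmem 1⟩ := congrArg Subtype.val h
    refine IntertwiningMap.ext (LinearMap.ext fun v => ?_)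
    change ψ v = ψ' v
    have hv : v = ∑ w ∈ (v : (α → ℕ) →₀ k).support.attach, (v : (α → ℕ) →₀ k) w.1 •
        (⟨Finsupp.single w.1 1, single_mem_weightSpace (mem_weightSpace.1 v.2 w.1
          (Finsupp.mem_support_iff.1 w.2)) 1⟩ : weightSpace k α (wordWeight f)) := by
      refine Subtype.ext ?_
      rw [AddSubmonoidClass.coe_finsetSum]
      simp only [SetLike.mk_smul_mk, Finsupp.smul_single, smul_eq_mul, mul_one]
      rw [Finset.sum_attach _ fun w => Finsupp.single w ((v : (α → ℕ) →₀ k) w)]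
      exact (Finsupp.sum_single _).symm
    rw [hv, map_sum, map_sum]
    refine Finset.sum_congr rfl fun w _ => ?_
    obtain ⟨g, hg⟩ := exists_comp_eq_of_wordWeight_eq (mem_weightSpace.1 v.2 w.1
          (Finsupp.mem_support_iff.1 w.2))
    rw [map_smul, map_smul]
    congr 1
    have h1 : (⟨Finsupp.single w.1 1, single_mem_weightSpace (mem_weightSpace.1 v.2 w.1
          (Finsupp.mem_support_iff.1 w.2)) 1⟩ : weightSpace k α (wordWeight f)) = ⟨_, hmem g⟩ :=
      Subtype.ext (by change Finsupp.single w.1 1 = Finsupp.single (f ∘ g) 1; rw [hg])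
    rw [h1, htrans, ψ.isIntertwining, ψ'.isIntertwining, h']
  · let c : k := Fintype.card (wordStab f)
    have hc : c ≠ 0 := Nat.cast_ne_zero.2 Fintype.card_ne_zero
    let L : ((α → ℕ) →₀ k) →ₗ[k] spechtModule k lam α := c⁻¹ • ∑ g : Equiv.Perm α,
      (Finsupp.lapply (f ∘ ⇑g⁻¹)).smulRight (spechtRep k lam α g x.1)
    have hL : ∀ v, L v = c⁻¹ • ∑ g : Equiv.Perm α, v (f ∘ ⇑g⁻¹) • spechtRep k lam α g x.1 :=
      fun v => by simp [L]
    refine ⟨⟨L ∘ₗ (weightSpace k α (wordWeight f)).subtype, fun a => LinearMap.ext fun v => ?_⟩,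
      Subtype.ext ?_⟩
    · change L (rowFunctionRep k α a v.1) = spechtRep k lam α a (L v.1)
      rw [hL, hL, map_smul, map_sum]
      congr 1
      refine Fintype.sum_equiv (Equiv.mulLeft a⁻¹) _ _ fun g => ?_
      rw [Equiv.coe_mulLeft, map_smul, ← Module.End.mul_apply, ← map_mul, mul_inv_cancel_left,
        rowFunctionRep_apply]
      congr 2
    · change L (Finsupp.single f 1) = x.1
      have h1 : ∀ g : Equiv.Perm α, (Finsupp.single f (1 : k)) (f ∘ ⇑g⁻¹) •
          spechtRep k lam α g x.1 = if g ∈ wordStab f then x.1 else 0 := by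
        intro g
        rw [Finsupp.single_apply]
        split_ifs with h2 h3 h3
        · rw [one_smul]
          exact (x.2 ⟨g, h3⟩).trans (one_smul _ _)
        · exact absurd (inv_inv g ▸ (wordStab f).inv_mem (mem_wordStab.2 h2.symm)) h3
        · exact absurd (mem_wordStab.1 ((wordStab f).inv_mem h3)).symm h2
        · rw [zero_smul]
      rw [hL, Finset.sum_congr rfl fun g _ => h1 g, ← Finset.sum_filter, Finset.sum_const,
        ← Nat.cast_smul_eq_nsmul k, smul_smul]
      rw [show ((#{g | g ∈ wordStab f} : ℕ) : k) = c by
        simp only [c]; rw [Fintype.card_subtype], inv_mul_cancel₀ hc, one_smul]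

/-- The multiplicities of a linear character of a group `W` in the Young permutation module of
weight `d` and in the Specht modules are related by the Kostka numbers. -/
theorem finrank_weightSpace_semiInvariants [CharZero k] {W : Type} [Group W]
    (φ : W →* Equiv.Perm α) (χ : W →* k) (d : ℕ →₀ ℕ) :
    finrank k (weightSpace k α d ⊓ semiInvariants φ χ (rowFunctionRep k α) :
      Submodule k ((α → ℕ) →₀ k)) =
      ∑ lam : {lam : YoungDiagram // lam.card = Fintype.card α},
        kostka lam d * finrank k (spechtSemiInvariants k lam.1 φ χ) := by
  classical
  by_cases hd : ∃ f : α → ℕ, wordWeight f = d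
  · obtain ⟨f, rfl⟩ := hd
    let ξ : Representation k W k :=
      { toFun := fun w => χ w • LinearMap.id
        map_one' := by simp; rfl
        map_mul' := fun a b => by ext; simp [mul_comm] }
    have hind : ∀ {V : Type _} [AddCommGroup V] [Module k V] [FiniteDimensional k V]
        (ρ : Representation k (Equiv.Perm α) V),
        finrank k (IntertwiningMap (ind φ ξ) ρ) = finrank k (semiInvariants φ χ ρ) := fun ρ =>
      finrank_hom_ind φ ξ χ 1 (fun w => rfl) one_ne_zero (fun x => ⟨x, by simp⟩) ρ
    have h := finrank_hom_eq_sum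
      (fun lam : {lam : YoungDiagram // lam.card = Fintype.card α} => spechtRep k lam.1 α)
      (fun lam mu => by
        rw [finrank_hom_specht lam.2 mu.2]
        simp only [Subtype.ext_iff])
      (fun H _ _ _ _ ρ => by
        obtain ⟨lam, hlam, φ, hφ⟩ := exists_hom_specht H ρ
        exact ⟨⟨lam, hlam⟩, φ, hφ⟩)
      (weightRep k α (wordWeight f)) (ind φ ξ)
    rw [finrank_hom_comm, hind] at h
    refine Eq.trans ?_ (h.trans (Finset.sum_congr rfl fun lam _ => ?_))
    · refine LinearEquiv.finrank_eq
        { toFun := fun v => ⟨⟨v.1, v.2.1⟩, fun w => Subtype.ext (v.2.2 w)⟩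
          invFun := fun v => ⟨v.1.1, v.1.2, fun w => congrArg Subtype.val (v.2 w)⟩
          map_add' := fun _ _ => rfl
          map_smul' := fun _ _ => rfl
          left_inv := fun _ => rfl
          right_inv := fun _ => rfl }
    · rw [finrank_hom_weightRep, finrank_invariants_eq_kostka lam.2, hind,
        finrank_semiInvariants_spechtRep]
  · have hbot : weightSpace k α d = ⊥ := by
      rw [eq_bot_iff]
      intro v hv
      by_contra hne
      obtain ⟨f, hf⟩ := Finsupp.ne_iff.1 hne
      exact hd ⟨f, mem_weightSpace.1 hv f hf⟩
    rw [hbot, bot_inf_eq, finrank_bot]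
    refine (Finset.sum_eq_zero fun lam _ => ?_).symm
    rw [mul_eq_zero]
    left
    by_contra hk
    obtain ⟨⟨T, hT⟩⟩ := (Nat.card_ne_zero.1 hk).1
    obtain ⟨t⟩ := exists_tableau lam.2
    refine hd ⟨fun a => T (t.symm a).1.1 (t.symm a).1.2, ?_⟩
    rw [← hT, content, wordWeight]
    exact (sum_cells_eq_sum t (fun c => Finsupp.single (T c.1 c.2) 1) _ fun c => by simp).symm

end Completeness

/-! ### The symmetric algebra of an exterior power -/

section SymmetricAlgebra

open Finset Module Representation

variable {k : Type*} [Field k] {m n : ℕ}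

/-- The wedge product of the letters of a word of length `m`, as an element of the symmetric algebra
of the `m`-th exterior power of the span of the letters. That algebra is the part of the polynomial
ring with variables `X_S` in which all `S` have `m` elements; `X_S` is the wedge product of the
elements of `S` in increasing order. -/
def wedge (k : Type*) [Field k] (g : Fin m → ℕ) : MvPolynomial (Finset ℕ) k :=
  open Classical in
  if Function.Injective g then
    permSign k (Tuple.sort g) • MvPolynomial.X (univ.image g)
  else 0

theorem wedge_of_injective {g : Fin m → ℕ} (hg : Function.Injective g) :
    wedge k g = permSign k (Tuple.sort g) • MvPolynomial.X (univ.image g) := if_pos hg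

theorem wedge_of_not_injective {g : Fin m → ℕ} (hg : ¬ Function.Injective g) :
    wedge k g = 0 := if_neg hg

theorem permSign_inv {α : Type} [Fintype α] [DecidableEq α] (σ : Equiv.Perm α) :
    permSign k σ⁻¹ = permSign k σ := by
  simp [permSign]

theorem wedge_comp (g : Fin m → ℕ) (σ : Equiv.Perm (Fin m)) :
    wedge k (g ∘ σ) = permSign k σ • wedge k g := by
  by_cases hg : Function.Injective g
  · have hg' : Function.Injective (g ∘ σ) := hg.comp σ.injective
    rw [wedge_of_injective hg, wedge_of_injective hg', smul_smul]
    have h1 : σ * Tuple.sort (g ∘ σ) = Tuple.sort g := by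
      ext1 a
      exact hg (congrFun (Tuple.comp_perm_comp_sort_eq_comp_sort (f := g) (σ := σ)) a)
    have h2 : univ.image (g ∘ σ) = univ.image g := by
      rw [← Finset.image_image, Finset.image_univ_equiv]
    rw [← h1, h2, permSign_mul, ← mul_assoc, permSign_mul_self, one_mul]
  · have hg' : ¬ Function.Injective (g ∘ σ) := fun h => hg ((σ.injective_comp g).1 h)
    rw [wedge_of_not_injective hg, wedge_of_not_injective hg', smul_zero]

variable (k) in
/-- The derivation of the symmetric algebra that is induced by changing the letter `i + 1` to `i`:
the image of `X_S` is `X_{S'}`, where `S'` is obtained from `S` by replacing `i + 1` by `i`, if this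
is possible without a repetition, and `0` otherwise. -/
def raise (i : ℕ) : Derivation k (MvPolynomial (Finset ℕ) k) (MvPolynomial (Finset ℕ) k) :=
  MvPolynomial.mkDerivation k fun S =>
    if i + 1 ∈ S ∧ i ∉ S then MvPolynomial.X (insert i (S.erase (i + 1))) else 0

/-- Here the letters of a wedge product keep their order when `i + 1` is replaced by an absent `i`,
so no sign appears. -/
theorem raise_wedge [CharZero k] (i : ℕ) (g : Fin m → ℕ) :
    raise k i (wedge k g) = ∑ l with g l = i + 1, wedge k (Function.update g l i) := by
  by_cases hg : Function.Injective g
  · rw [wedge_of_injective hg, Derivation.map_smul, raise, MvPolynomial.mkDerivation_X]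
    by_cases h1 : ∃ l, g l = i + 1
    · obtain ⟨l, hl⟩ := h1
      have hfil : univ.filter (fun l => g l = i + 1) = {l} := by
        ext l'
        rw [mem_filter_univ, mem_singleton, ← hl, hg.eq_iff]
      rw [hfil, sum_singleton]
      have hmem : i + 1 ∈ univ.image g := mem_image.2 ⟨l, mem_univ _, hl⟩
      by_cases h2 : i ∈ univ.image g
      · obtain ⟨l', -, hl'⟩ := mem_image.1 h2
        rw [if_neg fun h => h.2 h2, smul_zero, wedge_of_not_injective]
        intro h
        have hne : l' ≠ l := by rintro rfl; omega
        exact hne (h (by rw [Function.update_self, Function.update_of_ne hne, hl']))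
      · rw [if_pos ⟨hmem, h2⟩]
        have hi : ∀ a, g a ≠ i := fun a h => h2 (mem_image.2 ⟨a, mem_univ _, h⟩)
        have hval : ∀ a, Function.update g l i a = if g a = i + 1 then i else g a := by
          intro a
          rw [Function.update_apply]
          refine if_congr ?_ rfl rfl
          rw [← hl, hg.eq_iff]
        have hinj : Function.Injective (Function.update g l i) := by
          intro a b hab
          rw [hval, hval] at hab
          apply hg
          have ha := hi a
          have hb := hi b
          split_ifs at hab <;> omega
        rw [wedge_of_injective hinj]
        have himage : univ.image (Function.update g l i) =
            insert i ((univ.image g).erase (i + 1)) := by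
          ext p
          simp only [mem_image, mem_univ, true_and, mem_insert, mem_erase, hval]
          constructor
          · rintro ⟨a, rfl⟩
            split_ifs with h
            · exact Or.inl rfl
            · exact Or.inr ⟨h, a, rfl⟩
          · rintro (rfl | ⟨h, a, rfl⟩)
            · exact ⟨l, if_pos hl⟩
            · exact ⟨a, if_neg h⟩
        have hsort : Tuple.sort g = Tuple.sort (Function.update g l i) := by
          rw [Tuple.eq_sort_iff]
          refine ⟨fun a b hab => ?_, fun a b hab h => ?_⟩
          · have h3 := Tuple.monotone_sort g hab
            rw [Function.comp_apply, Function.comp_apply, hval, hval] at *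
            have ha := hi (Tuple.sort g a)
            have hb := hi (Tuple.sort g b)
            split_ifs <;> omega
          · exact absurd ((Tuple.sort g).injective (hinj h)) hab.ne
        rw [himage, hsort]
    · rw [if_neg, smul_zero, Finset.filter_eq_empty_iff.2 fun l _ h => h1 ⟨l, h⟩, sum_empty]
      rintro ⟨h, -⟩
      obtain ⟨l, -, hl⟩ := mem_image.1 h
      exact h1 ⟨l, hl⟩
  · rw [wedge_of_not_injective hg, map_zero]
    -- Two equal letters: exchanging their positions changes the sign of the terms.
    obtain ⟨a, b, hab, hne⟩ : ∃ a b, g a = g b ∧ a ≠ b := by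
      simpa [Function.Injective] using hg
    have hswap : ∀ l, g (Equiv.swap a b l) = g l := Equiv.apply_swap_eq_self hab
    have hneg : ∀ l, wedge k (Function.update g (Equiv.swap a b l) i) =
        - wedge k (Function.update g l i) := by
      intro l
      have h : Function.update g (Equiv.swap a b l) i =
          Function.update g l i ∘ Equiv.swap a b := by
        ext c
        rw [Function.comp_apply, Function.update_apply, Function.update_apply, hswap]
        refine if_congr ?_ rfl rfl
        rw [← (Equiv.swap a b).injective.eq_iff, Equiv.swap_apply_self]
      rw [h, wedge_comp, permSign, Equiv.Perm.sign_swap hne]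
      simp
    symm
    refine Finset.sum_involution (fun l _ => Equiv.swap a b l) (fun l _ => ?_) (fun l _ h0 h => ?_)
      (fun l hl => ?_) fun l _ => Equiv.swap_apply_self a b l
    · rw [hneg, add_neg_cancel]
    · apply h0
      have := hneg l
      rw [h] at this
      have h2 : (2 : k) • wedge k (Function.update g l i) = 0 := by
        rw [two_smul]
        nth_rewrite 1 [this]
        exact neg_add_cancel _
      exact (smul_eq_zero.1 h2).resolve_left two_ne_zero
    · rw [mem_filter_univ] at hl ⊢
      rw [hswap, hl]

theorem derivation_prod {A ι : Type*} [CommRing A] [Algebra k A] [DecidableEq ι]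
    (D : Derivation k A A) (s : Finset ι) (a : ι → A) :
    D (∏ j ∈ s, a j) = ∑ j ∈ s, (∏ j' ∈ s.erase j, a j') * D (a j) := by
  induction s using Finset.induction_on with
  | empty => simp
  | insert i s hi ih =>
    rw [Finset.prod_insert hi, Derivation.leibniz, ih, Finset.sum_insert hi, Finset.erase_insert hi,
      smul_eq_mul, smul_eq_mul, add_comm, Finset.mul_sum]
    congr 1
    refine Finset.sum_congr rfl fun j hj => ?_
    have hne : i ≠ j := fun h => hi (h ▸ hj)
    rw [Finset.erase_insert_of_ne hne, Finset.prod_insert fun h => hi (Finset.mem_of_mem_erase h),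
      mul_assoc]

variable (k m n) in
/-- The map from words on `n` blocks of `m` positions to the symmetric algebra of the `m`-th
exterior power. -/
def toSymmetricAlgebra : ((Fin n × Fin m → ℕ) →₀ k) →ₗ[k] MvPolynomial (Finset ℕ) k :=
  Finsupp.linearCombination k fun f => ∏ j, wedge k fun i => f (j, i)

theorem toSymmetricAlgebra_single (f : Fin n × Fin m → ℕ) (c : k) :
    toSymmetricAlgebra k m n (Finsupp.single f c) = c • ∏ j, wedge k fun i => f (j, i) := by
  rw [toSymmetricAlgebra, Finsupp.linearCombination_single]

/-- The raising operators on words correspond to the derivations `raise` of the symmetric algebra. -/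
theorem toSymmetricAlgebra_letterOp [CharZero k] (i : ℕ) (v : (Fin n × Fin m → ℕ) →₀ k) :
    toSymmetricAlgebra k m n (letterOp univ (i + 1) i v) =
      raise k i (toSymmetricAlgebra k m n v) := by
  induction v using Finsupp.induction_linear with
  | zero => simp
  | add v w hv hw => rw [map_add, map_add, hv, hw, map_add, map_add]
  | single f c =>
    rw [letterOp_single, map_sum, toSymmetricAlgebra_single, Derivation.map_smul,
      derivation_prod, Finset.sum_filter, Fintype.sum_prod_type, Finset.smul_sum]
    refine Finset.sum_congr rfl fun j _ => ?_
    rw [raise_wedge, Finset.mul_sum, Finset.smul_sum, ← Finset.sum_filter]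
    refine Finset.sum_congr rfl fun l _ => ?_
    rw [toSymmetricAlgebra_single, ← Finset.prod_erase_mul _ _ (mem_univ j)]
    congr 2
    · refine Finset.prod_congr rfl fun j' hj' => ?_
      congr 1
      ext l'
      exact Function.update_of_ne (fun h => Finset.ne_of_mem_erase hj' (congrArg Prod.fst h)) _ _
    · congr 1
      ext l'
      rw [Function.update_apply, Function.update_apply]
      exact if_congr (by simp) rfl rfl

variable (k m n) in
/-- The linear character of the wreath product by which it acts on the wedge products. -/
def wreathSign : Wreath m n →* k where
  toFun w := ∏ j, permSign k (w.left j)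
  map_one' := by simp [permSign]
  map_mul' v w := by
    simp only [SemidirectProduct.mul_left, Pi.mul_apply, permSign_mul, Finset.prod_mul_distrib]
    congr 1
    exact Fintype.prod_equiv v.right⁻¹ _ _ fun j => rfl

theorem toSymmetricAlgebra_rowFunctionRep (w : Wreath m n) (v : (Fin n × Fin m → ℕ) →₀ k) :
    toSymmetricAlgebra k m n (rowFunctionRep k _ (wreathHom m n w) v) =
      wreathSign k m n w • toSymmetricAlgebra k m n v := by
  induction v using Finsupp.induction_linear with
  | zero => simp
  | add v w hv hw => rw [map_add, map_add, hv, hw, map_add, smul_add]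
  | single f c =>
    rw [rowFunctionRep_single, toSymmetricAlgebra_single, toSymmetricAlgebra_single, smul_comm]
    congr 1
    have h : ∀ j, wedge k (fun i => (f ∘ ⇑(wreathHom m n w)⁻¹) (j, i)) =
        permSign k (w.left j) • wedge k fun i => f (w.right⁻¹ j, i) := by
      intro j
      rw [← permSign_inv, ← wedge_comp]
      rfl
    rw [Finset.prod_congr rfl fun j _ => h j, Finset.prod_smul]
    congr 1
    exact Fintype.prod_equiv w.right⁻¹ _ _ fun j => rfl

end SymmetricAlgebra

/-! ### Multiplication by a highest weight vector -/

section HighestWeight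

open Finset Module Representation

variable {k : Type*} [Field k] {m n : ℕ}

/-- The weight of the product of the letters in a set. -/
def setWeight (S : Finset ℕ) : ℕ →₀ ℕ := ∑ p ∈ S, Finsupp.single p 1

/-- The exponents of the monomials of degree `n` and weight `d` in the symmetric algebra of the
`m`-th exterior power. -/
def wedgeExponents (m n : ℕ) (d : ℕ →₀ ℕ) : Set (Finset ℕ →₀ ℕ) :=
  {e | (∀ S ∈ e.support, #S = m) ∧ e.degree = n ∧ Finsupp.weight setWeight e = d}

/-- The exponent of the image of a word in the symmetric algebra of the exterior power. -/
def blockExponent (f : Fin n × Fin m → ℕ) : Finset ℕ →₀ ℕ :=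
  ∑ j, Finsupp.single (univ.image fun i => f (j, i)) 1

theorem toSymmetricAlgebra_single_of_injective {f : Fin n × Fin m → ℕ}
    (hf : ∀ j, Function.Injective fun i => f (j, i)) : ∃ ε : k, ε * ε = 1 ∧
      toSymmetricAlgebra k m n (Finsupp.single f 1) =
        ε • MvPolynomial.monomial (blockExponent f) 1 := by
  refine ⟨∏ j, permSign k (Tuple.sort fun i => f (j, i)), ?_, ?_⟩
  · rw [← Finset.prod_mul_distrib]
    exact Finset.prod_eq_one fun j _ => permSign_mul_self _
  · rw [toSymmetricAlgebra_single, one_smul,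
      Finset.prod_congr rfl fun j _ => wedge_of_injective (hf j), Finset.prod_smul, blockExponent,
      MvPolynomial.monomial_sum_one]
    rfl

theorem toSymmetricAlgebra_single_of_not_injective {f : Fin n × Fin m → ℕ}
    (hf : ¬ ∀ j, Function.Injective fun i => f (j, i)) :
      toSymmetricAlgebra k m n (Finsupp.single f 1) = 0 := by
  obtain ⟨j, hj⟩ := not_forall.1 hf
  rw [toSymmetricAlgebra_single, Finset.prod_eq_zero (mem_univ j) (wedge_of_not_injective hj),
    smul_zero]

theorem blockExponent_mem {f : Fin n × Fin m → ℕ}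
    (hf : ∀ j, Function.Injective fun i => f (j, i)) :
    blockExponent f ∈ wedgeExponents m n (wordWeight f) := by
  refine ⟨fun S hS => ?_, ?_, ?_⟩
  · rw [Finsupp.mem_support_iff, blockExponent, Finsupp.finsetSum_apply] at hS
    obtain ⟨j, -, hj⟩ := Finset.exists_ne_zero_of_sum_ne_zero hS
    rw [Finsupp.single_apply_ne_zero] at hj
    rw [hj.1, Finset.card_image_of_injective _ (hf j), Finset.card_univ, Fintype.card_fin]
  · simp [blockExponent, map_sum]
  · simp only [blockExponent, map_sum, Finsupp.weight_single, one_smul, wordWeight, setWeight]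
    rw [Fintype.sum_prod_type]
    exact Finset.sum_congr rfl fun j _ => Finset.sum_image fun a _ b _ h => hf j h

theorem exists_sum_single_eq {β : Type*} {n : ℕ} {e : β →₀ ℕ} (he : e.degree = n) :
    ∃ s : Fin n → β, ∑ j, Finsupp.single (s j) 1 = e := by
  induction n generalizing e with
  | zero => exact ⟨Fin.elim0, by rw [Finsupp.degree_eq_zero_iff] at he; simp [he]⟩
  | succ n ih =>
    obtain ⟨b, hb⟩ : ∃ b, e b ≠ 0 := by
      by_contra! h
      rw [show e = 0 from Finsupp.ext h] at he
      simp at he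
    have h2 : Finsupp.single b 1 + (e - Finsupp.single b 1) = e :=
      add_tsub_cancel_of_le (Finsupp.single_le_iff.2 (Nat.one_le_iff_ne_zero.2 hb))
    obtain ⟨s, hs⟩ := ih (e := e - Finsupp.single b 1) (by
      have := congrArg Finsupp.degree h2
      rw [map_add, he, Finsupp.degree_single] at this
      omega)
    refine ⟨Fin.cons b s, ?_⟩
    rw [Fin.sum_univ_succ]
    simpa [hs] using h2

theorem exists_blockExponent_eq {d : ℕ →₀ ℕ} {e : Finset ℕ →₀ ℕ} (he : e ∈ wedgeExponents m n d) :
    ∃ f : Fin n × Fin m → ℕ, (∀ j, Function.Injective fun i => f (j, i)) ∧ blockExponent f = e ∧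
      wordWeight f = d := by
  obtain ⟨s, hs⟩ := exists_sum_single_eq he.2.1
  have hcard : ∀ j, #(s j) = m := by
    intro j
    refine he.1 _ ?_
    rw [← hs, Finsupp.mem_support_iff, Finsupp.finsetSum_apply]
    have : Finsupp.single (s j) 1 (s j) ≤ ∑ j', Finsupp.single (s j') 1 (s j) :=
      Finset.single_le_sum (f := fun j' => Finsupp.single (s j') 1 (s j)) (fun _ _ => Nat.zero_le _)
        (mem_univ j)
    rw [Finsupp.single_eq_same] at this
    omega
  let f : Fin n × Fin m → ℕ := fun x => (s x.1).orderEmbOfFin (hcard x.1) x.2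
  have hf : ∀ j, Function.Injective fun i => f (j, i) := fun j =>
    ((s j).orderEmbOfFin (hcard j)).injective
  have hfe : blockExponent f = e := by
    rw [← hs]
    refine Finset.sum_congr rfl fun j _ => ?_
    congr 1
    exact Finset.image_orderEmbOfFin_univ (s j) (hcard j)
  refine ⟨f, hf, hfe, ?_⟩
  rw [← (blockExponent_mem hf).2.2, hfe, he.2.2]

/-- Words with the same exponent differ by an element of the wreath product. -/
theorem exists_comp_wreathHom_eq {f f' : Fin n × Fin m → ℕ}
    (hf : ∀ j, Function.Injective fun i => f (j, i))
    (h : blockExponent f = blockExponent f') :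
    ∃ w, f' ∘ wreathHom m n w = f := by
  let S : Fin n → Finset ℕ := fun j => univ.image fun i => f (j, i)
  let S' : Fin n → Finset ℕ := fun j => univ.image fun i => f' (j, i)
  have e : ∀ s, Nonempty ({j // S j = s} ≃ {j // S' j = s}) := by
    intro s
    refine ⟨Fintype.equivOfCardEq ?_⟩
    have h1 := DFunLike.congr_fun h s
    rw [Fintype.card_subtype, Fintype.card_subtype]
    simpa [blockExponent, Finsupp.finsetSum_apply, Finsupp.single_apply] using h1
  let σ : Equiv.Perm (Fin n) := Equiv.ofFiberEquiv fun s => (e s).some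
  have hσ : ∀ j, S' (σ j) = S j := fun j => Equiv.ofFiberEquiv_map _ j
  have hτ : ∀ j, ∃ τ : Equiv.Perm (Fin m), ∀ i, f' (σ j, τ i) = f (j, i) := by
    intro j
    have h1 : ∀ i, ∃ i', f' (σ j, i') = f (j, i) := by
      intro i
      have h2 : f (j, i) ∈ S' (σ j) := by
        rw [hσ]
        exact mem_image_of_mem (fun i => f (j, i)) (mem_univ i)
      obtain ⟨i', -, hi'⟩ := mem_image.1 h2
      exact ⟨i', hi'⟩
    choose τ hτ using h1
    have hinj : Function.Injective τ := fun a b hab =>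
      hf j ((hτ a).symm.trans ((congrArg (fun i => f' (σ j, i)) hab).trans (hτ b)))
    exact ⟨Equiv.ofBijective τ (Finite.injective_iff_bijective.1 hinj), hτ⟩
  choose τ hτ using hτ
  refine ⟨⟨fun j => τ (σ.symm j), σ⟩, ?_⟩
  ext ⟨j, i⟩
  change f' (σ j, τ (σ.symm (σ j)) i) = f (j, i)
  rw [Equiv.symm_apply_apply, hτ]

instance finite_wreath : Finite (Wreath m n) :=
  Finite.of_injective (fun w => (w.left, w.right)) fun _ _ h =>
    SemidirectProduct.ext (congrArg Prod.fst h) (congrArg Prod.snd h)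

variable (k m n) in
/-- The combinations of words of weight `d` on which the wreath product acts as it does on wedge
products. -/
def foulkesSpace (d : ℕ →₀ ℕ) : Submodule k ((Fin n × Fin m → ℕ) →₀ k) :=
  weightSpace k _ d ⊓ semiInvariants (wreathHom m n) (wreathSign k m n) (rowFunctionRep k _)

theorem wreathSign_mul_self (w : Wreath m n) : wreathSign k m n w * wreathSign k m n w = 1 := by
  change (∏ j, permSign k (w.left j)) * (∏ j, permSign k (w.left j)) = 1
  rw [← Finset.prod_mul_distrib]
  exact Finset.prod_eq_one fun j _ => permSign_mul_self _

theorem foulkesSpace_apply_comp {d : ℕ →₀ ℕ} {v : (Fin n × Fin m → ℕ) →₀ k}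
    (hv : v ∈ foulkesSpace k m n d) (f : Fin n × Fin m → ℕ) (w : Wreath m n) :
    v (f ∘ wreathHom m n w) = wreathSign k m n w * v f := by
  rw [← rowFunctionRep_apply, hv.2 w]
  rfl

theorem foulkesSpace_apply_of_not_injective [CharZero k] {d : ℕ →₀ ℕ}
    {v : (Fin n × Fin m → ℕ) →₀ k} (hv : v ∈ foulkesSpace k m n d) {f : Fin n × Fin m → ℕ}
    (hf : ¬ ∀ j, Function.Injective fun i => f (j, i)) : v f = 0 := by
  obtain ⟨j, hj⟩ := not_forall.1 hf
  obtain ⟨a, b, hab, hne⟩ : ∃ a b, f (j, a) = f (j, b) ∧ a ≠ b := by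
    simpa [Function.Injective] using hj
  let w : Wreath m n := ⟨Pi.mulSingle j (Equiv.swap a b), 1⟩
  have h1 : f ∘ wreathHom m n w = f := by
    ext ⟨j', i⟩
    change f (j', (Pi.mulSingle j (Equiv.swap a b) : Fin n → Equiv.Perm (Fin m)) j' i) = _
    by_cases hj' : j' = j
    · subst hj'
      rw [Pi.mulSingle_eq_same]
      exact Equiv.apply_swap_eq_self (v := fun i => f (j', i)) hab i
    · rw [Pi.mulSingle_eq_of_ne hj']
      rfl
  have h2 : wreathSign k m n w = -1 := by
    change ∏ j', permSign k ((Pi.mulSingle j (Equiv.swap a b) : Fin n → Equiv.Perm (Fin m)) j') = _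
    rw [Finset.prod_eq_single j]
    · rw [Pi.mulSingle_eq_same, permSign, Equiv.Perm.sign_swap hne]
      simp
    · intro j' _ hj'
      rw [Pi.mulSingle_eq_of_ne hj']
      simp [permSign]
    · intro h; exact absurd (mem_univ _) h
  have h3 := foulkesSpace_apply_comp hv f w
  rw [h1, h2, neg_one_mul] at h3
  exact self_eq_neg.1 h3

theorem finite_wedgeExponents (d : ℕ →₀ ℕ) : Finite (wedgeExponents m n d) := by
  choose f _ hfe hfd using fun e : wedgeExponents m n d => exists_blockExponent_eq e.2
  have : Finite {f : Fin n × Fin m → ℕ | wordWeight f = d} := finite_wordWeight d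
  exact Finite.of_injective (fun e => (⟨f e, hfd e⟩ : {f : Fin n × Fin m → ℕ | wordWeight f = d}))
    fun e e' h => Subtype.ext ((hfe e).symm.trans
      ((congrArg blockExponent (congrArg Subtype.val h)).trans (hfe e')))

instance finiteDimensional_foulkesSpace (d : ℕ →₀ ℕ) :
    FiniteDimensional k (foulkesSpace k m n d) :=
  Submodule.finiteDimensional_of_le inf_le_left

/-- A vector of the space is determined by its coefficients at one word for each exponent: the words
with a given exponent form one orbit of the wreath product. -/
theorem finrank_foulkesSpace_le [CharZero k] (d : ℕ →₀ ℕ) :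
    finrank k (foulkesSpace k m n d) ≤ Nat.card (wedgeExponents m n d) := by
  have := finite_wedgeExponents (m := m) (n := n) d
  have := Fintype.ofFinite (wedgeExponents m n d)
  choose f _ hfe _ using fun e : wedgeExponents m n d => exists_blockExponent_eq e.2
  let ev : foulkesSpace k m n d →ₗ[k] (wedgeExponents m n d → k) :=
    { toFun := fun v e => (v : (Fin n × Fin m → ℕ) →₀ k) (f e)
      map_add' := fun _ _ => rfl
      map_smul' := fun _ _ => rfl }
  rw [Nat.card_eq_fintype_card, ← Module.finrank_fintype_fun_eq_card k]
  refine LinearMap.finrank_le_finrank_of_injective (f := ev) ?_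
  refine (injective_iff_map_eq_zero ev).2 fun v hv => Subtype.ext (Finsupp.ext fun u => ?_)
  by_contra hne
  change (v : (Fin n × Fin m → ℕ) →₀ k) u ≠ 0 at hne
  have hu : ∀ j, Function.Injective fun i => u (j, i) := by
    by_contra h
    exact hne (foulkesSpace_apply_of_not_injective v.2 h)
  have hmem := blockExponent_mem hu
  rw [mem_weightSpace.1 v.2.1 u hne] at hmem
  obtain ⟨w, hw⟩ := exists_comp_wreathHom_eq hu (hfe ⟨_, hmem⟩).symm
  rw [← hw, foulkesSpace_apply_comp v.2] at hne
  exact hne (by rw [show (v : (Fin n × Fin m → ℕ) →₀ k) (f ⟨_, hmem⟩) = 0 from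
    congrFun hv ⟨_, hmem⟩, mul_zero])

/-- The map to the symmetric algebra identifies `foulkesSpace` with the component of degree `n` and
weight `d`; see also `toSymmetricAlgebra_injOn`. -/
theorem map_foulkesSpace [CharZero k] (d : ℕ →₀ ℕ) :
    (foulkesSpace k m n d).map (toSymmetricAlgebra k m n) =
      MvPolynomial.restrictSupport k (wedgeExponents m n d) := by
  refine le_antisymm ?_ ?_
  · rintro _ ⟨v, hv, rfl⟩
    rw [← Finsupp.sum_single v, Finsupp.sum, map_sum]
    refine Submodule.sum_mem _ fun f hf => ?_
    have hfd := mem_weightSpace.1 hv.1 f (Finsupp.mem_support_iff.1 hf)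
    rw [← mul_one (v f), ← smul_eq_mul, ← Finsupp.smul_single, map_smul]
    refine Submodule.smul_mem _ _ ?_
    by_cases hinj : ∀ j, Function.Injective fun i => f (j, i)
    · obtain ⟨ε, -, h⟩ := toSymmetricAlgebra_single_of_injective (k := k) hinj
      rw [h]
      refine Submodule.smul_mem _ _ ?_
      rw [MvPolynomial.restrictSupport_eq_span]
      exact Submodule.subset_span ⟨_, hfd ▸ blockExponent_mem hinj, rfl⟩
    · rw [toSymmetricAlgebra_single_of_not_injective hinj]
      exact Submodule.zero_mem _
  · rw [MvPolynomial.restrictSupport_eq_span, Submodule.span_le]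
    rintro _ ⟨e, he, rfl⟩
    have := Fintype.ofFinite (Wreath m n)
    obtain ⟨f, hf, rfl, rfl⟩ := exists_blockExponent_eq he
    obtain ⟨ε, hε, h⟩ := toSymmetricAlgebra_single_of_injective (k := k) hf
    let v : (Fin n × Fin m → ℕ) →₀ k := ∑ w : Wreath m n, wreathSign k m n w •
      rowFunctionRep k _ (wreathHom m n w) (Finsupp.single f 1)
    have hv : v ∈ foulkesSpace k m n (wordWeight f) := by
      refine ⟨Submodule.sum_mem _ fun w _ => Submodule.smul_mem _ _
        (rowFunctionRep_mem_weightSpace _ (single_mem_weightSpace rfl 1)), fun w => ?_⟩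
      simp only [v]
      rw [map_sum, Finset.smul_sum]
      refine Fintype.sum_equiv (Equiv.mulLeft w) _ _ fun g => ?_
      rw [map_smul, Equiv.coe_mulLeft, map_mul, map_mul, map_mul, Module.End.mul_apply, smul_smul,
        ← mul_assoc, wreathSign_mul_self, one_mul]
    have hΦ : toSymmetricAlgebra k m n v = ((Fintype.card (Wreath m n) : k) * ε) •
        MvPolynomial.monomial (blockExponent f) 1 := by
      simp only [v]
      rw [map_sum, Finset.sum_congr rfl fun w _ => by
        rw [map_smul, toSymmetricAlgebra_rowFunctionRep, smul_smul, wreathSign_mul_self, one_smul],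
        Finset.sum_const, Finset.card_univ, ← Nat.cast_smul_eq_nsmul k, h, smul_smul]
    have hc : (Fintype.card (Wreath m n) : k) ≠ 0 := Nat.cast_ne_zero.2 Fintype.card_ne_zero
    refine ⟨((Fintype.card (Wreath m n) : k)⁻¹ * ε) • v, Submodule.smul_mem _ _ hv, ?_⟩
    rw [map_smul, hΦ, smul_smul, mul_mul_mul_comm, inv_mul_cancel₀ hc, hε, one_mul, one_smul]

theorem finrank_restrictSupport_wedgeExponents (d : ℕ →₀ ℕ) :
    finrank k (MvPolynomial.restrictSupport k (wedgeExponents m n d)) =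
      Nat.card (wedgeExponents m n d) :=
  finrank_eq_nat_card_basis (MvPolynomial.basisRestrictSupport k _)

theorem finrank_foulkesSpace [CharZero k] (d : ℕ →₀ ℕ) :
    finrank k (foulkesSpace k m n d) = Nat.card (wedgeExponents m n d) := by
  refine le_antisymm (finrank_foulkesSpace_le d) ?_
  rw [← finrank_restrictSupport_wedgeExponents (k := k), ← map_foulkesSpace]
  exact Submodule.finrank_map_le _ _

theorem toSymmetricAlgebra_injOn [CharZero k] {d : ℕ →₀ ℕ} {v : (Fin n × Fin m → ℕ) →₀ k}
    (hv : v ∈ foulkesSpace k m n d) (h : toSymmetricAlgebra k m n v = 0) : v = 0 := by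
  have h1 := LinearMap.finrank_range_add_finrank_ker
    ((toSymmetricAlgebra k m n).domRestrict (foulkesSpace k m n d))
  rw [LinearMap.range_domRestrict, map_foulkesSpace, finrank_restrictSupport_wedgeExponents,
    finrank_foulkesSpace, Nat.add_eq_left, Submodule.finrank_eq_zero] at h1
  have h2 : (⟨v, hv⟩ : foulkesSpace k m n d) ∈
      LinearMap.ker ((toSymmetricAlgebra k m n).domRestrict (foulkesSpace k m n d)) := h
  rw [h1, Submodule.mem_bot] at h2
  exact congrArg Subtype.val h2

variable (k m n) in
/-- The multiplicity of `S^λ` in the module that is induced from the linear character `wreathSign` of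
the wreath product. It is the coefficient of `s_λ` in `s_{(n)} ∘ s_{(1^m)}`, see
`plethysmCoeff_eq`. -/
def foulkesMult (lam : YoungDiagram) : ℕ :=
  finrank k (spechtSemiInvariants k lam (wreathHom m n) (wreathSign k m n))

theorem spechtSemiInvariants_le_foulkesSpace [CharZero k] (lam : YoungDiagram) :
    spechtSemiInvariants k lam (wreathHom m n) (wreathSign k m n) ≤
      foulkesSpace k m n (rowWeight lam) :=
  inf_le_inf_right _ (spechtModule_le_hwSpace.trans fun _ h => (mem_hwSpace.1 h).1)

theorem finrank_map_spechtSemiInvariants [CharZero k] (lam : YoungDiagram) :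
    finrank k ((spechtSemiInvariants k lam (wreathHom m n) (wreathSign k m n)).map
      (toSymmetricAlgebra k m n)) = foulkesMult k m n lam := by
  rw [← LinearMap.range_domRestrict]
  refine LinearMap.finrank_range_of_inj ((injective_iff_map_eq_zero _).2 fun v hv => Subtype.ext ?_)
  exact toSymmetricAlgebra_injOn (spechtSemiInvariants_le_foulkesSpace lam v.2) hv

/-- Multiplication by the wedge product of the letters `0, …, m - 1` maps highest weight vectors to
highest weight vectors, and it is injective because the symmetric algebra is a domain. -/
theorem foulkesMult_le [CharZero k] {lam mu : YoungDiagram}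
    (h : rowWeight mu = setWeight (range m) + rowWeight lam) :
    foulkesMult k m n lam ≤ foulkesMult k m (n + 1) mu := by
  rw [← finrank_map_spechtSemiInvariants, ← finrank_map_spechtSemiInvariants]
  let X : MvPolynomial (Finset ℕ) k := MvPolynomial.X (range m)
  let L : MvPolynomial (Finset ℕ) k →ₗ[k] MvPolynomial (Finset ℕ) k := LinearMap.mulLeft k X
  have hL : Function.Injective L := mul_right_injective₀ (MvPolynomial.X_ne_zero _)
  rw [(Submodule.equivMapOfInjective L hL _).finrank_eq]
  refine Submodule.finrank_mono ?_
  rintro _ ⟨_, ⟨v, hv, rfl⟩, rfl⟩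
  have hv' := spechtSemiInvariants_le_foulkesSpace lam hv
  have hmem : X * toSymmetricAlgebra k m n v ∈
      MvPolynomial.restrictSupport k (wedgeExponents m (n + 1) (rowWeight mu)) := by
    have h1 : toSymmetricAlgebra k m n v ∈ MvPolynomial.restrictSupport k
        (wedgeExponents m n (rowWeight lam)) := by
      rw [← map_foulkesSpace]
      exact ⟨v, hv', rfl⟩
    rw [MvPolynomial.mem_restrictSupport_iff] at h1 ⊢
    intro e he
    rw [mem_coe, MvPolynomial.support_X_mul, Finset.mem_map] at he
    obtain ⟨e, he, rfl⟩ := he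
    obtain ⟨h2, h3, h4⟩ := h1 he
    rw [addLeftEmbedding_apply]
    refine ⟨fun S hS => ?_, ?_, ?_⟩
    · rcases Finset.mem_union.1 (Finsupp.support_add hS) with hS | hS
      · rw [Finset.mem_singleton.1 (Finsupp.support_single_subset hS), card_range]
      · exact h2 S hS
    · rw [map_add, h3, Finsupp.degree_single, add_comm]
    · rw [map_add, h4, Finsupp.weight_single, one_smul, h]
  rw [← map_foulkesSpace] at hmem
  obtain ⟨u, hu, hΦ⟩ := hmem
  refine ⟨u, ⟨?_, hu.2⟩, hΦ⟩
  rw [← hwSpace_eq_spechtModule]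
  refine mem_hwSpace.2 ⟨hu.1, fun i => ?_⟩
  by_contra hne
  obtain ⟨d', -, hd'⟩ := exists_weight_letterOp hu.1 hne
  refine hne (toSymmetricAlgebra_injOn (d := d') ⟨hd', fun w => ?_⟩ ?_)
  · rw [← letterOp_rowFunctionRep, hu.2 w, map_smul]
  · have h1 : raise k i X = 0 := by
      rw [raise, MvPolynomial.mkDerivation_X, if_neg]
      rw [mem_range, mem_range]
      omega
    have h2 : raise k i (toSymmetricAlgebra k m n v) = 0 := by
      rw [← toSymmetricAlgebra_letterOp, (mem_hwSpace.1 (spechtModule_le_hwSpace hv.1)).2, map_zero]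
    rw [toSymmetricAlgebra_letterOp, hΦ, Derivation.leibniz, h1, h2, smul_zero, smul_zero, add_zero]

/-- The expansion of the number of monomials of a given weight into Kostka numbers. -/
theorem card_wedgeExponents (k : Type*) [Field k] [CharZero k] (d : ℕ →₀ ℕ) :
    Nat.card (wedgeExponents m n d) =
      ∑ lam : {lam : YoungDiagram // lam.card = Fintype.card (Fin n × Fin m)},
        kostka lam d * foulkesMult k m n lam.1 := by
  rw [← finrank_foulkesSpace (k := k)]
  exact finrank_weightSpace_semiInvariants (wreathHom m n) (wreathSign k m n) d

end HighestWeight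

/-! ### Rows and columns -/

section Shapes

open Finset Module Representation

theorem mem_rowShape {n i j : ℕ} : (i, j) ∈ rowShape n ↔ i = 0 ∧ j < n := by
  rw [rowShape, YoungDiagram.mem_ofRowLens]
  constructor
  · rintro ⟨h1, h2⟩
    have h3 : i = 0 := by simpa using h1
    subst h3
    exact ⟨rfl, h2⟩
  · rintro ⟨rfl, h⟩
    exact ⟨by simp, h⟩

theorem mem_colShape {m i j : ℕ} : (i, j) ∈ colShape m ↔ i < m ∧ j = 0 := by
  rw [colShape, YoungDiagram.mem_ofRowLens]
  simp

theorem colShape_eq_transpose (n : ℕ) : colShape n = (rowShape n).transpose := by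
  ext ⟨i, j⟩
  rw [YoungDiagram.mem_cells, YoungDiagram.mem_cells, YoungDiagram.mem_transpose, Prod.swap_prod_mk,
    mem_colShape, mem_rowShape, and_comm]

theorem rowLen_eq_of_forall {lam : YoungDiagram} {i r : ℕ} (h : ∀ j, (i, j) ∈ lam ↔ j < r) :
    lam.rowLen i = r :=
  eq_of_forall_lt_iff fun j => by rw [← YoungDiagram.mem_iff_lt_rowLen, h]

theorem card_transpose (lam : YoungDiagram) : lam.transpose.card = lam.card := by
  have : lam.transpose.cells = lam.cells.map (Equiv.prodComm ℕ ℕ).toEmbedding := by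
    ext ⟨i, j⟩
    rw [YoungDiagram.mem_cells, YoungDiagram.mem_transpose, Finset.mem_map_equiv]
    rfl
  rw [YoungDiagram.card, this, Finset.card_map]

theorem rowWeight_colShape (m : ℕ) : rowWeight (colShape m) = setWeight (range m) := by
  ext i
  rw [rowWeight_apply, setWeight, Finsupp.finsetSum_apply]
  simp only [Finsupp.single_apply, Finset.sum_ite_eq', mem_range]
  refine rowLen_eq_of_forall fun j => ?_
  rw [mem_colShape]
  split_ifs with h <;> omega

theorem rowWeight_rowShape (n : ℕ) : rowWeight (rowShape n) = Finsupp.single 0 n := by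
  ext i
  rw [rowWeight_apply, Finsupp.single_apply]
  refine rowLen_eq_of_forall fun j => ?_
  rw [mem_rowShape]
  split_ifs with h <;> omega

theorem card_rowShape (n : ℕ) : (rowShape n).card = n := by
  rw [← degree_rowWeight, rowWeight_rowShape, Finsupp.degree_single]

theorem card_colShape (m : ℕ) : (colShape m).card = m := by
  rw [colShape_eq_transpose, card_transpose, card_rowShape]

theorem rowWeight_addShape (lam theta : YoungDiagram) :
    rowWeight (addShape lam theta) = rowWeight lam + rowWeight theta := by
  ext i
  rw [Finsupp.add_apply, rowWeight_apply, rowWeight_apply, rowWeight_apply]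
  refine rowLen_eq_of_forall fun j => ?_
  rw [addShape, YoungDiagram.mem_ofRowLens]
  simp only [List.length_map, List.length_range, List.getElem_map, List.getElem_range,
    exists_prop, and_iff_right_iff_imp]
  intro h
  have hpos : ∀ mu : YoungDiagram, 0 < mu.rowLen i → i < mu.colLen 0 := fun mu hmu => by
    rwa [← YoungDiagram.mem_iff_lt_colLen, YoungDiagram.mem_iff_lt_rowLen]
  have h1 := hpos lam
  have h2 := hpos theta
  rw [lt_max_iff]
  omega

/-- In a decreasing list the entries greater than `j` form an initial segment. -/
theorem lt_countP_iff {w : List ℕ} (hw : w.Pairwise (· ≥ ·)) (i j : ℕ) :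
    i < w.countP (fun r => decide (j < r)) ↔ ∃ h : i < w.length, j < w[i] := by
  induction w generalizing i with
  | nil => simp
  | cons a w ih =>
    rw [List.pairwise_cons] at hw
    by_cases ha : j < a
    · rw [List.countP_cons_of_pos (by simpa using ha)]
      cases i with
      | zero => simp [ha]
      | succ i => simp [ih hw.2]
    · have h0 : (a :: w).countP (fun r => decide (j < r)) = 0 := by
        rw [List.countP_eq_zero]
        intro b hb
        rcases List.mem_cons.1 hb with rfl | hb
        · simpa using ha
        · have := hw.1 b hb
          simp only [decide_eq_true_eq]
          omega
      rw [h0]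
      refine iff_of_false (Nat.not_lt_zero i) ?_
      rintro ⟨h, hj⟩
      rcases List.mem_cons.1 (List.getElem_mem h) with hb | hb
      · omega
      · have := hw.1 _ hb
        omega

theorem colLen_ofRowLens {w : List ℕ} (hw : w.SortedGE) (j : ℕ) :
    (YoungDiagram.ofRowLens w hw).colLen j = w.countP (fun r => decide (j < r)) := by
  refine eq_of_forall_lt_iff fun i => ?_
  rw [← YoungDiagram.mem_iff_lt_colLen, YoungDiagram.mem_ofRowLens, lt_countP_iff hw.pairwise]

/-- Inserting a row of length `m` amounts to adding a column of length `m` to the conjugate. -/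
theorem insertRow_eq (m : ℕ) (lam : YoungDiagram) :
    insertRow m lam = (addShape lam.transpose (colShape m)).transpose := by
  rw [← YoungDiagram.transpose_eq_iff, YoungDiagram.transpose_transpose]
  refine rowWeight_injective (Finsupp.ext fun j => ?_)
  rw [rowWeight_addShape, Finsupp.add_apply, rowWeight_apply, rowWeight_apply, rowWeight_colShape,
    YoungDiagram.rowLen_transpose, YoungDiagram.rowLen_transpose, insertRow, colLen_ofRowLens,
    (List.perm_orderedInsert _ m lam.rowLens).countP_eq, List.countP_cons]
  have h1 : lam.colLen j = lam.rowLens.countP (fun r => decide (j < r)) := by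
    conv_lhs => rw [← YoungDiagram.ofRowLens_to_rowLens_eq_self (μ := lam)]
    rw [colLen_ofRowLens]
  rw [h1, setWeight, Finsupp.finsetSum_apply]
  simp [Finsupp.single_apply]

end Shapes

section LinearCharacters

open Finset Module Representation

variable {k : Type*} [Field k] {α : Type} [Fintype α] [DecidableEq α] {n : ℕ}

theorem rowShape_polytabloid (t : Tableau (rowShape n) α) :
    t.polytabloid k = Finsupp.single (fun _ => 0) 1 := by
  classical
  have htab : t.tabloid = fun _ => 0 := funext fun a =>
    (mem_rowShape.1 ((YoungDiagram.mem_cells _).1 (t.symm a).2)).1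
  have hrow : ∀ a, (t.symm a).1.1 = 0 := congrFun htab
  rw [Tableau.polytabloid_eq, Finset.sum_eq_single 1]
  · simp [htab]
  · intro π hπ hne
    rw [Finset.mem_filter_univ] at hπ
    refine absurd (Equiv.ext fun a => ?_) hne
    exact t.symm.injective (Subtype.ext (Prod.ext ((hrow _).trans (hrow _).symm) (hπ a)))
  · intro h
    exact absurd (Finset.mem_filter_univ _ |>.2 fun a => rfl) h

/-- The Specht module of a one-row partition is the trivial module. -/
theorem exists_spechtModule_rowShape (k : Type*) [Field k] (hn : n = Fintype.card α) :
    ∃ x₀ : spechtModule k (rowShape n) α, x₀ ≠ 0 ∧ (∀ x, ∃ c : k, x = c • x₀) ∧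
      ∀ σ, spechtRep k (rowShape n) α σ x₀ = x₀ := by
  obtain ⟨t⟩ := exists_tableau (α := α) ((card_rowShape n).trans hn)
  refine ⟨t.spechtVector k, t.spechtVector_ne_zero, fun x => ?_, fun σ => Subtype.ext ?_⟩
  · have hrange : (Set.range fun t : Tableau (rowShape n) α => t.polytabloid k) =
        {t.polytabloid k} := by
      ext y
      constructor
      · rintro ⟨t', rfl⟩
        exact (rowShape_polytabloid t').trans (rowShape_polytabloid t).symm
      · rintro rfl
        exact ⟨t, rfl⟩
    have hx : (x : (α → ℕ) →₀ k) ∈ Submodule.span k {t.polytabloid k} := hrange ▸ x.2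
    rw [Submodule.mem_span_singleton] at hx
    obtain ⟨c, hc⟩ := hx
    exact ⟨c, Subtype.ext hc.symm⟩
  · rw [spechtRep_coe]
    change rowFunctionRep k α σ (t.polytabloid k) = t.polytabloid k
    rw [rowFunctionRep_polytabloid, rowShape_polytabloid, rowShape_polytabloid]

/-- The Specht module of a one-column partition is the sign module. -/
theorem exists_spechtModule_colShape (k : Type*) [Field k] [CharZero k]
    (hn : n = Fintype.card α) :
    ∃ x₀ : spechtModule k (colShape n) α, x₀ ≠ 0 ∧ (∀ x, ∃ c : k, x = c • x₀) ∧
      ∀ σ, spechtRep k (colShape n) α σ x₀ = permSign k σ • x₀ := by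
  obtain ⟨x₀, h0, hspan, hact⟩ := exists_spechtModule_rowShape k hn
  obtain ⟨θ, hθ⟩ := exists_transpose_equiv (k := k) ((card_rowShape n).trans hn)
  rw [colShape_eq_transpose]
  refine ⟨θ x₀, fun h => h0 ((LinearEquiv.map_eq_zero_iff θ).1 h), fun x => ?_, fun σ => ?_⟩
  · obtain ⟨c, hc⟩ := hspan (θ.symm x)
    exact ⟨c, by rw [← map_smul, ← hc, LinearEquiv.apply_symm_apply]⟩
  · have := hθ σ x₀
    rw [hact] at this
    conv_rhs => rw [this, smul_smul, permSign_mul_self, one_smul]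

/-- The semi-invariants in a one-dimensional module. -/
theorem finrank_semiInvariants_of_span {V W : Type*} [AddCommGroup V] [Module k V]
    [Group W] {G : Type} [Group G] (φ : W →* G) (χ ψ : W → k) (ρ : Representation k G V) {x₀ : V}
    (h0 : x₀ ≠ 0) (hspan : ∀ x, ∃ c : k, x = c • x₀) (hact : ∀ w, ρ (φ w) x₀ = ψ w • x₀) :
    (∀ w, ψ w = χ w) ∧ finrank k (semiInvariants φ χ ρ) = 1 ∨
      (∃ w, ψ w ≠ χ w) ∧ finrank k (semiInvariants φ χ ρ) = 0 := by
  by_cases h : ∀ w, ψ w = χ w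
  · refine Or.inl ⟨h, finrank_eq_one_iff_of_nonzero' (⟨x₀, fun w => by rw [hact, h]⟩ :
      semiInvariants φ χ ρ) (fun h => h0 (congrArg Subtype.val h)) |>.2 fun x => ?_⟩
    obtain ⟨c, hc⟩ := hspan x.1
    exact ⟨c, Subtype.ext hc.symm⟩
  · rw [not_forall] at h
    refine Or.inr ⟨h, ?_⟩
    obtain ⟨w, hw⟩ := h
    have : semiInvariants φ χ ρ = ⊥ := by
      rw [eq_bot_iff]
      intro x hx
      obtain ⟨c, rfl⟩ := hspan x
      have h1 := hx w
      rw [map_smul, hact, smul_smul, smul_smul, ← sub_eq_zero, ← sub_smul, smul_eq_zero] at h1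
      have h2 := h1.resolve_right h0
      rw [mul_comm, ← sub_mul, mul_eq_zero] at h2
      rw [h2.resolve_left (sub_ne_zero.2 hw), zero_smul]
      exact Submodule.zero_mem _
    rw [this, finrank_bot]

theorem degree_of_kostka_ne_zero {lam : YoungDiagram} {d : ℕ →₀ ℕ} (h : kostka lam d ≠ 0) :
    d.degree = lam.card := by
  obtain ⟨⟨T, rfl⟩⟩ := (Nat.card_ne_zero.1 h).1
  simp [content, map_sum, YoungDiagram.card]

theorem exists_wordWeight_eq {d : ℕ →₀ ℕ} (hd : d.degree = n) :
    ∃ f : Fin n → ℕ, wordWeight f = d := exists_sum_single_eq hd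

theorem kostka_rowShape (n : ℕ) (d : ℕ →₀ ℕ) :
    kostka (rowShape n) d = if d.degree = n then 1 else 0 := by
  split_ifs with h
  · obtain ⟨f, rfl⟩ := exists_wordWeight_eq h
    have hn : n = Fintype.card (Fin n) := (Fintype.card_fin n).symm
    rw [← finrank_invariants_eq_kostka (k := ℚ) ((card_rowShape n).trans hn),
      ← finrank_semiInvariants_spechtRep]
    obtain ⟨x₀, h0, hspan, hact⟩ := exists_spechtModule_rowShape ℚ hn
    rcases finrank_semiInvariants_of_span (wordStab f).subtype (fun _ => 1) (fun _ => 1) _ h0 hspan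
      (fun w => by rw [hact, one_smul]) with h | ⟨⟨w, hw⟩, -⟩
    · exact h.2
    · exact absurd rfl hw
  · by_contra hne
    exact h ((degree_of_kostka_ne_zero hne).trans (card_rowShape n))

theorem kostka_colShape (m : ℕ) (S : Finset ℕ) (hS : #S = m) :
    kostka (colShape m) (setWeight S) = 1 := by
  let f : Fin m → ℕ := S.orderEmbOfFin hS
  have hf : wordWeight f = setWeight S := by
    rw [setWeight, ← Finset.image_orderEmbOfFin_univ S hS, Finset.sum_image fun a _ b _ h =>
      (S.orderEmbOfFin hS).injective h]
    rfl
  have hn : m = Fintype.card (Fin m) := (Fintype.card_fin m).symm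
  rw [← hf, ← finrank_invariants_eq_kostka (k := ℚ) ((card_colShape m).trans hn),
    ← finrank_semiInvariants_spechtRep]
  obtain ⟨x₀, h0, hspan, hact⟩ := exists_spechtModule_colShape ℚ hn
  rcases finrank_semiInvariants_of_span (wordStab f).subtype (fun _ => 1)
    (fun w => permSign ℚ w.1) _ h0 hspan (fun w => hact w.1) with h | ⟨⟨w, hw⟩, -⟩
  · exact h.2
  · refine absurd ?_ hw
    have : w.1 = 1 := Equiv.ext fun a => (S.orderEmbOfFin hS).injective (congrFun w.2 a)
    rw [this]
    simp [permSign]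

theorem exists_of_kostka_colShape_ne_zero {m : ℕ} {d : ℕ →₀ ℕ} (h : kostka (colShape m) d ≠ 0) :
    ∃ S : Finset ℕ, #S = m ∧ d = setWeight S := by
  obtain ⟨f, rfl⟩ := exists_wordWeight_eq ((degree_of_kostka_ne_zero h).trans (card_colShape m))
  have hn : m = Fintype.card (Fin m) := (Fintype.card_fin m).symm
  rw [← finrank_invariants_eq_kostka (k := ℚ) ((card_colShape m).trans hn),
    ← finrank_semiInvariants_spechtRep] at h
  obtain ⟨x₀, h0, hspan, hact⟩ := exists_spechtModule_colShape ℚ hn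
  rcases finrank_semiInvariants_of_span (wordStab f).subtype (fun _ => 1)
    (fun w => permSign ℚ w.1) _ h0 hspan (fun w => hact w.1) with h1 | h1
  · have hf : Function.Injective f := by
      intro a b hab
      by_contra hne
      have h2 := h1.1 ⟨_, swap_mem_wordStab hab⟩
      rw [permSign, Equiv.Perm.sign_swap hne] at h2
      norm_num at h2
    refine ⟨univ.image f, by rw [Finset.card_image_of_injective _ hf, Finset.card_fin], ?_⟩
    rw [setWeight, Finset.sum_image fun a _ b _ h => hf h]
    rfl
  · exact absurd h1.2 h

end LinearCharacters

/-! ### Plethysm coefficients and twisted Foulkes modules -/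

section Plethysm

open Finset Module Representation

variable {m n : ℕ}

theorem coeff_schur_int (lam : YoungDiagram) (d : ℕ →₀ ℕ) :
    MvPowerSeries.coeff d (schur ℤ lam) = kostka lam d := rfl

theorem coeff_schur_nat (lam : YoungDiagram) (d : ℕ →₀ ℕ) :
    MvPowerSeries.coeff d (schur ℕ lam) = kostka lam d := Nat.cast_id _

theorem support_setWeight (S : Finset ℕ) : (setWeight S).support = S := by
  ext p
  simp [setWeight, Finsupp.finsetSum_apply, Finsupp.single_apply]

/-- The monomials of the elementary symmetric function are indexed by the sets of size `m`. -/
theorem monomialIndex_colShape (u : MonomialIndex (schur ℕ (colShape m))) :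
    #u.1.support = m ∧ u.1 = setWeight u.1.support ∧
      MvPowerSeries.coeff u.1 (schur ℕ (colShape m)) = 1 := by
  have h1 : kostka (colShape m) u.1 ≠ 0 := by
    rw [← coeff_schur_nat]
    exact (Nat.zero_le _).trans_lt u.2.2 |>.ne'
  obtain ⟨S, hS, h2⟩ := exists_of_kostka_colShape_ne_zero h1
  rw [h2, support_setWeight, coeff_schur_nat, kostka_colShape m S hS]
  exact ⟨hS, rfl, rfl⟩

theorem monomialIndex_support_injective :
    Function.Injective fun u : MonomialIndex (schur ℕ (colShape m)) => u.1.support := by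
  intro u v h
  have h1 : u.1 = v.1 := by
    rw [(monomialIndex_colShape u).2.1, (monomialIndex_colShape v).2.1]
    exact congrArg setWeight h
  have hu := (monomialIndex_colShape u).2.2
  obtain ⟨d, i⟩ := u
  obtain ⟨d', j⟩ := v
  obtain rfl : d = d' := h1
  have : Subsingleton (Fin (MvPowerSeries.coeff d (schur ℕ (colShape m)))) := by
    rw [hu]
    infer_instance
  rw [Subsingleton.elim i j]

theorem exists_monomialIndex (S : Finset ℕ) (hS : #S = m) :
    ∃ u : MonomialIndex (schur ℕ (colShape m)), u.1.support = S :=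
  ⟨⟨setWeight S, ⟨0, by rw [coeff_schur_nat, kostka_colShape m S hS]; exact one_pos⟩⟩,
    support_setWeight S⟩

theorem weight_mapDomain_support (e : MonomialIndex (schur ℕ (colShape m)) →₀ ℕ) :
    Finsupp.weight setWeight (e.mapDomain fun u => u.1.support) = e.sum fun u c => c • u.1 := by
  rw [Finsupp.weight_apply, Finsupp.sum_mapDomain_index (by simp) (by intros; rw [add_smul])]
  exact Finset.sum_congr rfl fun u _ => congrArg (e u • ·) (monomialIndex_colShape u).2.1.symm

/-- The coefficients of the plethysm count monomials in the symmetric algebra of the exterior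
power. -/
theorem coeff_plethysm (d : ℕ →₀ ℕ) :
    MvPowerSeries.coeff d (plethysm (schur ℤ (rowShape n)) (schur ℕ (colShape m))) =
      Nat.card (wedgeExponents m n d) := by
  have h1 : ∀ e : {e : MonomialIndex (schur ℕ (colShape m)) →₀ ℕ //
      (e.sum fun u c => c • u.1) = d},
      MvPowerSeries.coeff (e.1.mapDomain Encodable.encode) (schur ℤ (rowShape n)) =
        Nat.castAddMonoidHom ℤ (∑ᶠ _ : e.1.degree = n, 1) := by
    intro e
    rw [coeff_schur_int, kostka_rowShape, Finsupp.degree_mapDomain, finsum_eq_if]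
    rfl
  change ∑ᶠ e : {e : MonomialIndex (schur ℕ (colShape m)) →₀ ℕ //
      (e.sum fun u c => c • u.1) = d},
      MvPowerSeries.coeff (e.1.mapDomain Encodable.encode) (schur ℤ (rowShape n)) = _
  rw [finsum_congr h1, ← AddMonoidHom.map_finsum_of_injective _ Nat.cast_injective]
  refine congrArg (Nat.cast : ℕ → ℤ) ((finsum_one (s := {e : {e : MonomialIndex
    (schur ℕ (colShape m)) →₀ ℕ // (e.sum fun u c => c • u.1) = d} | e.1.degree = n})).trans ?_)
  rw [← Nat.card_coe_set_eq]
  refine Nat.card_congr (Equiv.ofBijective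
    (fun e => ⟨e.1.1.mapDomain fun u => u.1.support, fun S hS => ?_, ?_, ?_⟩) ⟨?_, ?_⟩)
  · classical
    obtain ⟨u, -, rfl⟩ := Finset.mem_image.1 (Finsupp.mapDomain_support hS)
    exact (monomialIndex_colShape u).1
  · rw [Finsupp.degree_mapDomain]
    exact e.2
  · rw [weight_mapDomain_support]
    exact e.1.2
  · intro e e' h
    exact Subtype.ext (Subtype.ext (Finsupp.mapDomain_injective monomialIndex_support_injective
      (congrArg Subtype.val h)))
  · rintro ⟨e, h2, h3, h4⟩
    have h5 : Finsupp.mapDomain (fun u : MonomialIndex (schur ℕ (colShape m)) => u.1.support)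
        (Finsupp.comapDomain _ e monomialIndex_support_injective.injOn) = e :=
      Finsupp.mapDomain_comapDomain _ monomialIndex_support_injective _
        fun S hS => exists_monomialIndex S (h2 S hS)
    refine ⟨⟨⟨Finsupp.comapDomain _ e monomialIndex_support_injective.injOn, ?_⟩, ?_⟩,
      Subtype.ext h5⟩
    · rw [← weight_mapDomain_support, h5, h4]
    · change Finsupp.degree _ = n
      rw [← Finsupp.degree_mapDomain (fun u : MonomialIndex (schur ℕ (colShape m)) => u.1.support),
        h5, h3]

theorem isSchurExpansion_iff (F : MvPowerSeries ℕ ℤ) (c : YoungDiagram →₀ ℤ) :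
    IsSchurExpansion F c ↔ F = Finsupp.linearCombination ℤ (schur ℤ) c := Iff.rfl

/-- The Schur functions are linearly independent because the Kostka numbers are unitriangular. -/
theorem linearIndependent_schur : LinearIndependent ℤ (schur ℤ) := by
  rw [linearIndependent_iff]
  intro c hc
  by_contra hne
  obtain ⟨lam, hlam, hmin⟩ := Finset.exists_min_image c.support
    (fun lam => letterSum (rowWeight lam)) (Finsupp.support_nonempty_iff.2 hne)
  have h := congrArg (MvPowerSeries.coeff (rowWeight lam)) hc
  rw [Finsupp.linearCombination_apply, Finsupp.sum, map_sum, Finset.sum_eq_single lam] at h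
  · rw [map_smul, coeff_schur_int, kostka_self] at h
    exact Finsupp.mem_support_iff.1 hlam (by simpa using h)
  · intro mu hmu hmul
    rw [map_smul, coeff_schur_int]
    by_cases hk : kostka mu (rowWeight lam) = 0
    · rw [hk, Nat.cast_zero, smul_zero]
    · obtain ⟨h1, h2⟩ := letterSum_le_of_kostka_ne_zero hk
      exact absurd (h2 (le_antisymm h1 (hmin mu hmu))) hmul
  · intro h
    exact absurd hlam h

/-- The multiplicities as the coefficients of a linear combination of Schur functions. -/
def plethysmExpansion (k : Type*) [Field k] (m n : ℕ) : YoungDiagram →₀ ℤ :=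
  ∑ lam : {lam : YoungDiagram // lam.card = Fintype.card (Fin n × Fin m)},
    Finsupp.single lam.1 (foulkesMult k m n lam.1 : ℤ)

theorem isSchurExpansion_plethysmExpansion (k : Type*) [Field k] [CharZero k] (m n : ℕ) :
    IsSchurExpansion (plethysm (schur ℤ (rowShape n)) (schur ℕ (colShape m)))
      (plethysmExpansion k m n) := by
  rw [isSchurExpansion_iff]
  refine MvPowerSeries.ext fun d => ?_
  rw [coeff_plethysm, card_wedgeExponents k, plethysmExpansion, map_sum, map_sum, Nat.cast_sum]
  refine Finset.sum_congr rfl fun lam _ => ?_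
  rw [Finsupp.linearCombination_single, map_smul, coeff_schur_int, Nat.cast_mul, smul_eq_mul,
    mul_comm]

theorem existsUnique_isSchurExpansion (m n : ℕ) :
    ∃! c, IsSchurExpansion (plethysm (schur ℤ (rowShape n)) (schur ℕ (colShape m))) c := by
  refine ⟨plethysmExpansion ℚ m n, isSchurExpansion_plethysmExpansion ℚ m n, fun c hc => ?_⟩
  refine linearIndependent_schur ?_
  rw [← (isSchurExpansion_iff _ _).1 hc, ← (isSchurExpansion_iff _ _).1
    (isSchurExpansion_plethysmExpansion ℚ m n)]

/-- Plethysm coefficients are multiplicities of Specht modules. -/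
theorem plethysmCoeff_eq (k : Type*) [Field k] [CharZero k] {lam : YoungDiagram}
    (hlam : lam.card = m * n) :
    plethysmCoeff (rowShape n) (colShape m) lam = foulkesMult k m n lam := by
  classical
  have h := (existsUnique_isSchurExpansion m n).exists
  rw [plethysmCoeff, dif_pos h, (existsUnique_isSchurExpansion m n).unique h.choose_spec
    (isSchurExpansion_plethysmExpansion k m n), plethysmExpansion, Finsupp.finsetSum_apply]
  have hcard : lam.card = Fintype.card (Fin n × Fin m) := by
    rw [hlam, Fintype.card_prod, Fintype.card_fin, Fintype.card_fin, mul_comm]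
  rw [Finset.sum_eq_single ⟨lam, hcard⟩]
  · exact Finsupp.single_eq_same
  · intro mu _ hne
    exact Finsupp.single_eq_of_ne fun h => hne (Subtype.ext h.symm)
  · intro h
    exact absurd (mem_univ _) h

end Plethysm

section Foulkes

open Finset Module Representation

variable {k : Type*} [Field k] [CharZero k] {m n : ℕ}

theorem permSign_wreathHom (w : Wreath m n) :
    permSign k (wreathHom m n w) = wreathSign k m n w * permSign k w.right ^ m := by
  have h1 : wreathHom m n w = Equiv.prodCongrRight w.left *
      Equiv.prodCongrLeft fun _ : Fin m => w.right := by
    ext x <;> rfl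
  rw [h1, permSign_mul, permSign, permSign, Equiv.Perm.sign_prodCongrRight,
    Equiv.Perm.sign_prodCongrLeft]
  simp [wreathSign, permSign]

/-- The multiplicities in a twisted Foulkes module that belongs to a linear character `ψ` of the
symmetric group. The condition on `ψ` says that its inflation times the sign is the action on wedge
products. -/
theorem twistedFoulkesMult_eq {nu lam : YoungDiagram} (hlam : lam.card = m * n)
    (ψ : Equiv.Perm (Fin n) → k) (hψ : ∀ σ, permSign k σ ^ m * ψ σ = 1)
    (hnu : ∃ x₀ : spechtModule k nu (Fin n), x₀ ≠ 0 ∧ (∀ x, ∃ c : k, x = c • x₀) ∧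
      ∀ σ, spechtRep k nu (Fin n) σ x₀ = ψ σ • x₀) :
    twistedFoulkesMult k m n nu lam = foulkesMult k m n lam.transpose := by
  obtain ⟨x₀, h0, hspan, hact⟩ := hnu
  have hcard : lam.card = Fintype.card (Fin n × Fin m) := by
    rw [hlam, Fintype.card_prod, Fintype.card_fin, Fintype.card_fin, mul_comm]
  have hχ : (fun w : Wreath m n => permSign k (wreathHom m n w) * ψ w.right) =
      wreathSign k m n := by
    ext w
    rw [permSign_wreathHom, mul_assoc, hψ, mul_one]
  have hind := finrank_hom_ind (wreathHom m n) ((spechtRep k nu (Fin n)).comp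
    (SemidirectProduct.rightHom : Wreath m n →* Equiv.Perm (Fin n))) (fun w => ψ w.right) x₀
    (fun w => hact w.right) h0 hspan (spechtRep k lam (Fin n × Fin m))
  rw [finrank_semiInvariants_spechtRep, finrank_spechtSemiInvariants_transpose hcard, hχ] at hind
  exact (finrank_hom_comm _ _).trans hind

theorem foulkesMult_le_insertRow (lam : YoungDiagram) :
    foulkesMult k m n lam.transpose ≤ foulkesMult k m (n + 1) (insertRow m lam).transpose := by
  rw [insertRow_eq, YoungDiagram.transpose_transpose]
  refine foulkesMult_le ?_
  rw [rowWeight_addShape, rowWeight_colShape, add_comm]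

theorem card_addShape (lam theta : YoungDiagram) :
    (addShape lam theta).card = lam.card + theta.card := by
  rw [← degree_rowWeight, rowWeight_addShape, map_add, degree_rowWeight, degree_rowWeight]

theorem card_insertRow (m : ℕ) (lam : YoungDiagram) : (insertRow m lam).card = lam.card + m := by
  rw [insertRow_eq, card_transpose, card_addShape, card_transpose, card_colShape]

end Foulkes

end

theorem theorem1 (k : Type*) [Field k] [CharZero k] (m n : ℕ) (lam : YoungDiagram) (hlam : lam.card = m * n) :
    ((∃! c, IsSchurExpansion (plethysm (schur ℤ (rowShape n)) (schur ℕ (colShape m))) c) ∧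
      plethysmCoeff (rowShape n) (colShape m) lam ≤
        plethysmCoeff (rowShape (n + 1)) (colShape m) (addShape lam (colShape m))) ∧
    (Even m →
      twistedFoulkesMult k m n (rowShape n) lam ≤
        twistedFoulkesMult k m (n + 1) (rowShape (n + 1)) (insertRow m lam)) ∧
    (Odd m →
      twistedFoulkesMult k m n (colShape n) lam ≤
        twistedFoulkesMult k m (n + 1) (colShape (n + 1)) (insertRow m lam)) := by
  have hadd : (addShape lam (colShape m)).card = m * (n + 1) := by
    rw [card_addShape, hlam, card_colShape, mul_add_one]
  have hins : (insertRow m lam).card = m * (n + 1) := by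
    rw [card_insertRow, hlam, mul_add_one]
  have hsq : ∀ {n} (σ : Equiv.Perm (Fin n)), permSign k σ ^ 2 = 1 := fun σ => by
    rw [sq, permSign_mul_self]
  refine ⟨⟨existsUnique_isSchurExpansion m n, ?_⟩, fun hm => ?_, fun hm => ?_⟩
  · rw [plethysmCoeff_eq k hlam, plethysmCoeff_eq k hadd, Nat.cast_le]
    refine foulkesMult_le ?_
    rw [rowWeight_addShape, rowWeight_colShape, add_comm]
  · have h : ∀ {n} (lam : YoungDiagram), lam.card = m * n →
        twistedFoulkesMult k m n (rowShape n) lam = foulkesMult k m n lam.transpose := by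
      intro n lam hlam
      obtain ⟨x₀, h0, hspan, hact⟩ := exists_spechtModule_rowShape k (Fintype.card_fin n).symm
      refine twistedFoulkesMult_eq hlam (fun _ => 1) (fun σ => ?_)
        ⟨x₀, h0, hspan, fun σ => by rw [hact, one_smul]⟩
      obtain ⟨r, rfl⟩ := even_iff_two_dvd.1 hm
      rw [pow_mul, hsq, one_pow, one_mul]
    rw [h lam hlam, h _ hins]
    exact foulkesMult_le_insertRow lam
  · have h : ∀ {n} (lam : YoungDiagram), lam.card = m * n →
        twistedFoulkesMult k m n (colShape n) lam = foulkesMult k m n lam.transpose := by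
      intro n lam hlam
      refine twistedFoulkesMult_eq hlam (permSign k) (fun σ => ?_)
        (exists_spechtModule_colShape k (Fintype.card_fin n).symm)
      obtain ⟨r, rfl⟩ := hm
      rw [← pow_succ, show 2 * r + 1 + 1 = 2 * (r + 1) by ring, pow_mul, hsq, one_pow]
    rw [h lam hlam, h _ hins]
    exact foulkesMult_le_insertRow lam
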